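/- Let $n\ge 1$, $\mathbb T^n=(\mathbb R/2\pi\mathbb Z)^n$, $\bar m=(2\pi)^{-n}$, $T>0$ and $\alpha\in(0,T/2)$. Put $\beta(s)=2\alpha s/T$ for $s\in[0,T/2]$ and $\beta(s)=2\alpha-2\alpha s/T$ for $s\in[T/2,T]$. For $f:\mathbb T^n\to\mathbb R$ let $\hat f(k)=(2\pi)^{-n}\int_{\mathbb T^n}f(x)e^{-ik\cdot x}\,dx$ and $\mathbb Pf=f-(2\pi)^{-n}\int_{\mathbb T^n}f$. Let $B^j$ be the space of continuous $f:\mathbb T^n\to\mathbb R$ with $|f|_{B^j}=\sum_{k\in\mathbb Z^n}(1+|k|^j)|\hat f(k)|<\infty$, where $|k|$ is the Euclidean length, and let $\mathcal B^j_\alpha$ be the space of $f\in C([0,T];B^j)$ with $\|f\|_{\mathcal B^j_\alpha}=\sum_{k\in\mathbb Z^n}\sup_{t\in[0,T]}(1+|k|^j)e^{\beta(t)|k|}|\hat f(t,k)|<\infty$. Let $\mathcal H(t,x,p,m)$ be a continuous real function on $[0,T]\times\mathbb T^n\times\mathbb R^n\times\mathbb R$ that is differentiable in $p$, with $\mathcal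 H_p=\partial\mathcal H/\partial p$, and let $b\in\mathcal B^0_\alpha$. For $w,\mu\in\mathcal B_\alpha^2$ put $\Theta(\cdot,\cdot,Dw,\mu)=\mathcal H_p(\cdot,\cdot,Dw,\mu+\bar m)$ and $\Upsilon(\cdot,\cdot,Dw,\mu)=\mathbb P\mathcal H(\cdot,\cdot,Dw,\mu+\bar m)-b\mu$. Assume: (A2) $\Upsilon(\cdot,\cdot,0,0)=0$ and $\Theta(\cdot,\cdot,0,0)=0$; for all $w,\mu\in\mathcal B^2_\alpha$ one has $\Theta(\cdot,\cdot,Dw,\mu)\in(\mathcal B^1_\alpha)^n$ and $\mathbb P\Upsilon(\cdot,\cdot,Dw,\mu)\in\mathcal B^0_\alpha$; and there are continuous functions $\Phi_1,\Phi_2:(\mathcal B_\alpha^2)^4\to\mathbb R$ with $\Phi_i(w_1,w_2,\mu_1,\mu_2)\to0$ as $(w_1,w_2,\mu_1,\mu_2)\to0$ such that for all $w_1,w_2,\mu_1,\mu_2\in\mathcal B_\alpha^2$ $$\|\Theta(\cdot,\cdot,Dw_1,\mu_1)-\Theta(\cdot,\cdot,Dw_2,\mu_2)\|_{(\mathcal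 B^1_\alpha)^n}\le\Phi_1(w_1,w_2,\mu_1,\mu_2)\big(\|Dw_1-Dw_2\|_{(\mathcal B^1_\alpha)^n}+\|\mu_1-\mu_2\|_{\mathcal B^2_\alpha}\big),$$ $$\|\mathbb P\Upsilon(\cdot,\cdot,Dw_1,\mu_1)-\mathbb P\Upsilon(\cdot,\cdot,Dw_2,\mu_2)\|_{\mathcal B^0_\alpha}\le\Phi_2(w_1,w_2,\mu_1,\mu_2)\big(\|Dw_1-Dw_2\|_{(\mathcal B^1_\alpha)^n}+\|\mu_1-\mu_2\|_{\mathcal B^2_\alpha}\big).$$ Then there exist $\delta>0$ and $r>0$ such that, for every function $u_T$ and every probability density $m_0$ on $\mathbb T^n$ with $\mathbb Pu_T\in B^2$, $m_0-\bar m\in B^2$ and $|\mathbb Pu_T|_{B^2}+|m_0-\bar m|_{B^2}<\delta$, the system $$u_t+\Delta u+\mathcal H(t,x,Du,m)=0,\qquad m_t-\Delta m+\mathrm{div}\big(m\,\mathcal H_p(t,x,Du,m)\big)=0$$ on $[0,T]\times\mathbb T^n$ with $m(0,\cdot)=m_0$ and $u(T,\cdot)=u_T$ has a strong (classical) solution $(u,m)\in(\mathcal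 B^2_\alpha)^2$ with $\|\mathbb Pu\|_{\mathcal B^2_\alpha}+\|m-\bar m\|_{\mathcal B^2_\alpha}<r$, and this is the only strong solution in $(\mathcal B^2_\alpha)^2$ that satisfies this bound. Furthermore, $u(t,\cdot)$ and $m(t,\cdot)$ are real analytic for all $t\in(0,T)$, and $m(t,\cdot)$ is a probability density for all $t\in[0,T]$. -/

import Mathlib

open Set Filter Topology MeasureTheory

open scoped Gradient Laplacian

noncomputable section

namespace MFG

/-- Euclidean `n`-space. Functions on the torus `𝕋ⁿ = (ℝ / 2πℤ)ⁿ` are functions on this space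
that are `2π`-periodic in every coordinate. -/
abbrev E (n : ℕ) : Type := EuclideanSpace ℝ (Fin n)

/-- Space-time functions; only the times in `[0, T]` matter. -/
abbrev SpaceTime (n : ℕ) : Type := ℝ → E n → ℝ

variable {n : ℕ}

/-- `2π`-periodicity in every coordinate. -/
def IsPeriodic {β : Type*} (f : E n → β) : Prop :=
  ∀ (i : Fin n) (x : E n), f (x + EuclideanSpace.single i (2 * Real.pi)) = f x

/-- A fundamental domain of the torus. -/
def box (n : ℕ) : Set (E n) := {x | ∀ i, x i ∈ Ico (0 : ℝ) (2 * Real.pi)}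

/-- `m̄ = 1 / vol(𝕋ⁿ)`, the density of the uniform probability measure. -/
def mbar (n : ℕ) : ℝ := 1 / (2 * Real.pi) ^ n

/-- The spatial mean of a function on the torus. -/
def mean (f : E n → ℝ) : ℝ := mbar n * ∫ x in box n, f x

/-- The projection `ℙ`, which removes the mean. -/
def proj (f : E n → ℝ) : E n → ℝ := fun x => f x - mean f

/-- `ℙ` at each time. -/
def projST (f : SpaceTime n) : SpaceTime n := fun t => proj (f t)

/-- The Euclidean length of a frequency. -/
def freqNorm (k : Fin n → ℤ) : ℝ := Real.sqrt (∑ i, (k i : ℝ) ^ 2)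

/-- Fourier coefficients, `f̂(k) = (2π)⁻ⁿ ∫ f(x) e^{-i k·x} dx`. -/
def torusFourierCoeff (f : E n → ℝ) (k : Fin n → ℤ) : ℂ :=
  (mbar n : ℂ) *
    ∫ x in box n, (f x : ℂ) * Complex.exp (-Complex.I * ((∑ i, (k i : ℝ) * x i : ℝ) : ℂ))

/-- `∑_k (1 + |k|^j) |f̂(k)|`, with values in `[0, ∞]`. -/
def wienerENorm (j : ℕ) (f : E n → ℝ) : ENNReal :=
  ∑' k : Fin n → ℤ, ENNReal.ofReal ((1 + freqNorm k ^ j) * ‖torusFourierCoeff f k‖)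

/-- The space `B^j`. -/
structure MemB (j : ℕ) (f : E n → ℝ) : Prop where
  periodic : IsPeriodic f
  continuous : Continuous f
  finite : wienerENorm j f < ⊤

/-- The norm of `B^j`. -/
def wienerNorm (j : ℕ) (f : E n → ℝ) : ℝ := (wienerENorm j f).toReal

/-- The time-dependent weight `β`. -/
def beta (T α s : ℝ) : ℝ :=
  if s ≤ T / 2 then 2 * α * s / T else 2 * α - 2 * α * s / T

/-- `∑_k sup_{t ∈ [0,T]} (1 + |k|^j) e^{β(t)|k|} |f̂(t,k)|`, with values in `[0, ∞]`. -/
def stENorm (T α : ℝ) (j : ℕ) (f : SpaceTime n) : ENNReal :=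
  ∑' k : Fin n → ℤ, ⨆ t ∈ Icc (0 : ℝ) T,
    ENNReal.ofReal
      ((1 + freqNorm k ^ j) * Real.exp (beta T α t * freqNorm k) * ‖torusFourierCoeff (f t) k‖)

/-- The space `𝓑_α^j`: functions in `C([0,T]; B^j)` with finite norm. -/
structure MemST (T α : ℝ) (j : ℕ) (f : SpaceTime n) : Prop where
  mem : ∀ t ∈ Icc (0 : ℝ) T, MemB j (f t)
  continuous : ∀ t ∈ Icc (0 : ℝ) T,
    Tendsto (fun s => wienerNorm j (f s - f t)) (𝓝[Icc 0 T] t) (𝓝 0)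
  finite : stENorm T α j f < ⊤

/-- The norm of `𝓑_α^j`. -/
def stNorm (T α : ℝ) (j : ℕ) (f : SpaceTime n) : ℝ := (stENorm T α j f).toReal

/-- The space `(𝓑_α^j)ⁿ` of vector fields. -/
def MemSTVec (T α : ℝ) (j : ℕ) (F : ℝ → E n → E n) : Prop :=
  ∀ i : Fin n, MemST T α j (fun t x => F t x i)

/-- The norm of `(𝓑_α^j)ⁿ`. -/
def stNormVec (T α : ℝ) (j : ℕ) (F : ℝ → E n → E n) : ℝ :=
  ∑ i : Fin n, stNorm T α j (fun t x => F t x i)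

/-- The spatial gradient `Dw`. -/
def spaceGrad (w : SpaceTime n) : ℝ → E n → E n := fun t x => ∇ (w t) x

/-- The divergence of a vector field. -/
def divergence (F : E n → E n) (x : E n) : ℝ :=
  ∑ i : Fin n, (fderiv ℝ F x (EuclideanSpace.single i 1)) i

/-- Nonnegative functions on the torus with integral one. -/
def IsProbabilityDensity (f : E n → ℝ) : Prop :=
  (∀ x, 0 ≤ f x) ∧ IntegrableOn f (box n) ∧ ∫ x in box n, f x = 1

/-- A Hamiltonian `(t, x, p, m) ↦ H t x p m`. -/
abbrev Hamiltonian (n : ℕ) : Type := ℝ → E n → E n → ℝ → ℝ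

/-- The derivative `H_p` of the Hamiltonian in its third argument. -/
def Hp (H : Hamiltonian n) (t : ℝ) (x p : E n) (m : ℝ) : E n := ∇ (fun q => H t x q m) p

/-- The Hamiltonian is a continuous function on `[0,T] × 𝕋ⁿ × ℝⁿ × ℝ`, differentiable in `p`. -/
structure IsHamiltonian (T : ℝ) (H : Hamiltonian n) : Prop where
  periodic : ∀ t ∈ Icc (0 : ℝ) T, ∀ p m, IsPeriodic (fun x => H t x p m)
  continuous : ContinuousOn (fun z : ℝ × E n × E n × ℝ => H z.1 z.2.1 z.2.2.1 z.2.2.2)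
    (Icc (0 : ℝ) T ×ˢ univ)
  differentiable : ∀ t ∈ Icc (0 : ℝ) T, ∀ x m, Differentiable ℝ (fun p => H t x p m)

/-- `Θ(t, x, Dw, μ) = H_p(t, x, Dw, μ + m̄)`. -/
def Theta (H : Hamiltonian n) (w μ : SpaceTime n) : ℝ → E n → E n :=
  fun t x => Hp H t x (∇ (w t) x) (μ t x + mbar n)

/-- `Ξ(t, x, Dw, μ) = ℙ H(t, x, Dw, μ + m̄)`. -/
def Xi (H : Hamiltonian n) (w μ : SpaceTime n) : SpaceTime n :=
  projST (fun t x => H t x (∇ (w t) x) (μ t x + mbar n))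

/-- `Υ`, defined by `Ξ(t, x, Dw, μ) = b(t, x) μ + Υ(t, x, Dw, μ)`. -/
def Upsilon (H : Hamiltonian n) (b w μ : SpaceTime n) : SpaceTime n :=
  fun t x => Xi H w μ t x - b t x * μ t x

/-- `Φ` is a continuous real function of four variables in `𝓑_α^2` that tends to `0` as its
arguments tend to `0`. -/
structure IsSmallFactor (T α : ℝ)
    (Φ : SpaceTime n → SpaceTime n → SpaceTime n → SpaceTime n → ℝ) : Prop where
  continuous : ∀ w₁ w₂ μ₁ μ₂, MemST T α 2 w₁ → MemST T α 2 w₂ → MemST T α 2 μ₁ →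
    MemST T α 2 μ₂ → ∀ ε > 0, ∃ δ > 0, ∀ v₁ v₂ ν₁ ν₂,
      MemST T α 2 v₁ → MemST T α 2 v₂ → MemST T α 2 ν₁ → MemST T α 2 ν₂ →
      stNorm T α 2 (v₁ - w₁) < δ → stNorm T α 2 (v₂ - w₂) < δ →
      stNorm T α 2 (ν₁ - μ₁) < δ → stNorm T α 2 (ν₂ - μ₂) < δ →
      |Φ v₁ v₂ ν₁ ν₂ - Φ w₁ w₂ μ₁ μ₂| < ε
  tendsto_zero : ∀ ε > 0, ∃ δ > 0, ∀ w₁ w₂ μ₁ μ₂,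
    MemST T α 2 w₁ → MemST T α 2 w₂ → MemST T α 2 μ₁ → MemST T α 2 μ₂ →
    stNorm T α 2 w₁ < δ → stNorm T α 2 w₂ < δ → stNorm T α 2 μ₁ < δ → stNorm T α 2 μ₂ < δ →
    |Φ w₁ w₂ μ₁ μ₂| < ε

/-- The Lipschitz assumption on the Hamiltonian, in terms of `Θ` and `Υ`. The mapping properties
are part of it: they give a meaning to the norms in the two estimates. -/
structure AssumptionA2 (T α : ℝ) (H : Hamiltonian n) (b : SpaceTime n) : Prop where
  upsilon_zero : ∀ t ∈ Icc (0 : ℝ) T, ∀ x, Upsilon H b 0 0 t x = 0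
  theta_zero : ∀ t ∈ Icc (0 : ℝ) T, ∀ x, Theta H 0 0 t x = 0
  theta_mem : ∀ w μ, MemST T α 2 w → MemST T α 2 μ → MemSTVec T α 1 (Theta H w μ)
  upsilon_mem : ∀ w μ, MemST T α 2 w → MemST T α 2 μ → MemST T α 0 (projST (Upsilon H b w μ))
  theta_lipschitz : ∃ Φ₁ : SpaceTime n → SpaceTime n → SpaceTime n → SpaceTime n → ℝ,
    IsSmallFactor T α Φ₁ ∧ ∀ w₁ w₂ μ₁ μ₂,
      MemST T α 2 w₁ → MemST T α 2 w₂ → MemST T α 2 μ₁ → MemST T α 2 μ₂ →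
      stNormVec T α 1 (Theta H w₁ μ₁ - Theta H w₂ μ₂) ≤
        Φ₁ w₁ w₂ μ₁ μ₂ *
          (stNormVec T α 1 (spaceGrad w₁ - spaceGrad w₂) + stNorm T α 2 (μ₁ - μ₂))
  upsilon_lipschitz : ∃ Φ₂ : SpaceTime n → SpaceTime n → SpaceTime n → SpaceTime n → ℝ,
    IsSmallFactor T α Φ₂ ∧ ∀ w₁ w₂ μ₁ μ₂,
      MemST T α 2 w₁ → MemST T α 2 w₂ → MemST T α 2 μ₁ → MemST T α 2 μ₂ →
      stNorm T α 0 (projST (Upsilon H b w₁ μ₁) - projST (Upsilon H b w₂ μ₂)) ≤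
        Φ₂ w₁ w₂ μ₁ μ₂ *
          (stNormVec T α 1 (spaceGrad w₁ - spaceGrad w₂) + stNorm T α 2 (μ₁ - μ₂))

/-- Strong solutions of the planning problem
`u_t + Δu + H(t,x,Du,m) = 0`, `m_t - Δm + div(m H_p(t,x,Du,m)) = 0`, `m(0) = m₀`, `u(T) = u_T`:
the equations hold at every point of `[0,T] × 𝕋ⁿ` (with one-sided time derivatives at the two
end times), and all derivatives in them exist in the classical sense. -/
structure IsStrongSolution (T : ℝ) (H : Hamiltonian n) (uT m₀ : E n → ℝ)
    (u m : SpaceTime n) : Prop where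
  contDiff_u : ∀ t ∈ Icc (0 : ℝ) T, ContDiff ℝ 2 (u t)
  contDiff_m : ∀ t ∈ Icc (0 : ℝ) T, ContDiff ℝ 2 (m t)
  differentiable_flux : ∀ t ∈ Icc (0 : ℝ) T,
    Differentiable ℝ (fun x => m t x • Hp H t x (∇ (u t) x) (m t x))
  u_equation : ∀ t ∈ Icc (0 : ℝ) T, ∀ x,
    HasDerivWithinAt (fun s => u s x) (-(Δ (u t)) x - H t x (∇ (u t) x) (m t x)) (Icc 0 T) t
  m_equation : ∀ t ∈ Icc (0 : ℝ) T, ∀ x,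
    HasDerivWithinAt (fun s => m s x)
      ((Δ (m t)) x - divergence (fun y => m t y • Hp H t y (∇ (u t) y) (m t y)) x) (Icc 0 T) t
  initial : m 0 = m₀
  terminal : u T = uT

end MFG

end

/-! Write w = ℙu and μ = m − m̄. The mean of u enters neither Du nor Δu, so it decouples and is
recovered at the end by one integration in time. What remains is a forward heat equation for μ with
source −div((μ + m̄)Θ(w, μ)), and a backward heat equation for w whose source is bμ + ℙΥ(w, μ) up to
its spatial mean.

Smoothing. On a mode k ≠ 0 the exponent β(t)|k| changes at rate at most (2α/T)|k|, while the heat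
flow damps at rate |k|². As |k| ≥ 1 and 2α/T < 1, a net rate of at least (1 − 2α/T)|k|² survives, so
solving the heat equation gains two derivatives in the weighted norms, with the constant `gain`
(`exp_beta_mul_norm_le`, `IsHeat.stNorm_le`). Because β vanishes at both end times, the data need
only lie in B²; because β is symmetric, time reversal carries everything over to the backward
equation.

Contraction. Freeze the nonlinear terms at (w, μ), solve for μ', then solve for w' with source bμ' +
ℙΥ(w, μ) (`IsStep`). The coefficient b is not small, so bμ' contains the new density, whose
variation has already been shown to be small. The divergence costs one derivative, and the flux is a
product estimated in 𝓑_α^1, which is an algebra (`stNorm_mul_le`). Assumption (A2) makes the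
Lipschitz constants as small as desired near zero, so the step contracts by 1/2
(`exists_stability`). Zero is a fixed point for zero data, so small data keep a small ball
invariant, and Banach's theorem in ℓ¹ with values in C([0,T]) gives the fixed point
(`exists_fixedPoint_of_contracting`, `exists_fixedPoint_isStep`).

Return to the system. Fixed points yield strong solutions and conversely (`IsStep.isStrongSolution`,
`IsStrongSolution.isStep`), which gives existence and uniqueness. Analyticity is the exponential
decay of coefficients where β > 0. The density keeps its mass because a divergence has mean zero,
and is nonnegative because |μ| ≤ m̄. -/

noncomputable section

namespace MFG

/-! ### Fourier series on the torus -/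

variable {n : ℕ}

/-- The frequency `k` as a vector. -/
def freqVec (k : Fin n → ℤ) : E n := WithLp.toLp 2 fun i => (k i : ℝ)

/-- The linear form `x ↦ k · x`. -/
def phase (k : Fin n → ℤ) : E n →L[ℝ] ℝ := innerSL ℝ (freqVec k)

lemma phase_apply (k : Fin n → ℤ) (x : E n) : phase k x = ∑ i, (k i : ℝ) * x i := by
  simp [phase, freqVec, PiLp.inner_apply, mul_comm]

lemma norm_phase (k : Fin n → ℤ) : ‖phase k‖ = freqNorm k := by
  simp [phase, freqVec, freqNorm, EuclideanSpace.norm_eq]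

lemma freqNorm_eq_norm (k : Fin n → ℤ) : freqNorm k = ‖freqVec k‖ := by
  simp [freqVec, freqNorm, EuclideanSpace.norm_eq]

/-- The character `e^{i k·x}`. -/
def chr (k : Fin n → ℤ) (x : E n) : ℂ := Complex.exp (Complex.I * (phase k x : ℝ))

lemma norm_chr (k : Fin n → ℤ) (x : E n) : ‖chr k x‖ = 1 := by
  rw [chr, mul_comm, Complex.norm_exp_ofReal_mul_I]

lemma continuous_chr (k : Fin n → ℤ) : Continuous (chr k) := by
  unfold chr; fun_prop

lemma phase_add_freq (k l : Fin n → ℤ) (x : E n) : phase (k + l) x = phase k x + phase l x := by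
  simp [phase_apply, add_mul, Finset.sum_add_distrib]

lemma phase_neg_freq (k : Fin n → ℤ) (x : E n) : phase (-k) x = -phase k x := by
  simp [phase_apply]

lemma chr_add (k l : Fin n → ℤ) (x : E n) : chr (k + l) x = chr k x * chr l x := by
  rw [chr, chr, chr, ← Complex.exp_add, phase_add_freq]
  push_cast; ring_nf

lemma chr_neg (k : Fin n → ℤ) (x : E n) : chr (-k) x = (starRingEnd ℂ) (chr k x) := by
  rw [chr, chr, ← Complex.exp_conj, phase_neg_freq]
  simp

lemma chr_zero (x : E n) : chr (0 : Fin n → ℤ) x = 1 := by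
  simp [chr, phase_apply]

/-- Fourier coefficients of a complex-valued function on the torus. -/
def cfc (f : E n → ℂ) (k : Fin n → ℤ) : ℂ :=
  (mbar n : ℂ) * ∫ x in box n, f x * chr (-k) x

lemma torusFourierCoeff_eq_cfc (f : E n → ℝ) (k : Fin n → ℤ) :
    torusFourierCoeff f k = cfc (fun x => (f x : ℂ)) k := by
  unfold torusFourierCoeff cfc
  congr 2
  ext x
  rw [chr, phase_neg_freq, phase_apply]
  push_cast
  ring_nf

lemma IsPeriodic.add_int {β : Type*} {f : E n → β} (hf : IsPeriodic f) (m : Fin n → ℤ) (x : E n) :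
    f (x + WithLp.toLp 2 fun i => 2 * Real.pi * (m i : ℝ)) = f x := by
  have h1 : ∀ (i : Fin n) (j : ℤ) (x : E n),
      f (x + EuclideanSpace.single i (2 * Real.pi * (j : ℝ))) = f x := by
    intro i j
    induction j using Int.induction_on with
    | zero =>
      intro x
      congr 1
      ext l
      simp
    | succ j ih =>
      intro x
      rw [← hf i (x + EuclideanSpace.single i (2 * Real.pi * ((j + 1 : ℤ) : ℝ))) ] at *
      rw [hf i, ← ih x, ← hf i (x + EuclideanSpace.single i (2 * Real.pi * ((j : ℤ) : ℝ)))]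
      congr 1
      ext l
      by_cases h : l = i
      · subst h; simp; ring
      · simp [h]
    | pred j ih =>
      intro x
      rw [← ih x, ← hf i (x + EuclideanSpace.single i (2 * Real.pi * ((-(j : ℤ) - 1 : ℤ) : ℝ)))]
      congr 1
      ext l
      by_cases h : l = i
      · subst h; simp; ring
      · simp [h]
  have h2 : ∀ (s : Finset (Fin n)) (x : E n),
      f (x + ∑ i ∈ s, EuclideanSpace.single i (2 * Real.pi * (m i : ℝ))) = f x := by
    intro s
    induction s using Finset.induction_on with
    | empty => intro x; simp
    | insert i s hi ih =>
      intro x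
      rw [Finset.sum_insert hi, ← add_assoc, ih, h1]
  rw [← h2 Finset.univ x]
  congr 2
  ext l
  simp [Finset.sum_apply, Pi.single_apply]

/-- A function on the torus `(ℝ / ℤ)ⁿ` obtained from a periodic function by rescaling. -/
def toUnitTorus (f : E n → ℂ) (y : UnitAddTorus (Fin n)) : ℂ :=
  f (WithLp.toLp 2 fun i => 2 * Real.pi * ((AddCircle.equivIco 1 0 (y i) : Ico (0:ℝ) (0 + 1)) : ℝ))

/-- The representative in [0, 1) differs from v by an integer vector, which periodicity removes. -/
lemma toUnitTorus_coe {f : E n → ℂ} (hf : IsPeriodic f) (v : Fin n → ℝ) :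
    toUnitTorus f (fun i => (v i : UnitAddCircle)) = f (WithLp.toLp 2 fun i => 2 * Real.pi * v i) := by
  have h : ∀ i, ∃ m : ℤ, v i =
      ((AddCircle.equivIco 1 0 (v i : UnitAddCircle) : Ico (0:ℝ) (0 + 1)) : ℝ) + m := by
    intro i
    have h0 : (((AddCircle.equivIco 1 0 (v i : UnitAddCircle) : Ico (0:ℝ) (0 + 1)) : ℝ) :
      UnitAddCircle) = (v i : UnitAddCircle) := AddCircle.coe_equivIco
    rw [eq_comm, ← sub_eq_zero, ← AddCircle.coe_sub, AddCircle.coe_eq_zero_iff] at h0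
    obtain ⟨m, hm⟩ := h0
    refine ⟨m, ?_⟩
    simp only [zsmul_eq_mul, mul_one] at hm
    linarith
  choose m hm using h
  rw [toUnitTorus, ← hf.add_int m]
  congr 1
  ext i
  simp only [PiLp.add_apply]
  rw [← mul_add, ← hm i]

/-- The chosen representative jumps, so continuity is tested upstairs: the coordinatewise projection
from ℝⁿ is a quotient map, and the pullback is v ↦ f(2πv). -/
lemma continuous_toUnitTorus {f : E n → ℂ} (hf : IsPeriodic f) (hc : Continuous f) :
    Continuous (toUnitTorus f) := by
  have hq : IsOpenQuotientMap (Pi.map fun (_ : Fin n) (t : ℝ) => (t : UnitAddCircle)) :=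
    IsOpenQuotientMap.piMap fun _ => QuotientAddGroup.isOpenQuotientMap_mk
  rw [hq.isQuotientMap.continuous_iff]
  have : toUnitTorus f ∘ (Pi.map fun (_ : Fin n) (t : ℝ) => (t : UnitAddCircle)) =
      fun v => f (WithLp.toLp 2 fun i => 2 * Real.pi * v i) := by
    ext v
    exact toUnitTorus_coe hf v
  rw [this]
  fun_prop

lemma isPeriodic_chr (k : Fin n → ℤ) : IsPeriodic (chr k) := by
  intro i x
  have : phase k (EuclideanSpace.single i (2 * Real.pi)) = (k i : ℝ) * (2 * Real.pi) := by
    rw [phase_apply]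
    simp
  rw [chr, chr, map_add, this]
  rw [Complex.exp_eq_exp_iff_exists_int]
  refine ⟨k i, ?_⟩
  push_cast
  ring

lemma mFourier_coe (k : Fin n → ℤ) (v : Fin n → ℝ) :
    UnitAddTorus.mFourier k (fun i => (v i : UnitAddCircle)) =
      chr k (WithLp.toLp 2 fun i => 2 * Real.pi * v i) := by
  simp only [UnitAddTorus.mFourier, ContinuousMap.coe_mk]
  rw [chr, phase_apply]
  push_cast
  rw [Finset.mul_sum, Complex.exp_sum]
  refine Finset.prod_congr rfl fun i _ => ?_
  rw [fourier_coe_apply]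
  congr 1
  push_cast
  ring

lemma toUnitTorus_chr (k : Fin n → ℤ) : toUnitTorus (chr k) = UnitAddTorus.mFourier k := by
  have hq : IsOpenQuotientMap (Pi.map fun (_ : Fin n) (t : ℝ) => (t : UnitAddCircle)) :=
    IsOpenQuotientMap.piMap fun _ => QuotientAddGroup.isOpenQuotientMap_mk
  ext y
  obtain ⟨v, rfl⟩ := hq.surjective y
  exact (toUnitTorus_coe (isPeriodic_chr k) v).trans (mFourier_coe k v).symm

-- Substitute x = 2πv; the Jacobian (2π)ⁿ cancels `mbar`. The half-open cubes closed on opposite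
-- sides agree up to a null set.
open scoped Pointwise in
lemma integral_box {f : E n → ℂ} :
    (mbar n : ℂ) * ∫ x in box n, f x =
      ∫ v in {v : Fin n → ℝ | ∀ i, v i ∈ Ioc (0 : ℝ) (0 + 1)},
        f (WithLp.toLp 2 fun i => 2 * Real.pi * v i) := by
  have hpi : (2 * Real.pi) ≠ 0 := by positivity
  have h1 : ∫ x in box n, f x =
      ∫ v in Set.pi univ (fun _ : Fin n => Ico (0 : ℝ) (2 * Real.pi)), f (WithLp.toLp 2 v) := by
    have := (EuclideanSpace.volume_preserving_symm_measurableEquiv_toLp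
      (Fin n)).symm.setIntegral_preimage_emb (MeasurableEquiv.measurableEmbedding _) f (box n)
    rw [← this]
    simp only [MeasurableEquiv.symm_symm, MeasurableEquiv.coe_toLp]
    congr 2
    ext v
    simp [box, Set.pi]
  have h2 := Measure.setIntegral_comp_smul (volume : Measure (Fin n → ℝ))
    (fun v => f (WithLp.toLp 2 v)) (Set.pi univ (fun _ : Fin n => Ico (0 : ℝ) 1)) hpi
  have h3 : (2 * Real.pi) • Set.pi univ (fun _ : Fin n => Ico (0 : ℝ) 1) =
      Set.pi univ (fun _ : Fin n => Ico (0 : ℝ) (2 * Real.pi)) := by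
    ext v
    rw [Set.mem_smul_set_iff_inv_smul_mem₀ hpi]
    have hp : 0 < 2 * Real.pi := by positivity
    simp only [Set.mem_pi, mem_univ, true_imp_iff, Pi.smul_apply, smul_eq_mul, mem_Ico]
    refine forall_congr' fun i => ?_
    rw [inv_mul_lt_iff₀ hp, mul_one]
    refine and_congr_left fun _ => ?_
    constructor
    · intro h
      have := mul_nonneg hp.le h
      rwa [mul_inv_cancel_left₀ hpi] at this
    · intro h; positivity
  rw [h1, ← h3]
  have h4 : (mbar n : ℂ) = ((|((2 * Real.pi) ^ Module.finrank ℝ (Fin n → ℝ))⁻¹| : ℝ) : ℂ) := by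
    rw [abs_of_pos (by positivity), Module.finrank_fin_fun, mbar, one_div]
  rw [h4, ← Complex.real_smul, ← h2]
  have h5 : {v : Fin n → ℝ | ∀ i, v i ∈ Ioc (0 : ℝ) (0 + 1)} =
      Set.pi univ (fun _ : Fin n => Ioc (0 : ℝ) 1) := by
    ext v; simp [Set.pi]
  rw [h5]
  exact setIntegral_congr_set (μ := (volume : Measure (Fin n → ℝ)))
    (Measure.univ_pi_Ico_ae_eq_Icc.trans Measure.univ_pi_Ioc_ae_eq_Icc.symm)

lemma cfc_eq_mFourierCoeff {f : E n → ℂ} (hf : IsPeriodic f) (k : Fin n → ℤ) :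
    cfc f k = UnitAddTorus.mFourierCoeff (toUnitTorus f) k := by
  rw [UnitAddTorus.mFourierCoeff_eq_integral _ _ 0, cfc, integral_box]
  refine integral_congr_ae (ae_of_all _ fun v => ?_)
  simp only
  rw [toUnitTorus_coe hf, mFourier_coe, smul_eq_mul, mul_comm]

/-- The trigonometric series with coefficients `a`. -/
def series (a : (Fin n → ℤ) → ℂ) (x : E n) : ℂ := ∑' k, a k * chr k x

lemma summable_series {a : (Fin n → ℤ) → ℂ} (ha : Summable a) (x : E n) :
    Summable fun k => a k * chr k x := by
  refine Summable.of_norm ?_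
  simpa [norm_chr] using ha.norm

lemma isPeriodic_series (a : (Fin n → ℤ) → ℂ) : IsPeriodic (series a) := fun i x => by
  simp only [series, isPeriodic_chr _ i x]

lemma continuous_series {a : (Fin n → ℤ) → ℂ} (ha : Summable a) : Continuous (series a) := by
  refine continuous_tsum (fun k => continuous_const.mul (continuous_chr k)) ha.norm fun k x => ?_
  simp [norm_chr]

lemma series_cfc {f : E n → ℂ} (hf : IsPeriodic f) (hc : Continuous f) (hs : Summable (cfc f)) :
    series (cfc f) = f := by
  ext x
  obtain ⟨v, rfl⟩ : ∃ v : Fin n → ℝ, x = WithLp.toLp 2 fun i => 2 * Real.pi * v i :=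
    ⟨fun i => x i / (2 * Real.pi), by ext i; simp; field_simp⟩
  have h1 : cfc f = UnitAddTorus.mFourierCoeff (toUnitTorus f) := funext (cfc_eq_mFourierCoeff hf)
  let F : C(UnitAddTorus (Fin n), ℂ) := ⟨toUnitTorus f, continuous_toUnitTorus hf hc⟩
  have h2 : Summable (UnitAddTorus.mFourierCoeff F) := by
    rw [h1] at hs; exact hs
  have h3 := UnitAddTorus.hasSum_mFourier_series_apply_of_summable h2 (fun i => (v i : UnitAddCircle))
  rw [← toUnitTorus_coe hf]
  refine Eq.trans ?_ h3.tsum_eq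
  unfold series
  refine tsum_congr fun k => ?_
  rw [mFourier_coe, h1]
  rfl

/-- The Haar measure on the circle, as in the definition of `UnitAddTorus.mFourierCoeff`. -/
local instance : MeasureSpace UnitAddCircle := ⟨AddCircle.haarAddCircle⟩

local instance : IsProbabilityMeasure (volume : Measure UnitAddCircle) :=
  inferInstanceAs (IsProbabilityMeasure AddCircle.haarAddCircle)

/-- The series converges uniformly, hence in L², where the k-th coefficient is a continuous
functional; it passes through the sum, and orthonormality leaves a k. This turns every later
identity between series into one between coefficients. -/
lemma cfc_series {a : (Fin n → ℤ) → ℂ} (ha : Summable a) : cfc (series a) = a := by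
  classical
  ext k
  rw [cfc_eq_mFourierCoeff (isPeriodic_series a)]
  have hs : Summable fun k => a k • (UnitAddTorus.mFourier k : C(UnitAddTorus (Fin n), ℂ)) := by
    refine Summable.of_norm ?_
    simpa [norm_smul, UnitAddTorus.mFourier_norm] using ha.norm
  have hF : toUnitTorus (series a) =
      ⇑(∑' k, a k • (UnitAddTorus.mFourier k : C(UnitAddTorus (Fin n), ℂ))) := by
    ext y
    rw [← ContinuousMap.tsum_apply hs]
    simp only [toUnitTorus, series, ContinuousMap.smul_apply, ← toUnitTorus_chr, smul_eq_mul]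
  rw [hF, ← UnitAddTorus.mFourierCoeff_toLp, ← UnitAddTorus.mFourierBasis_repr,
    UnitAddTorus.mFourierBasis.repr_apply_apply]
  have h1 := ((hs.hasSum.mapL (ContinuousMap.toLp 2 volume ℂ)).mapL
    (innerSL ℂ (UnitAddTorus.mFourierBasis (d := Fin n) k)))
  refine h1.unique ?_
  refine (hasSum_ite_eq k (a k)).congr_fun fun l => ?_
  simp only [map_smul, innerSL_apply_apply, UnitAddTorus.coe_mFourierBasis, smul_eq_mul]
  have := (orthonormal_iff_ite.mp (UnitAddTorus.orthonormal_mFourier (d := Fin n))) k l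
  rw [this]
  by_cases h : l = k <;> simp [h, Ne.symm]

lemma integrableOn_box {F : Type*} [NormedAddCommGroup F] {f : E n → F} (hf : Continuous f) :
    IntegrableOn f (box n) := by
  have hK : IsCompact (WithLp.toLp 2 '' Set.pi univ (fun _ : Fin n => Icc (0 : ℝ) (2 * Real.pi)) :
      Set (E n)) :=
    (isCompact_univ_pi fun _ => isCompact_Icc).image (PiLp.continuous_toLp 2 _)
  refine (hf.continuousOn.integrableOn_compact hK).mono_set fun x hx => ?_
  exact ⟨fun i => x i, fun i _ => ⟨(hx i).1, (hx i).2.le⟩, rfl⟩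

lemma measurableSet_box : MeasurableSet (box n) := by
  have : box n = ⋂ i, (fun x : E n => x i) ⁻¹' Ico (0 : ℝ) (2 * Real.pi) := by
    ext x; simp [box]
  rw [this]
  exact MeasurableSet.iInter fun i => measurableSet_Ico.preimage (by fun_prop)

lemma cfc_add {f g : E n → ℂ} (hf : Continuous f) (hg : Continuous g) (k : Fin n → ℤ) :
    cfc (fun x => f x + g x) k = cfc f k + cfc g k := by
  have h := continuous_chr (-k)
  simp only [cfc, add_mul]
  rw [← mul_add]
  congr 1
  exact integral_add (integrableOn_box (hf.mul h)) (integrableOn_box (hg.mul h))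

lemma cfc_const_mul (c : ℂ) (f : E n → ℂ) (k : Fin n → ℤ) :
    cfc (fun x => c * f x) k = c * cfc f k := by
  simp only [cfc, mul_assoc]
  rw [integral_const_mul]
  ring

lemma cfc_conj (f : E n → ℂ) (k : Fin n → ℤ) :
    cfc (fun x => (starRingEnd ℂ) (f x)) (-k) = (starRingEnd ℂ) (cfc f k) := by
  simp only [cfc, map_mul, Complex.conj_ofReal, ← integral_conj, ← chr_neg, neg_neg]

lemma torusFourierCoeff_add {f g : E n → ℝ} (hf : Continuous f) (hg : Continuous g)
    (k : Fin n → ℤ) : torusFourierCoeff (fun x => f x + g x) k =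
      torusFourierCoeff f k + torusFourierCoeff g k := by
  simp only [torusFourierCoeff_eq_cfc, Complex.ofReal_add]
  exact cfc_add (by fun_prop) (by fun_prop) k

lemma torusFourierCoeff_const_mul (c : ℝ) (f : E n → ℝ) (k : Fin n → ℤ) :
    torusFourierCoeff (fun x => c * f x) k = c * torusFourierCoeff f k := by
  simp only [torusFourierCoeff_eq_cfc, Complex.ofReal_mul]
  exact cfc_const_mul _ _ k

lemma torusFourierCoeff_sub {f g : E n → ℝ} (hf : Continuous f) (hg : Continuous g)
    (k : Fin n → ℤ) : torusFourierCoeff (fun x => f x - g x) k =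
      torusFourierCoeff f k - torusFourierCoeff g k := by
  have h := torusFourierCoeff_add (n := n) hf (g := fun x => (-1) * g x) (by fun_prop) k
  rw [torusFourierCoeff_const_mul] at h
  simp only [neg_one_mul, ← sub_eq_add_neg] at h
  rw [h]
  push_cast
  ring

lemma torusFourierCoeff_sub' {f g : E n → ℝ} (hf : Continuous f) (hg : Continuous g)
    (k : Fin n → ℤ) : torusFourierCoeff (f - g) k =
      torusFourierCoeff f k - torusFourierCoeff g k := torusFourierCoeff_sub hf hg k

lemma torusFourierCoeff_neg_freq (f : E n → ℝ) (k : Fin n → ℤ) :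
    torusFourierCoeff f (-k) = (starRingEnd ℂ) (torusFourierCoeff f k) := by
  rw [torusFourierCoeff_eq_cfc, torusFourierCoeff_eq_cfc, ← cfc_conj]
  simp

lemma torusFourierCoeff_zero_freq (f : E n → ℝ) : torusFourierCoeff f 0 = mean f := by
  rw [torusFourierCoeff_eq_cfc, cfc, mean]
  simp only [neg_zero, chr_zero, mul_one]
  rw [integral_complex_ofReal]
  push_cast
  rfl

lemma series_single (c : ℂ) : series (Pi.single (0 : Fin n → ℤ) c) = fun _ => c := by
  ext x
  rw [series, tsum_eq_single 0]
  · simp [chr_zero]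
  · intro k hk
    simp [hk]

lemma torusFourierCoeff_const (c : ℝ) :
    torusFourierCoeff (fun _ : E n => c) = Pi.single 0 (c : ℂ) := by
  have h : Summable (Pi.single (0 : Fin n → ℤ) (c : ℂ)) :=
    (hasSum_pi_single 0 (c : ℂ)).summable
  rw [← cfc_series h, series_single]
  ext k
  rw [torusFourierCoeff_eq_cfc]

lemma torusFourierCoeff_const_of_ne (c : ℝ) {k : Fin n → ℤ} (hk : k ≠ 0) :
    torusFourierCoeff (fun _ : E n => c) k = 0 := by
  rw [torusFourierCoeff_const, Pi.single_eq_of_ne hk]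

lemma mean_const (c : ℝ) : mean (fun _ : E n => c) = c := by
  have h := torusFourierCoeff_zero_freq (fun _ : E n => c)
  rw [torusFourierCoeff_const, Pi.single_eq_same] at h
  exact_mod_cast h.symm

lemma torusFourierCoeff_zero_fun (k : Fin n → ℤ) : torusFourierCoeff (fun _ : E n => 0) k = 0 := by
  simp [torusFourierCoeff]

lemma continuous_proj {f : E n → ℝ} (hf : Continuous f) : Continuous (proj f) :=
  hf.sub continuous_const

lemma torusFourierCoeff_proj {f : E n → ℝ} (hf : Continuous f) {k : Fin n → ℤ} (hk : k ≠ 0) :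
    torusFourierCoeff (proj f) k = torusFourierCoeff f k := by
  unfold proj
  rw [torusFourierCoeff_sub hf continuous_const, torusFourierCoeff_const_of_ne _ hk, sub_zero]

lemma torusFourierCoeff_proj_zero {f : E n → ℝ} (hf : Continuous f) :
    torusFourierCoeff (proj f) 0 = 0 := by
  unfold proj
  rw [torusFourierCoeff_sub hf continuous_const, torusFourierCoeff_const, Pi.single_eq_same,
    torusFourierCoeff_zero_freq, sub_self]

lemma continuous_of_proj {f : E n → ℝ} (hf : Continuous (proj f)) : Continuous f := by
  have : f = fun x => proj f x + mean f := by ext x; simp [proj]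
  rw [this]
  exact hf.add continuous_const

lemma series_torusFourierCoeff {f : E n → ℝ} (hf : IsPeriodic f) (hc : Continuous f)
    (hs : Summable (torusFourierCoeff f)) (x : E n) : series (torusFourierCoeff f) x = f x := by
  have h1 : torusFourierCoeff f = cfc (fun x => (f x : ℂ)) := funext (torusFourierCoeff_eq_cfc f)
  have h2 : IsPeriodic (fun x => (f x : ℂ)) := fun i x => by simp only [hf i x]
  rw [h1, series_cfc h2 (by fun_prop) (h1 ▸ hs)]

/-- The real part of a trigonometric series. -/
def realSeries (a : (Fin n → ℤ) → ℂ) (x : E n) : ℝ := (series a x).re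

lemma conj_series (a : (Fin n → ℤ) → ℂ) (x : E n) :
    (starRingEnd ℂ) (series a x) = series (fun k => (starRingEnd ℂ) (a (-k))) x := by
  rw [series, Complex.conj_tsum, series, ← (Equiv.neg (Fin n → ℤ)).tsum_eq]
  refine tsum_congr fun k => ?_
  simp [chr_neg]

/-- Conjugation pairs the terms k and −k, so Hermitian coefficients have a real sum. -/
lemma ofReal_realSeries {a : (Fin n → ℤ) → ℂ} (ha : ∀ k, a (-k) = (starRingEnd ℂ) (a k))
    (x : E n) : (realSeries a x : ℂ) = series a x := by
  rw [realSeries, ← Complex.conj_eq_iff_re, conj_series]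
  simp [ha]

lemma continuous_realSeries {a : (Fin n → ℤ) → ℂ} (ha : Summable a) : Continuous (realSeries a) :=
  Complex.continuous_re.comp (continuous_series ha)

lemma isPeriodic_realSeries (a : (Fin n → ℤ) → ℂ) : IsPeriodic (realSeries a) := fun i x => by
  simp only [realSeries, isPeriodic_series a i x]

lemma torusFourierCoeff_realSeries {a : (Fin n → ℤ) → ℂ} (hs : Summable a)
    (ha : ∀ k, a (-k) = (starRingEnd ℂ) (a k)) : torusFourierCoeff (realSeries a) = a := by
  ext k
  rw [torusFourierCoeff_eq_cfc]
  simp only [ofReal_realSeries ha]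
  rw [cfc_series hs]

lemma realSeries_torusFourierCoeff {f : E n → ℝ} (hf : IsPeriodic f) (hc : Continuous f)
    (hs : Summable (torusFourierCoeff f)) : realSeries (torusFourierCoeff f) = f := by
  ext x
  rw [realSeries, series_torusFourierCoeff hf hc hs, Complex.ofReal_re]

/-- Reindexing `(k, l) ↦ (l, k - l)`. -/
def convEquiv (n : ℕ) : (Fin n → ℤ) × (Fin n → ℤ) ≃ (Fin n → ℤ) × (Fin n → ℤ) where
  toFun p := (p.2, p.1 - p.2)
  invFun p := (p.1 + p.2, p.1)
  left_inv p := by simp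
  right_inv p := by simp

lemma summable_conv {R : Type*} [NormedRing R] {a b : (Fin n → ℤ) → R}
    (ha : Summable fun k => ‖a k‖) (hb : Summable fun k => ‖b k‖) :
    Summable fun p : (Fin n → ℤ) × (Fin n → ℤ) => ‖a p.2 * b (p.1 - p.2)‖ := by
  have h : Summable fun p : (Fin n → ℤ) × (Fin n → ℤ) => ‖a p.1 * b p.2‖ :=
    Summable.mul_norm ha hb
  have h2 := (convEquiv n).summable_iff.mpr h
  exact h2

/-- The Fourier coefficients of a product are the convolution of those of the factors. -/
lemma torusFourierCoeff_mul {f g : E n → ℝ} (hf : IsPeriodic f) (hfc : Continuous f)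
    (hfs : Summable (torusFourierCoeff f)) (hg : IsPeriodic g) (hgc : Continuous g)
    (hgs : Summable (torusFourierCoeff g)) (k : Fin n → ℤ) :
    torusFourierCoeff (fun x => f x * g x) k =
      ∑' l, torusFourierCoeff f l * torusFourierCoeff g (k - l) := by
  set a := torusFourierCoeff f
  set b := torusFourierCoeff g
  have h1 := summable_conv hfs.norm hgs.norm
  have h2 : Summable fun k => ∑' l, a l * b (k - l) := h1.of_norm.prod
  -- The product of two absolutely convergent series, regrouped by total frequency, is again a
  -- trigonometric series, so its coefficients can be read off by `cfc_series`.
  have h3 : (fun x => ((f x * g x : ℝ) : ℂ)) = series fun k => ∑' l, a l * b (k - l) := by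
    ext x
    push_cast
    rw [← series_torusFourierCoeff hf hfc hfs, ← series_torusFourierCoeff hg hgc hgs, series,
      series, tsum_mul_tsum_of_summable_norm (summable_series hfs x).norm
        (summable_series hgs x).norm, ← (convEquiv n).tsum_eq, series]
    have h4 : ∀ p : (Fin n → ℤ) × (Fin n → ℤ),
        (a (convEquiv n p).1 * chr (convEquiv n p).1 x) *
          (b (convEquiv n p).2 * chr (convEquiv n p).2 x) =
        a p.2 * b (p.1 - p.2) * chr p.1 x := by
      intro p
      have : p.1 = p.2 + (p.1 - p.2) := by abel
      conv_rhs => rw [this, chr_add]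
      simp only [convEquiv, Equiv.coe_fn_mk]
      rw [← this]
      ring
    simp_rw [h4]
    rw [Summable.tsum_prod]
    · simp_rw [tsum_mul_right]
    · refine Summable.of_norm ?_
      simpa [norm_chr] using h1
  rw [torusFourierCoeff_eq_cfc, h3, cfc_series h2]

end MFG

end

/-! ### Derivatives and analyticity of trigonometric series -/

noncomputable section

namespace MFG

variable {n : ℕ}

lemma freqNorm_nonneg (k : Fin n → ℤ) : 0 ≤ freqNorm k := Real.sqrt_nonneg _

lemma abs_phase_le (k : Fin n → ℤ) (v : E n) : |phase k v| ≤ freqNorm k * ‖v‖ := by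
  rw [← norm_phase]
  exact (phase k).le_opNorm v

lemma phase_single (k : Fin n → ℤ) (i : Fin n) : phase k (EuclideanSpace.single i 1) = k i := by
  simp [phase_apply]

/-- The complexified linear form `v ↦ i k·v`. -/
def iphase (k : Fin n → ℤ) : E n →L[ℝ] ℂ := Complex.I • Complex.ofRealCLM.comp (phase k)

lemma iphase_apply (k : Fin n → ℤ) (v : E n) : iphase k v = Complex.I * (phase k v : ℝ) := by
  simp [iphase]

lemma norm_iphase_le (k : Fin n → ℤ) : ‖iphase k‖ ≤ freqNorm k := by
  refine ContinuousLinearMap.opNorm_le_bound _ (freqNorm_nonneg k) fun v => ?_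
  rw [iphase_apply]
  simpa using abs_phase_le k v

lemma norm_iphase_single_le (k : Fin n → ℤ) (i : Fin n) :
    ‖iphase k (EuclideanSpace.single i 1)‖ ≤ freqNorm k := by
  simpa using (iphase k).le_of_opNorm_le (norm_iphase_le k) (EuclideanSpace.single i 1)

lemma hasFDerivAt_chr (k : Fin n → ℤ) (x : E n) :
    HasFDerivAt (chr k) (chr k x • iphase k) x := by
  have h : HasFDerivAt (fun y : E n => iphase k y) (iphase k) x := (iphase k).hasFDerivAt
  have h2 := h.cexp
  have h3 : chr k = fun y => Complex.exp (iphase k y) := by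
    ext y
    rw [chr, iphase_apply]
  rw [h3]
  exact h2

/-- The coefficients of the derivative along `v`. -/
def derivCoeff (a : (Fin n → ℤ) → ℂ) (v : E n) (k : Fin n → ℤ) : ℂ := iphase k v * a k

lemma summable_derivCoeff {a : (Fin n → ℤ) → ℂ} (ha : Summable fun k => freqNorm k * ‖a k‖)
    (v : E n) : Summable (derivCoeff a v) := by
  refine Summable.of_norm_bounded (ha.mul_left ‖v‖) fun k => ?_
  rw [derivCoeff, norm_mul, ← mul_assoc, mul_comm ‖v‖]
  gcongr
  exact (iphase k).le_of_opNorm_le (norm_iphase_le k) v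

lemma hasFDerivAt_series {a : (Fin n → ℤ) → ℂ} (ha0 : Summable a)
    (ha : Summable fun k => freqNorm k * ‖a k‖) (x : E n) :
    HasFDerivAt (series a) (∑' k, a k • chr k x • iphase k) x := by
  refine hasFDerivAt_tsum ha (fun k x => (hasFDerivAt_chr k x).const_smul (a k)) (fun k x => ?_)
    (summable_series ha0 0) x
  rw [norm_smul, norm_smul, norm_chr, one_mul, mul_comm]
  gcongr
  exact norm_iphase_le k

lemma fderiv_series_apply {a : (Fin n → ℤ) → ℂ} (ha0 : Summable a)
    (ha : Summable fun k => freqNorm k * ‖a k‖) (x v : E n) :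
    fderiv ℝ (series a) x v = series (derivCoeff a v) x := by
  rw [(hasFDerivAt_series ha0 ha x).fderiv]
  have hs : Summable fun k => a k • chr k x • iphase k := by
    refine Summable.of_norm_bounded ha fun k => ?_
    rw [norm_smul, norm_smul, norm_chr, one_mul, mul_comm]
    gcongr
    exact norm_iphase_le k
  have := (ContinuousLinearMap.apply ℝ ℂ v).map_tsum hs
  simp only [ContinuousLinearMap.apply_apply] at this
  rw [this, series]
  refine tsum_congr fun k => ?_
  simp only [_root_.smul_apply, smul_eq_mul, derivCoeff]
  ring

lemma contDiff_one_series {a : (Fin n → ℤ) → ℂ} (ha0 : Summable a)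
    (ha : Summable fun k => freqNorm k * ‖a k‖) : ContDiff ℝ 1 (series a) := by
  rw [show (1 : WithTop ℕ∞) = 0 + 1 by simp, contDiff_succ_iff_fderiv_apply]
  refine ⟨fun x => (hasFDerivAt_series ha0 ha x).differentiableAt, by simp, fun v => ?_⟩
  rw [contDiff_zero]
  simp_rw [fderiv_series_apply ha0 ha]
  exact continuous_series (summable_derivCoeff ha v)

/-- Termwise from |k| ≤ 1 + |k|². -/
lemma summable_freqNorm_mul {a : (Fin n → ℤ) → ℂ} (ha0 : Summable a)
    (ha : Summable fun k => freqNorm k ^ 2 * ‖a k‖) : Summable fun k => freqNorm k * ‖a k‖ := by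
  refine Summable.of_nonneg_of_le (fun k => mul_nonneg (freqNorm_nonneg k) (norm_nonneg _))
    (fun k => ?_) (ha0.norm.add ha)
  nlinarith [mul_nonneg (sq_nonneg (freqNorm k - 1)) (norm_nonneg (a k)), norm_nonneg (a k),
    mul_nonneg (sq_nonneg (freqNorm k)) (norm_nonneg (a k))]

lemma summable_freqNorm_mul_derivCoeff {a : (Fin n → ℤ) → ℂ}
    (ha : Summable fun k => freqNorm k ^ 2 * ‖a k‖) (v : E n) :
    Summable fun k => freqNorm k * ‖derivCoeff a v k‖ := by
  refine Summable.of_nonneg_of_le (fun k => mul_nonneg (freqNorm_nonneg k) (norm_nonneg _))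
    (fun k => ?_) (ha.mul_left ‖v‖)
  have := (iphase k).le_of_opNorm_le (norm_iphase_le k) v
  rw [derivCoeff, norm_mul]
  calc freqNorm k * (‖iphase k v‖ * ‖a k‖) ≤ freqNorm k * ((freqNorm k * ‖v‖) * ‖a k‖) := by
        gcongr; exact freqNorm_nonneg k
    _ = _ := by ring

lemma contDiff_two_series {a : (Fin n → ℤ) → ℂ} (ha0 : Summable a)
    (ha : Summable fun k => freqNorm k ^ 2 * ‖a k‖) : ContDiff ℝ 2 (series a) := by
  have ha1 := summable_freqNorm_mul ha0 ha
  rw [show (2 : WithTop ℕ∞) = 1 + 1 by norm_num, contDiff_succ_iff_fderiv_apply]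
  refine ⟨fun x => (hasFDerivAt_series ha0 ha1 x).differentiableAt, by simp, fun v => ?_⟩
  simp_rw [fderiv_series_apply ha0 ha1]
  exact contDiff_one_series (summable_derivCoeff ha1 v) (summable_freqNorm_mul_derivCoeff ha v)

lemma contDiff_two_realSeries {a : (Fin n → ℤ) → ℂ} (ha0 : Summable a)
    (ha : Summable fun k => freqNorm k ^ 2 * ‖a k‖) : ContDiff ℝ 2 (realSeries a) :=
  Complex.reCLM.contDiff.comp (contDiff_two_series ha0 ha)

lemma differentiable_realSeries {a : (Fin n → ℤ) → ℂ} (ha0 : Summable a)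
    (ha : Summable fun k => freqNorm k * ‖a k‖) : Differentiable ℝ (realSeries a) :=
  (Complex.reCLM.contDiff.comp (contDiff_one_series ha0 ha)).differentiable one_ne_zero

lemma fderiv_realSeries_apply {a : (Fin n → ℤ) → ℂ} (ha0 : Summable a)
    (ha : Summable fun k => freqNorm k * ‖a k‖) (x v : E n) :
    fderiv ℝ (realSeries a) x v = realSeries (derivCoeff a v) x := by
  have h := Complex.reCLM.hasFDerivAt.comp x (hasFDerivAt_series ha0 ha x)
  have h2 : fderiv ℝ (realSeries a) x = _ := h.fderiv
  rw [h2, ← (hasFDerivAt_series ha0 ha x).fderiv, ContinuousLinearMap.comp_apply,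
    fderiv_series_apply ha0 ha, realSeries, Complex.reCLM_apply]

lemma gradient_apply (f : E n → ℝ) (x : E n) (i : Fin n) :
    (∇ f x) i = fderiv ℝ f x (EuclideanSpace.single i 1) := by
  have : inner ℝ (∇ f x) (EuclideanSpace.single i (1 : ℝ)) =
      fderiv ℝ f x (EuclideanSpace.single i 1) := by
    rw [gradient, InnerProductSpace.toDual_symm_apply]
  rw [← this, EuclideanSpace.inner_single_right]
  simp only [one_mul, conj_trivial]

lemma sq_freqNorm (k : Fin n → ℤ) : freqNorm k ^ 2 = ∑ i, (k i : ℝ) ^ 2 :=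
  Real.sq_sqrt (Finset.sum_nonneg fun _ _ => sq_nonneg _)

lemma laplacian_realSeries {a : (Fin n → ℤ) → ℂ} (ha0 : Summable a)
    (ha : Summable fun k => freqNorm k ^ 2 * ‖a k‖) (x : E n) :
    (Δ (realSeries a)) x = realSeries (fun k => -(freqNorm k ^ 2 : ℝ) * a k) x := by
  have ha1 := summable_freqNorm_mul ha0 ha
  have hd : ∀ v, Summable (derivCoeff (derivCoeff a v) v) := fun v =>
    summable_derivCoeff (summable_freqNorm_mul_derivCoeff ha v) v
  rw [InnerProductSpace.laplacian_eq_iteratedFDeriv_orthonormalBasis _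
    (EuclideanSpace.basisFun (Fin n) ℝ)]
  have h : ∀ v : E n, (iteratedFDeriv ℝ 2 (realSeries a) x) ![v, v] =
      realSeries (derivCoeff (derivCoeff a v) v) x := by
    intro v
    rw [iteratedFDeriv_two_apply]
    simp only [Matrix.cons_val_zero, Matrix.cons_val_one]
    have hdf : DifferentiableAt ℝ (fderiv ℝ (realSeries a)) x :=
      ((contDiff_two_realSeries ha0 ha).fderiv_right (m := 1) (by norm_num)).differentiable
        one_ne_zero x
    have h2 : fderiv ℝ (fun y => fderiv ℝ (realSeries a) y v) x v =
        fderiv ℝ (fderiv ℝ (realSeries a)) x v v := by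
      rw [fderiv_clm_apply hdf (differentiableAt_const v)]
      simp
    rw [← h2]
    simp_rw [fderiv_realSeries_apply ha0 ha1]
    rw [fderiv_realSeries_apply (summable_derivCoeff ha1 v)
      (summable_freqNorm_mul_derivCoeff ha v)]
  simp only [h, EuclideanSpace.basisFun_apply]
  simp only [realSeries]
  rw [← Complex.re_sum]
  simp only [series]
  rw [← Summable.tsum_finsetSum fun i _ => summable_series (hd _) x]
  congr 1
  refine tsum_congr fun k => ?_
  rw [← Finset.sum_mul, sq_freqNorm]
  congr 1
  simp only [derivCoeff, iphase_apply, phase_single]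
  push_cast
  rw [← Finset.sum_neg_distrib, Finset.sum_mul]
  refine Finset.sum_congr rfl fun i _ => ?_
  linear_combination ((k i : ℂ) * (k i : ℂ) * a k) * Complex.I_mul_I

/-- Expand each character about x by the exponential series. The double series over frequency and
degree is dominated by ‖a k‖ |k|^m r^m / m!, whose total is the assumed sum with weight e^{r|k|}.
Fubini then allows summation over frequencies first, which produces a power series of radius at
least r. -/
lemma analyticAt_series {a : (Fin n → ℤ) → ℂ} {r : ℝ} (hr : 0 < r)
    (ha : Summable fun k => ‖a k‖ * Real.exp (r * freqNorm k)) (x : E n) :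
    AnalyticAt ℝ (series a) x := by
  let q : (Fin n → ℤ) → FormalMultilinearSeries ℝ (E n) ℂ := fun k m =>
    (a k * chr k x) • (NormedSpace.expSeries ℝ ℂ m).compContinuousLinearMap fun _ => iphase k
  have hq : ∀ k m, ‖q k m‖ ≤ ‖a k‖ * (freqNorm k ^ m / m.factorial) := by
    intro k m
    simp only [q]
    rw [norm_smul, norm_mul, norm_chr, mul_one]
    gcongr
    refine (ContinuousMultilinearMap.norm_compContinuousLinearMap_le _ _).trans ?_
    rw [Finset.prod_const, Finset.card_univ, Fintype.card_fin, NormedSpace.expSeries, norm_smul,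
      ContinuousMultilinearMap.norm_mkPiAlgebraFin, mul_one, norm_inv, div_eq_inv_mul]
    gcongr
    · simp
    · exact norm_iphase_le k
  have hsum : ∀ s : ℝ, 0 ≤ s → s ≤ r → Summable fun p : (Fin n → ℤ) × ℕ =>
      ‖a p.1‖ * (freqNorm p.1 ^ p.2 / p.2.factorial) * s ^ p.2 := by
    intro s hs hsr
    have h1 : ∀ k : Fin n → ℤ, HasSum (fun m : ℕ => ‖a k‖ * (freqNorm k ^ m / m.factorial) * s ^ m)
        (‖a k‖ * Real.exp (s * freqNorm k)) := by
      intro k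
      have := (NormedSpace.expSeries_div_hasSum_exp (s * freqNorm k)).mul_left ‖a k‖
      rw [← Real.exp_eq_exp_ℝ] at this
      refine this.congr_fun fun m => ?_
      rw [mul_pow]; ring
    rw [summable_prod_of_nonneg]
    · refine ⟨fun k => (h1 k).summable, ?_⟩
      simp_rw [(h1 _).tsum_eq]
      refine Summable.of_nonneg_of_le (fun k => by positivity) (fun k => ?_) ha
      gcongr
      exact freqNorm_nonneg k
    · intro p
      have := freqNorm_nonneg p.1
      simp only [Pi.zero_apply]
      positivity
  let p : FormalMultilinearSeries ℝ (E n) ℂ := fun m => ∑' k, q k m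
  have hqs : ∀ m, Summable fun k => ‖q k m‖ := by
    intro m
    have h1 := ((hsum r hr.le le_rfl).prod_symm.prod_factor m).mul_right ((r ^ m)⁻¹)
    refine Summable.of_nonneg_of_le (fun k => norm_nonneg _) (fun k => (hq k m).trans ?_) h1
    simp only [Prod.swap]
    rw [mul_assoc, mul_inv_cancel₀ (by positivity), mul_one]
  refine ⟨p, ENNReal.ofReal r, ?_, ENNReal.ofReal_pos.mpr hr, ?_⟩
  · refine p.le_radius_of_summable_norm (r := r.toNNReal) ?_
    refine Summable.of_nonneg_of_le (fun m => by positivity) (fun m => ?_)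
      (hsum r hr.le le_rfl).prod_symm.prod
    rw [Real.coe_toNNReal r hr.le]
    simp only [Prod.swap]
    rw [tsum_mul_right]
    gcongr
    refine (norm_tsum_le_tsum_norm (hqs m)).trans ?_
    refine Summable.tsum_le_tsum (fun k => hq k m) (hqs m) ?_
    have h1 := ((hsum r hr.le le_rfl).prod_symm.prod_factor m).mul_right ((r ^ m)⁻¹)
    refine h1.congr fun k => ?_
    simp only [Prod.swap]
    rw [mul_assoc, mul_inv_cancel₀ (by positivity), mul_one]
  · intro y hy
    have hy' : ‖y‖ < r := by
      rw [Metric.mem_eball, edist_zero_right] at hy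
      have := (ENNReal.lt_ofReal_iff_toReal_lt (by simp)).mp hy
      simpa using this
    have hval : ∀ k m, q k m (fun _ => y) = (a k * chr k x) * ((iphase k y) ^ m / m.factorial) := by
      intro k m
      simp only [q]
      rw [_root_.smul_apply, ContinuousMultilinearMap.compContinuousLinearMap_apply,
        NormedSpace.expSeries_apply_eq_div, smul_eq_mul]
    have hs2 : Summable fun z : (Fin n → ℤ) × ℕ => q z.1 z.2 (fun _ => y) := by
      refine Summable.of_norm_bounded (hsum ‖y‖ (norm_nonneg _) hy'.le) fun z => ?_
      refine ((q z.1 z.2).le_opNorm _).trans ?_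
      rw [Finset.prod_const, Finset.card_univ, Fintype.card_fin]
      gcongr
      exact hq z.1 z.2
    -- Summing over degrees first rebuilds the characters at x + y.
    have h1 : HasSum (fun z : (Fin n → ℤ) × ℕ => q z.1 z.2 (fun _ => y)) (series a (x + y)) := by
      rw [hs2.hasSum_iff, hs2.tsum_prod, series]
      refine tsum_congr fun k => ?_
      simp_rw [hval]
      rw [tsum_mul_left, (NormedSpace.expSeries_div_hasSum_exp (iphase k y)).tsum_eq, mul_assoc,
        ← Complex.exp_eq_exp_ℂ, chr, chr, ← Complex.exp_add, map_add, iphase_apply]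
      push_cast
      ring_nf
    -- Summing over frequencies first gives the terms of p.
    have h2 := (hs2.prod_symm).hasSum.prod_fiberwise fun m =>
      (hs2.prod_symm.prod_factor m).hasSum
    have h3 : ∑' z : ℕ × (Fin n → ℤ), q z.swap.1 z.swap.2 (fun _ => y) = series a (x + y) := by
      rw [← h1.tsum_eq]
      exact (Equiv.prodComm ℕ (Fin n → ℤ)).tsum_eq
        (fun z : (Fin n → ℤ) × ℕ => q z.1 z.2 (fun _ => y))
    rw [h3] at h2
    refine h2.congr_fun fun m => ?_
    simp only [p, Prod.swap]
    have := (ContinuousMultilinearMap.apply ℝ (fun _ : Fin m => E n) ℂ (fun _ => y)).map_tsum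
      (hqs m).of_norm
    simpa using this

lemma analyticOnNhd_realSeries {a : (Fin n → ℤ) → ℂ} {r : ℝ} (hr : 0 < r)
    (ha : Summable fun k => ‖a k‖ * Real.exp (r * freqNorm k)) :
    AnalyticOnNhd ℝ (realSeries a) univ := fun x _ =>
  (Complex.reCLM.analyticAt _).comp (analyticAt_series hr ha x)

/-! ### The time weight and weighted coefficients -/

/-- As a minimum of two affine functions, β is visibly continuous, nonnegative on [0, T], Lipschitz
and symmetric about T/2. -/
lemma beta_eq_min {T α : ℝ} (hT : 0 < T) (hα : 0 < α) (t : ℝ) :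
    beta T α t = min (2 * α / T * t) (2 * α / T * (T - t)) := by
  have h1 : 2 * α * t / T = 2 * α / T * t := by ring
  have h2 : 2 * α - 2 * α * t / T = 2 * α / T * (T - t) := by field_simp
  unfold beta
  rw [h2, h1]
  have hc : 0 < 2 * α / T := by positivity
  split_ifs with h
  · rw [min_eq_left]
    gcongr
    linarith
  · rw [min_eq_right]
    gcongr
    linarith

lemma beta_nonneg {T α t : ℝ} (hT : 0 < T) (hα : 0 < α) (ht : t ∈ Icc 0 T) : 0 ≤ beta T α t := by
  rw [beta_eq_min hT hα]
  have hc : 0 < 2 * α / T := by positivity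
  exact le_min (mul_nonneg hc.le ht.1) (mul_nonneg hc.le (sub_nonneg.mpr ht.2))

lemma beta_pos {T α t : ℝ} (hT : 0 < T) (hα : 0 < α) (ht : t ∈ Ioo 0 T) : 0 < beta T α t := by
  rw [beta_eq_min hT hα]
  have hc : 0 < 2 * α / T := by positivity
  exact lt_min (mul_pos hc ht.1) (mul_pos hc (sub_pos.mpr ht.2))

/-- This slope, multiplied by |k|, is the growth of the exponent that the damping |k|² has to beat.
-/
lemma beta_sub_le {T α : ℝ} (hT : 0 < T) (hα : 0 < α) (s t : ℝ) :
    beta T α t - beta T α s ≤ 2 * α / T * |t - s| := by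
  have hc : 0 < 2 * α / T := by positivity
  rw [beta_eq_min hT hα, beta_eq_min hT hα]
  refine (le_abs_self _).trans ((abs_min_sub_min_le_max _ _ _ _).trans (max_le ?_ ?_))
  · rw [← mul_sub, abs_mul, abs_of_pos hc]
  · rw [← mul_sub, abs_mul, abs_of_pos hc, sub_sub_sub_cancel_left, abs_sub_comm]

/-- This symmetry makes the norms invariant under time reversal, so the backward equation needs no
estimates of its own. -/
lemma beta_reflect {T α : ℝ} (hT : 0 < T) (hα : 0 < α) (t : ℝ) :
    beta T α (T - t) = beta T α t := by
  rw [beta_eq_min hT hα, beta_eq_min hT hα, sub_sub_cancel, min_comm]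

lemma beta_zero {T α : ℝ} (hT : 0 < T) : beta T α 0 = 0 := by
  rw [beta, if_pos (by positivity)]; simp

lemma continuous_beta {T α : ℝ} (hT : 0 < T) (hα : 0 < α) : Continuous (beta T α) := by
  simp only [funext (beta_eq_min hT hα)]
  fun_prop

/-- The weight in the norm of `𝓑_α^j`. -/
def weight (T α : ℝ) (j : ℕ) (k : Fin n → ℤ) (t : ℝ) : ℝ :=
  (1 + freqNorm k ^ j) * Real.exp (beta T α t * freqNorm k)

lemma weight_pos (T α : ℝ) (j : ℕ) (k : Fin n → ℤ) (t : ℝ) : 0 < weight T α j k t := by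
  have := freqNorm_nonneg k
  unfold weight; positivity

lemma le_weight {T α t : ℝ} (hT : 0 < T) (hα : 0 < α) (ht : t ∈ Icc 0 T) (j : ℕ)
    (k : Fin n → ℤ) : 1 + freqNorm k ^ j ≤ weight T α j k t := by
  have h := freqNorm_nonneg k
  have h2 : 1 ≤ Real.exp (beta T α t * freqNorm k) :=
    Real.one_le_exp (mul_nonneg (beta_nonneg hT hα ht) h)
  exact le_mul_of_one_le_right (by positivity) h2

lemma one_le_weight {T α t : ℝ} (hT : 0 < T) (hα : 0 < α) (ht : t ∈ Icc 0 T) (j : ℕ)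
    (k : Fin n → ℤ) : 1 ≤ weight T α j k t := by
  have h := freqNorm_nonneg k
  refine le_trans ?_ (le_weight hT hα ht j k)
  have : 0 ≤ freqNorm k ^ j := by positivity
  linarith

lemma freqNorm_add_le (k l : Fin n → ℤ) : freqNorm (k + l) ≤ freqNorm k + freqNorm l := by
  simp only [freqNorm_eq_norm]
  refine le_trans (le_of_eq ?_) (norm_add_le _ _)
  congr 1
  ext i
  simp [freqVec]

/-- The exponential factor uses the triangle inequality and β ≥ 0. The polynomial factor restricts
j: for j = 2 and k = l of length one it would read 5 ≤ 4. -/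
lemma weight_submultiplicative {T α t : ℝ} (hT : 0 < T) (hα : 0 < α) (ht : t ∈ Icc 0 T) {j : ℕ}
    (hj : j ≤ 1) (k l : Fin n → ℤ) :
    weight T α j (k + l) t ≤ weight T α j k t * weight T α j l t := by
  have hk := freqNorm_nonneg k
  have hl := freqNorm_nonneg l
  have hkl := freqNorm_add_le k l
  have hb := beta_nonneg hT hα ht
  have h1 : 1 + freqNorm (k + l) ^ j ≤ (1 + freqNorm k ^ j) * (1 + freqNorm l ^ j) := by
    interval_cases j
    · norm_num
    · simp only [pow_one]
      nlinarith [mul_nonneg hk hl]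
  have h2 : Real.exp (beta T α t * freqNorm (k + l)) ≤
      Real.exp (beta T α t * freqNorm k) * Real.exp (beta T α t * freqNorm l) := by
    rw [← Real.exp_add, ← mul_add]
    gcongr
  unfold weight
  calc _ ≤ ((1 + freqNorm k ^ j) * (1 + freqNorm l ^ j)) *
        (Real.exp (beta T α t * freqNorm k) * Real.exp (beta T α t * freqNorm l)) := by gcongr
    _ = _ := by ring

/-- The weighted supremum in time of a single Fourier coefficient. -/
def supCoeff (T α : ℝ) (j : ℕ) (k : Fin n → ℤ) (y : ℝ → ℂ) : ENNReal :=
  ⨆ t ∈ Icc (0 : ℝ) T, ENNReal.ofReal (weight T α j k t * ‖y t‖)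

lemma stENorm_eq (T α : ℝ) (j : ℕ) (f : SpaceTime n) :
    stENorm T α j f = ∑' k, supCoeff T α j k fun t => torusFourierCoeff (f t) k := rfl

lemma le_supCoeff {T α t : ℝ} (ht : t ∈ Icc 0 T) (j : ℕ) (k : Fin n → ℤ) (y : ℝ → ℂ) :
    ENNReal.ofReal (weight T α j k t * ‖y t‖) ≤ supCoeff T α j k y :=
  le_iSup₂ (f := fun t (_ : t ∈ Icc (0 : ℝ) T) => ENNReal.ofReal (weight T α j k t * ‖y t‖)) t ht

lemma supCoeff_le {T α : ℝ} {j : ℕ} {k : Fin n → ℤ} {y : ℝ → ℂ} {C : ENNReal}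
    (h : ∀ t ∈ Icc 0 T, ENNReal.ofReal (weight T α j k t * ‖y t‖) ≤ C) :
    supCoeff T α j k y ≤ C := iSup₂_le h

lemma supCoeff_congr {T α : ℝ} {j : ℕ} {k : Fin n → ℤ} {y z : ℝ → ℂ}
    (h : ∀ t ∈ Icc 0 T, y t = z t) : supCoeff T α j k y = supCoeff T α j k z :=
  biSup_congr fun t ht => by rw [h t ht]

lemma supCoeff_add_le (T α : ℝ) (j : ℕ) (k : Fin n → ℤ) (y z : ℝ → ℂ) :
    supCoeff T α j k (fun t => y t + z t) ≤ supCoeff T α j k y + supCoeff T α j k z := by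
  refine supCoeff_le fun t ht => ?_
  refine le_trans ?_ (add_le_add (le_supCoeff ht j k y) (le_supCoeff ht j k z))
  have hw := (weight_pos T α j k t).le
  rw [← ENNReal.ofReal_add (by positivity) (by positivity), ← mul_add]
  gcongr
  exact norm_add_le _ _

lemma supCoeff_const_mul_le (T α : ℝ) (j : ℕ) (k : Fin n → ℤ) (c : ℂ) (y : ℝ → ℂ) :
    supCoeff T α j k (fun t => c * y t) ≤ ENNReal.ofReal ‖c‖ * supCoeff T α j k y := by
  refine supCoeff_le fun t ht => ?_
  refine le_trans (le_of_eq ?_) (mul_le_mul_right (le_supCoeff ht j k y) _)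
  rw [← ENNReal.ofReal_mul (norm_nonneg _), norm_mul]
  ring_nf

lemma stENorm_congr {T α : ℝ} {j : ℕ} {f g : SpaceTime n} (h : ∀ t ∈ Icc 0 T, f t = g t) :
    stENorm T α j f = stENorm T α j g := by
  simp only [stENorm_eq]
  exact tsum_congr fun k => supCoeff_congr fun t ht => by rw [h t ht]

lemma stNorm_congr {T α : ℝ} {j : ℕ} {f g : SpaceTime n} (h : ∀ t ∈ Icc 0 T, f t = g t) :
    stNorm T α j f = stNorm T α j g := by
  rw [stNorm, stNorm, stENorm_congr h]

/-- A function of finite norm has a summable majorant for its weighted coefficients. -/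
lemma exists_majorant {T α : ℝ} {j : ℕ} {a : ℝ → (Fin n → ℤ) → ℂ}
    (h : ∑' k, supCoeff T α j k (fun t => a t k) < ⊤) :
    ∃ M : (Fin n → ℤ) → ℝ, Summable M ∧ (∀ k, 0 ≤ M k) ∧
      ∀ t ∈ Icc (0 : ℝ) T, ∀ k, weight T α j k t * ‖a t k‖ ≤ M k := by
  refine ⟨fun k => (supCoeff T α j k fun t => a t k).toReal, ENNReal.summable_toReal h.ne,
    fun k => ENNReal.toReal_nonneg, fun t ht k => ?_⟩
  have h1 := le_supCoeff (α := α) ht j k fun t => a t k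
  rwa [ENNReal.ofReal_le_iff_le_toReal (ENNReal.ne_top_of_tsum_ne_top h.ne k)] at h1

lemma tsum_supCoeff_lt_top {T α : ℝ} {j : ℕ} {a : ℝ → (Fin n → ℤ) → ℂ}
    {M : (Fin n → ℤ) → ℝ} (hM : Summable M)
    (h : ∀ t ∈ Icc (0 : ℝ) T, ∀ k, weight T α j k t * ‖a t k‖ ≤ M k) :
    ∑' k, supCoeff T α j k (fun t => a t k) < ⊤ := by
  refine lt_of_le_of_lt (ENNReal.tsum_le_tsum fun k => supCoeff_le fun t ht =>
    ENNReal.ofReal_le_ofReal (h t ht k)) ?_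
  exact hM.tsum_ofReal_lt_top

lemma norm_le_of_weight_mul_norm_le {T α t M : ℝ} (hT : 0 < T) (hα : 0 < α) (ht : t ∈ Icc 0 T)
    {j : ℕ} {k : Fin n → ℤ} {z : ℂ} (h : weight T α j k t * ‖z‖ ≤ M) : ‖z‖ ≤ M :=
  le_trans (le_mul_of_one_le_left (norm_nonneg _) (one_le_weight hT hα ht j k)) h

lemma freqNorm_pow_mul_norm_le {T α t M : ℝ} (hT : 0 < T) (hα : 0 < α) (ht : t ∈ Icc 0 T)
    {j : ℕ} {k : Fin n → ℤ} {z : ℂ} (h : weight T α j k t * ‖z‖ ≤ M) :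
    freqNorm k ^ j * ‖z‖ ≤ M := by
  refine le_trans ?_ h
  gcongr
  have := le_weight hT hα ht j k
  linarith

/-! ### The spaces 𝓑_α^j: linear structure, inclusions, products -/

section Membership

variable {T α : ℝ} {j : ℕ} {f g : SpaceTime n}

lemma MemB.wiener_summable {f : E n → ℝ} (hf : MemB j f) :
    Summable fun k => (1 + freqNorm k ^ j) * ‖torusFourierCoeff f k‖ := by
  have h := ENNReal.summable_toReal hf.finite.ne
  refine h.congr fun k => ENNReal.toReal_ofReal ?_
  have := freqNorm_nonneg k
  positivity

lemma MemB.summable {f : E n → ℝ} (hf : MemB j f) : Summable (torusFourierCoeff f) := by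
  refine Summable.of_norm_bounded hf.wiener_summable fun k => ?_
  refine le_mul_of_one_le_left (norm_nonneg _) ?_
  have : 0 ≤ freqNorm k ^ j := pow_nonneg (freqNorm_nonneg k) j
  linarith

lemma wienerNorm_eq_tsum (j : ℕ) (f : E n → ℝ) :
    wienerNorm j f = ∑' k, (1 + freqNorm k ^ j) * ‖torusFourierCoeff f k‖ := by
  rw [wienerNorm, wienerENorm, ENNReal.tsum_toReal_eq fun k => ENNReal.ofReal_ne_top]
  refine tsum_congr fun k => ENNReal.toReal_ofReal ?_
  have := freqNorm_nonneg k
  positivity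

lemma wienerENorm_lt_top {f : E n → ℝ}
    (h : Summable fun k => (1 + freqNorm k ^ j) * ‖torusFourierCoeff f k‖) :
    wienerENorm j f < ⊤ := h.tsum_ofReal_lt_top

lemma MemST.periodic (hf : MemST T α j f) {t : ℝ} (ht : t ∈ Icc 0 T) : IsPeriodic (f t) :=
  (hf.mem t ht).periodic

lemma MemST.continuous_space (hf : MemST T α j f) {t : ℝ} (ht : t ∈ Icc 0 T) :
    Continuous (f t) := (hf.mem t ht).continuous

lemma MemST.summable (hf : MemST T α j f) {t : ℝ} (ht : t ∈ Icc 0 T) :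
    Summable (torusFourierCoeff (f t)) := (hf.mem t ht).summable

lemma MemST.exists_majorant (hf : MemST T α j f) :
    ∃ M : (Fin n → ℤ) → ℝ, Summable M ∧ (∀ k, 0 ≤ M k) ∧
      ∀ t ∈ Icc (0 : ℝ) T, ∀ k, weight T α j k t * ‖torusFourierCoeff (f t) k‖ ≤ M k :=
  MFG.exists_majorant hf.finite

/-- A single coefficient of f s − f t is bounded by the norm of that difference in B^j. -/
lemma MemST.continuousOn_coeff (hf : MemST T α j f) (k : Fin n → ℤ) :
    ContinuousOn (fun t => torusFourierCoeff (f t) k) (Icc 0 T) := by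
  intro t ht
  rw [ContinuousWithinAt, tendsto_iff_norm_sub_tendsto_zero]
  refine squeeze_zero' (Eventually.of_forall fun s => norm_nonneg _) ?_ (hf.continuous t ht)
  filter_upwards [self_mem_nhdsWithin] with s hs
  have h1 : ∀ k, torusFourierCoeff (f s - f t) k =
      torusFourierCoeff (f s) k - torusFourierCoeff (f t) k :=
    torusFourierCoeff_sub' (hf.continuous_space hs) (hf.continuous_space ht)
  have hp : ∀ k : Fin n → ℤ, 0 ≤ freqNorm k ^ j := fun k => pow_nonneg (freqNorm_nonneg k) j
  have hs1 : Summable fun k => (1 + freqNorm k ^ j) * ‖torusFourierCoeff (f s - f t) k‖ := by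
    refine Summable.of_nonneg_of_le (fun k => ?_) (fun k => ?_)
      ((hf.mem s hs).wiener_summable.add (hf.mem t ht).wiener_summable)
    · have := hp k; positivity
    · rw [h1, ← mul_add]
      have := hp k
      gcongr
      exact norm_sub_le _ _
  rw [← h1, wienerNorm_eq_tsum]
  refine le_trans ?_ (hs1.le_tsum k fun l _ => ?_)
  · refine le_mul_of_one_le_left (norm_nonneg _) ?_
    have := hp k
    linarith
  · have := hp l; positivity

/-- Membership in `𝓑_α^j` in terms of the individual Fourier coefficients. -/
lemma memST_of_coeff (hT : 0 < T) (hα : 0 < α) (hp : ∀ t ∈ Icc 0 T, IsPeriodic (f t))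
    (hc : ∀ t ∈ Icc 0 T, Continuous (f t))
    (hk : ∀ k, ContinuousOn (fun t => torusFourierCoeff (f t) k) (Icc 0 T))
    (hfin : stENorm T α j f < ⊤) : MemST T α j f := by
  obtain ⟨M, hM, hM0, hfM⟩ := exists_majorant hfin
  have hw : ∀ t ∈ Icc (0 : ℝ) T, ∀ k,
      (1 + freqNorm k ^ j) * ‖torusFourierCoeff (f t) k‖ ≤ M k := fun t ht k =>
    (mul_le_mul_of_nonneg_right (le_weight hT hα ht j k) (norm_nonneg _)).trans (hfM t ht k)
  have hpw : ∀ k : Fin n → ℤ, 0 ≤ freqNorm k ^ j := fun k => pow_nonneg (freqNorm_nonneg k) j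
  refine ⟨fun t ht => ⟨hp t ht, hc t ht, wienerENorm_lt_top ?_⟩, fun t ht => ?_, hfin⟩
  · refine Summable.of_nonneg_of_le (fun k => ?_) (hw t ht) hM
    have := hpw k; positivity
  · simp only [wienerNorm_eq_tsum]
    have hz : ∑' _ : Fin n → ℤ, (0 : ℝ) = 0 := tsum_zero
    suffices h : Tendsto (fun s => ∑' k, (1 + freqNorm k ^ j) * ‖torusFourierCoeff (f s - f t) k‖)
        (𝓝[Icc 0 T] t) (𝓝 (∑' _ : Fin n → ℤ, (0 : ℝ))) by rwa [hz] at h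
    -- The majorant of the weighted coefficients is uniform in time, so continuity of each mode
    -- upgrades to continuity in B^j by dominated convergence.
    refine tendsto_tsum_of_dominated_convergence (bound := fun k => 2 * M k) (hM.mul_left 2) ?_ ?_
    · intro k
      have h1 : Tendsto (fun s => (1 + freqNorm k ^ j) *
          ‖torusFourierCoeff (f s) k - torusFourierCoeff (f t) k‖) (𝓝[Icc 0 T] t)
          (𝓝 ((1 + freqNorm k ^ j) * 0)) :=
        (tendsto_iff_norm_sub_tendsto_zero.mp (hk k t ht)).const_mul _
      rw [mul_zero] at h1
      refine h1.congr' ?_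
      filter_upwards [self_mem_nhdsWithin] with s hs
      rw [torusFourierCoeff_sub' (hc s hs) (hc t ht)]
    · filter_upwards [self_mem_nhdsWithin] with s hs k
      rw [torusFourierCoeff_sub' (hc s hs) (hc t ht)]
      have := hpw k
      rw [Real.norm_of_nonneg (by positivity), two_mul]
      refine le_trans ?_ (add_le_add (hw s hs k) (hw t ht k))
      rw [← mul_add]
      gcongr
      exact norm_sub_le _ _

lemma MemST.congr (hf : MemST T α j f) (h : ∀ t ∈ Icc 0 T, g t = f t) : MemST T α j g := by
  refine ⟨fun t ht => by rw [h t ht]; exact hf.mem t ht, fun t ht => ?_, ?_⟩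
  · refine (hf.continuous t ht).congr' ?_
    filter_upwards [self_mem_nhdsWithin] with s hs
    rw [h t ht, h s hs]
  · rw [stENorm_congr h]
    exact hf.finite

lemma stNorm_nonneg (T α : ℝ) (j : ℕ) (f : SpaceTime n) : 0 ≤ stNorm T α j f :=
  ENNReal.toReal_nonneg

lemma stENorm_add_le (hf : MemST T α j f) (hg : MemST T α j g) :
    stENorm T α j (fun t x => f t x + g t x) ≤ stENorm T α j f + stENorm T α j g := by
  simp only [stENorm_eq]
  rw [← ENNReal.tsum_add]
  refine ENNReal.tsum_le_tsum fun k => le_trans (le_of_eq ?_) (supCoeff_add_le T α j k _ _)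
  exact supCoeff_congr fun t ht =>
    torusFourierCoeff_add (hf.continuous_space ht) (hg.continuous_space ht) k

lemma MemST.add (hT : 0 < T) (hα : 0 < α) (hf : MemST T α j f) (hg : MemST T α j g) :
    MemST T α j (fun t x => f t x + g t x) := by
  refine memST_of_coeff hT hα (fun t ht i x => ?_) (fun t ht => ?_) (fun k => ?_) ?_
  · simp only [hf.periodic ht i x, hg.periodic ht i x]
  · exact (hf.continuous_space ht).add (hg.continuous_space ht)
  · exact ((hf.continuousOn_coeff k).add (hg.continuousOn_coeff k)).congr fun t ht =>
      torusFourierCoeff_add (hf.continuous_space ht) (hg.continuous_space ht) k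
  · exact (stENorm_add_le hf hg).trans_lt (ENNReal.add_lt_top.mpr ⟨hf.finite, hg.finite⟩)

lemma stNorm_add_le (hf : MemST T α j f) (hg : MemST T α j g) :
    stNorm T α j (fun t x => f t x + g t x) ≤ stNorm T α j f + stNorm T α j g := by
  rw [stNorm, stNorm, stNorm, ← ENNReal.toReal_add hf.finite.ne hg.finite.ne]
  exact ENNReal.toReal_mono (ENNReal.add_ne_top.mpr ⟨hf.finite.ne, hg.finite.ne⟩)
    (stENorm_add_le hf hg)

lemma stENorm_const_mul_le (c : ℝ) (f : SpaceTime n) :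
    stENorm T α j (fun t x => c * f t x) ≤ ENNReal.ofReal |c| * stENorm T α j f := by
  simp only [stENorm_eq]
  rw [← ENNReal.tsum_mul_left]
  refine ENNReal.tsum_le_tsum fun k => ?_
  simp only [torusFourierCoeff_const_mul]
  simpa using supCoeff_const_mul_le T α j k (c : ℂ) fun t => torusFourierCoeff (f t) k

lemma MemST.const_mul (hT : 0 < T) (hα : 0 < α) (hf : MemST T α j f) (c : ℝ) :
    MemST T α j (fun t x => c * f t x) := by
  refine memST_of_coeff hT hα (fun t ht i x => ?_) (fun t ht => ?_) (fun k => ?_) ?_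
  · simp only [hf.periodic ht i x]
  · exact continuous_const.mul (hf.continuous_space ht)
  · simp only [torusFourierCoeff_const_mul]
    exact continuousOn_const.mul (hf.continuousOn_coeff k)
  · exact (stENorm_const_mul_le c f).trans_lt (ENNReal.mul_lt_top ENNReal.ofReal_lt_top hf.finite)

lemma stNorm_const_mul_le (hf : MemST T α j f) (c : ℝ) :
    stNorm T α j (fun t x => c * f t x) ≤ |c| * stNorm T α j f := by
  have h := ENNReal.toReal_mono (ENNReal.mul_lt_top ENNReal.ofReal_lt_top hf.finite).ne
    (stENorm_const_mul_le (T := T) (α := α) (j := j) c f)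
  rwa [ENNReal.toReal_mul, ENNReal.toReal_ofReal (abs_nonneg c)] at h

lemma MemST.sub (hT : 0 < T) (hα : 0 < α) (hf : MemST T α j f) (hg : MemST T α j g) :
    MemST T α j (fun t x => f t x - g t x) := by
  refine (hf.add hT hα (hg.const_mul hT hα (-1))).congr fun t _ => ?_
  ext x; ring

lemma stNorm_sub_comm (f g : SpaceTime n) : stNorm T α j (f - g) = stNorm T α j (g - f) := by
  have h : ∀ f g : SpaceTime n, stENorm T α j (f - g) ≤ stENorm T α j (g - f) := by
    intro f g
    have h1 := stENorm_const_mul_le (T := T) (α := α) (j := j) (-1) (g - f)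
    simp only [abs_neg, abs_one, ENNReal.ofReal_one, one_mul] at h1
    refine le_trans (le_of_eq ?_) h1
    congr 1
    ext t x
    simp
  rw [stNorm, stNorm, (h f g).antisymm (h g f)]

/-- Only the zero mode is present, and there the weight does not depend on time. The lemma serves
for m̄ and for all spatial means. -/
lemma memST_const (hT : 0 < T) (hα : 0 < α) {c : ℝ → ℝ} (hc : ContinuousOn c (Icc 0 T)) :
    MemST T α j (fun t (_ : E n) => c t) := by
  have hk : ∀ k : Fin n → ℤ,
      ContinuousOn (fun t => torusFourierCoeff (fun _ : E n => c t) k) (Icc 0 T) := by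
    intro k
    by_cases h : k = 0
    · subst h
      simp only [torusFourierCoeff_const, Pi.single_eq_same]
      exact Complex.continuous_ofReal.comp_continuousOn hc
    · simp only [torusFourierCoeff_const_of_ne _ h]
      exact continuousOn_const
  refine memST_of_coeff hT hα (fun t _ i x => rfl) (fun t _ => continuous_const) hk ?_
  obtain ⟨B, hB⟩ := isCompact_Icc.exists_bound_of_continuousOn hc
  refine tsum_supCoeff_lt_top (M := Pi.single 0 (weight T α j (0 : Fin n → ℤ) 0 * B))
    (hasSum_pi_single _ _).summable fun t ht k => ?_
  by_cases h : k = 0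
  · subst h
    simp only [torusFourierCoeff_const, Pi.single_eq_same, Complex.norm_real]
    have h1 : weight T α j (0 : Fin n → ℤ) t = weight T α j (0 : Fin n → ℤ) 0 := by
      simp [weight, freqNorm]
    rw [h1]
    exact mul_le_mul_of_nonneg_left (hB t ht) (weight_pos _ _ _ _ _).le
  · simp [torusFourierCoeff_const_of_ne _ h, h]

/-- The factor 2 is forced by k = 0 with i = 0 < j, where 1 + |k|^i = 2 and 1 + |k|^j = 1. -/
lemma weight_mono {i j : ℕ} (hij : i ≤ j) (T α : ℝ) (k : Fin n → ℤ) (t : ℝ) :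
    weight T α i k t ≤ 2 * weight T α j k t := by
  have hk := freqNorm_nonneg k
  unfold weight
  rw [← mul_assoc]
  gcongr
  rcases le_total (freqNorm k) 1 with h | h
  · have := pow_le_one₀ hk h (n := i)
    have : 0 ≤ freqNorm k ^ j := by positivity
    linarith
  · have := pow_le_pow_right₀ h hij
    have : 0 ≤ freqNorm k ^ j := by positivity
    linarith

lemma stENorm_mono {i j : ℕ} (hij : i ≤ j) (f : SpaceTime n) :
    stENorm T α i f ≤ 2 * stENorm T α j f := by
  simp only [stENorm_eq]
  rw [← ENNReal.tsum_mul_left]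
  refine ENNReal.tsum_le_tsum fun k => supCoeff_le fun t ht => ?_
  refine le_trans ?_ (mul_le_mul_right (le_supCoeff ht j k _) 2)
  rw [show (2 : ENNReal) = ENNReal.ofReal 2 by simp, ← ENNReal.ofReal_mul (by norm_num), ← mul_assoc]
  gcongr
  exact weight_mono hij T α k t

lemma MemST.mono (hT : 0 < T) (hα : 0 < α) {i j : ℕ} (hij : i ≤ j) (hf : MemST T α j f) :
    MemST T α i f :=
  memST_of_coeff hT hα (fun _ ht => hf.periodic ht) (fun _ ht => hf.continuous_space ht)
    hf.continuousOn_coeff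
    ((stENorm_mono hij f).trans_lt (ENNReal.mul_lt_top (by simp) hf.finite))

lemma stNorm_mono {i j : ℕ} (hij : i ≤ j) (hf : MemST T α j f) :
    stNorm T α i f ≤ 2 * stNorm T α j f := by
  have h := ENNReal.toReal_mono (ENNReal.mul_lt_top (by simp) hf.finite).ne
    (stENorm_mono (T := T) (α := α) hij f)
  rwa [ENNReal.toReal_mul, ENNReal.toReal_ofNat] at h

/-- Young's inequality for ℓ¹ convolution: by submultiplicativity the weight splits over the two
frequencies, and the supremum in time is taken factor by factor. -/
lemma stENorm_mul_le (hT : 0 < T) (hα : 0 < α) (hj : j ≤ 1) (hf : MemST T α j f)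
    (hg : MemST T α j g) :
    stENorm T α j (fun t x => f t x * g t x) ≤ stENorm T α j f * stENorm T α j g := by
  simp only [stENorm_eq]
  set A := fun k : Fin n → ℤ => supCoeff T α j k fun t => torusFourierCoeff (f t) k
  set B := fun k : Fin n → ℤ => supCoeff T α j k fun t => torusFourierCoeff (g t) k
  have h1 : ∀ k, supCoeff T α j k (fun t => torusFourierCoeff (fun x => f t x * g t x) k) ≤
      ∑' l, A l * B (k - l) := by
    intro k
    refine supCoeff_le fun t ht => ?_
    rw [torusFourierCoeff_mul (hf.periodic ht) (hf.continuous_space ht) (hf.summable ht)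
      (hg.periodic ht) (hg.continuous_space ht) (hg.summable ht)]
    have hs := (summable_conv (hf.summable ht).norm (hg.summable ht).norm).prod_factor k
    calc ENNReal.ofReal (weight T α j k t *
            ‖∑' l, torusFourierCoeff (f t) l * torusFourierCoeff (g t) (k - l)‖)
        ≤ ENNReal.ofReal (∑' l, weight T α j k t *
            ‖torusFourierCoeff (f t) l * torusFourierCoeff (g t) (k - l)‖) := by
          rw [tsum_mul_left]
          have := (weight_pos T α j k t).le
          gcongr
          exact norm_tsum_le_tsum_norm hs
      _ = ∑' l, ENNReal.ofReal (weight T α j k t *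
            ‖torusFourierCoeff (f t) l * torusFourierCoeff (g t) (k - l)‖) := by
          refine ENNReal.ofReal_tsum_of_nonneg (fun l => ?_) (hs.mul_left _)
          have := (weight_pos T α j k t).le
          positivity
      _ ≤ ∑' l, A l * B (k - l) := by
          refine ENNReal.tsum_le_tsum fun l => ?_
          refine le_trans ?_ (mul_le_mul' (le_supCoeff ht j l _) (le_supCoeff ht j (k - l) _))
          have hw := weight_submultiplicative hT hα ht hj l (k - l)
          rw [add_sub_cancel] at hw
          have h2 := (weight_pos T α j l t).le
          rw [← ENNReal.ofReal_mul (by positivity), norm_mul]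
          refine ENNReal.ofReal_le_ofReal ?_
          calc _ ≤ (weight T α j l t * weight T α j (k - l) t) *
                (‖torusFourierCoeff (f t) l‖ * ‖torusFourierCoeff (g t) (k - l)‖) := by gcongr
            _ = _ := by ring
  calc _ ≤ ∑' k, ∑' l, A l * B (k - l) := ENNReal.tsum_le_tsum h1
    _ = ∑' l, ∑' k, A l * B (k - l) := ENNReal.tsum_comm
    _ = ∑' l, A l * ∑' k, B k := by
        refine tsum_congr fun l => ?_
        rw [ENNReal.tsum_mul_left]
        congr 1
        exact (Equiv.subRight l).tsum_eq B
    _ = _ := ENNReal.tsum_mul_right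

lemma MemST.mul (hT : 0 < T) (hα : 0 < α) (hj : j ≤ 1) (hf : MemST T α j f)
    (hg : MemST T α j g) : MemST T α j (fun t x => f t x * g t x) := by
  refine memST_of_coeff hT hα (fun t ht i x => ?_) (fun t ht => ?_) (fun k => ?_) ?_
  · simp only [hf.periodic ht i x, hg.periodic ht i x]
  · exact (hf.continuous_space ht).mul (hg.continuous_space ht)
  · obtain ⟨M, hM, hM0, hfM⟩ := hf.exists_majorant
    obtain ⟨N, hN, hN0, hgN⟩ := hg.exists_majorant
    have h1 : ContinuousOn (fun t => ∑' l, torusFourierCoeff (f t) l *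
        torusFourierCoeff (g t) (k - l)) (Icc 0 T) := by
      refine continuousOn_tsum (u := fun l => M l * N (k - l))
        (fun l => (hf.continuousOn_coeff l).mul (hg.continuousOn_coeff (k - l))) ?_ ?_
      · exact ((summable_conv hM.norm hN.norm).prod_factor k).of_norm
      · intro l t ht
        rw [norm_mul]
        exact mul_le_mul (norm_le_of_weight_mul_norm_le hT hα ht (hfM t ht l))
          (norm_le_of_weight_mul_norm_le hT hα ht (hgN t ht _)) (norm_nonneg _) (hM0 l)
    refine h1.congr fun t ht => ?_
    exact torusFourierCoeff_mul (hf.periodic ht) (hf.continuous_space ht) (hf.summable ht)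
      (hg.periodic ht) (hg.continuous_space ht) (hg.summable ht) k
  · exact (stENorm_mul_le hT hα hj hf hg).trans_lt (ENNReal.mul_lt_top hf.finite hg.finite)

lemma stNorm_mul_le (hT : 0 < T) (hα : 0 < α) (hj : j ≤ 1) (hf : MemST T α j f)
    (hg : MemST T α j g) :
    stNorm T α j (fun t x => f t x * g t x) ≤ stNorm T α j f * stNorm T α j g := by
  rw [stNorm, stNorm, stNorm, ← ENNReal.toReal_mul]
  exact ENNReal.toReal_mono (ENNReal.mul_lt_top hf.finite hg.finite).ne
    (stENorm_mul_le hT hα hj hf hg)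

end Membership

/-! ### Primitives and termwise differentiation in time -/

/-- The nearest point of `[0, T]`. -/
def clamp (T s : ℝ) : ℝ := max 0 (min T s)

lemma clamp_mem {T : ℝ} (hT : 0 < T) (s : ℝ) : clamp T s ∈ Icc 0 T :=
  ⟨le_max_left _ _, max_le hT.le (min_le_left _ _)⟩

lemma clamp_of_mem {T s : ℝ} (hs : s ∈ Icc 0 T) : clamp T s = s := by
  rw [clamp, min_eq_right hs.2, max_eq_right hs.1]

lemma continuous_clamp (T : ℝ) : Continuous (clamp T) := by
  unfold clamp; fun_prop

lemma continuous_comp_clamp {X : Type*} [TopologicalSpace X] {T : ℝ} (hT : 0 < T) {g : ℝ → X}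
    (hg : ContinuousOn g (Icc 0 T)) : Continuous fun s => g (clamp T s) :=
  hg.comp_continuous (continuous_clamp T) (clamp_mem hT)

/-- A primitive on `[0, T]`. -/
def timePrimitive {F : Type*} [NormedAddCommGroup F] [NormedSpace ℝ F] (T : ℝ) (g : ℝ → F)
    (t : ℝ) : F := ∫ s in (0 : ℝ)..t, g (clamp T s)

section Primitive

variable {F : Type*} [NormedAddCommGroup F] [NormedSpace ℝ F] {T : ℝ}

lemma timePrimitive_zero (T : ℝ) (g : ℝ → F) : timePrimitive T g 0 = 0 := by
  simp [timePrimitive]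

/-- `clamp` extends the integrand continuously to ℝ, so the derivative is two-sided at every real
time, including the end times. -/
lemma hasDerivAt_timePrimitive [CompleteSpace F] (hT : 0 < T) {g : ℝ → F} (hg : ContinuousOn g (Icc 0 T)) (t : ℝ) :
    HasDerivAt (timePrimitive T g) (g (clamp T t)) t :=
  ((continuous_comp_clamp hT hg).integral_hasStrictDerivAt 0 t).hasDerivAt

lemma hasDerivWithinAt_timePrimitive [CompleteSpace F] (hT : 0 < T) {g : ℝ → F} (hg : ContinuousOn g (Icc 0 T))
    {t : ℝ} (ht : t ∈ Icc 0 T) :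
    HasDerivWithinAt (timePrimitive T g) (g t) (Icc 0 T) t := by
  have h := (hasDerivAt_timePrimitive hT hg t).hasDerivWithinAt (s := Icc 0 T)
  rwa [clamp_of_mem ht] at h

lemma hasDerivWithinAt_Ici {f : ℝ → F} {f' : F} {t : ℝ}
    (h : HasDerivWithinAt f f' (Icc 0 T) t) (ht : t ∈ Ico 0 T) :
    HasDerivWithinAt f f' (Ici t) t := by
  have h1 : HasDerivWithinAt f f' (Icc t T) t := h.mono (Icc_subset_Icc_left ht.1)
  exact h1.mono_of_mem_nhdsWithin (Icc_mem_nhdsGE ht.2)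

lemma eq_of_hasDerivWithinAt_eq {f g : ℝ → F} {f' : ℝ → F}
    (hf : ∀ t ∈ Icc 0 T, HasDerivWithinAt f (f' t) (Icc 0 T) t)
    (hg : ∀ t ∈ Icc 0 T, HasDerivWithinAt g (f' t) (Icc 0 T) t) {t : ℝ} (ht : t ∈ Icc 0 T) :
    f t - g t = f 0 - g 0 := by
  have h1 : ∀ t ∈ Icc 0 T, HasDerivWithinAt (fun s => f s - g s) 0 (Icc 0 T) t := by
    intro t ht
    have := (hf t ht).sub (hg t ht)
    rwa [sub_self] at this
  exact constant_of_has_deriv_right_zero (fun t ht => (h1 t ht).continuousWithinAt)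
    (fun t ht => hasDerivWithinAt_Ici (h1 t (Ico_subset_Icc_self ht)) ht) t ht

lemma hasDerivWithinAt_reflect {f : ℝ → F} {f' : F} {t : ℝ}
    (h : HasDerivWithinAt f f' (Icc 0 T) (T - t)) :
    HasDerivWithinAt (fun s => f (T - s)) (-f') (Icc 0 T) t := by
  have h1 : HasDerivWithinAt (fun s => T - s) (-1) (Icc 0 T) t :=
    ((hasDerivAt_id t).const_sub T).hasDerivWithinAt
  have h2 := HasDerivWithinAt.scomp t h h1 fun s hs => ⟨by linarith [hs.2], by linarith [hs.1]⟩
  rwa [neg_one_smul] at h2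

end Primitive

lemma reflect_mem {T t : ℝ} (ht : t ∈ Icc 0 T) : T - t ∈ Icc 0 T :=
  ⟨by linarith [ht.2], by linarith [ht.1]⟩

lemma timePrimitive_conj (T : ℝ) (g : ℝ → ℂ) (t : ℝ) :
    timePrimitive T (fun s => (starRingEnd ℂ) (g s)) t =
      (starRingEnd ℂ) (timePrimitive T g t) := by
  simp only [timePrimitive, intervalIntegral.intervalIntegral_conj]

lemma continuousOn_realSeries {T : ℝ} {a : ℝ → (Fin n → ℤ) → ℂ} {M : (Fin n → ℤ) → ℝ}
    (hM : Summable M) (ha : ∀ k, ContinuousOn (fun t => a t k) (Icc 0 T))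
    (haM : ∀ t ∈ Icc 0 T, ∀ k, ‖a t k‖ ≤ M k) :
    ContinuousOn (fun p : ℝ × E n => realSeries (a p.1) p.2) (Icc 0 T ×ˢ univ) := by
  refine Complex.continuous_re.comp_continuousOn (continuousOn_tsum (fun k => ?_) hM ?_)
  · refine ContinuousOn.mul ?_ ((continuous_chr k).comp continuous_snd).continuousOn
    exact (ha k).comp continuous_fst.continuousOn fun p hp => hp.1
  · intro k p hp
    rw [norm_mul, norm_chr, mul_one]
    exact haM p.1 hp.1 k

/-- Termwise differentiation in time. -/
lemma hasDerivWithinAt_realSeries {T : ℝ} (hT : 0 < T) {y g : ℝ → (Fin n → ℤ) → ℂ}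
    {M : (Fin n → ℤ) → ℝ} (hM : Summable M)
    (hy : ∀ k, ∀ t ∈ Icc 0 T, HasDerivWithinAt (fun s => y s k) (g t k) (Icc 0 T) t)
    (hg : ∀ k, ContinuousOn (fun t => g t k) (Icc 0 T))
    (hgM : ∀ t ∈ Icc 0 T, ∀ k, ‖g t k‖ ≤ M k) (hy0 : Summable (y 0)) (x : E n) {t : ℝ}
    (ht : t ∈ Icc 0 T) :
    HasDerivWithinAt (fun s => realSeries (y s) x) (realSeries (g t) x) (Icc 0 T) t := by
  -- Y agrees with y on [0, T] but is differentiable on all of ℝ, with derivatives bounded by M, as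
  -- `hasDerivAt_tsum` demands.
  set Y : ℝ → (Fin n → ℤ) → ℂ := fun t k => y 0 k + timePrimitive T (fun s => g s k) t
  have hYy : ∀ s ∈ Icc 0 T, y s = Y s := by
    intro s hs
    ext k
    have := eq_of_hasDerivWithinAt_eq (hy k)
      (fun t ht => hasDerivWithinAt_timePrimitive hT (hg k) ht) hs
    rw [timePrimitive_zero, sub_zero] at this
    rw [← sub_eq_iff_eq_add, this]
  have h1 : HasDerivAt (fun s => series (Y s) x) (series (g (clamp T t)) x) t := by
    refine hasDerivAt_tsum (y₀ := 0) hM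
      (fun k s => ((hasDerivAt_timePrimitive hT (hg k) s).const_add (y 0 k)).mul_const (chr k x))
      (fun k s => ?_) ?_ t
    · rw [norm_mul, norm_chr, mul_one]
      exact hgM _ (clamp_mem hT s) k
    · simp only [timePrimitive_zero, add_zero]
      exact summable_series hy0 x
  have h2 : HasDerivAt (fun s => realSeries (Y s) x) (realSeries (g (clamp T t)) x) t :=
    Complex.reCLM.hasFDerivAt.comp_hasDerivAt t h1
  rw [clamp_of_mem ht] at h2
  exact h2.hasDerivWithinAt.congr (fun s hs => by rw [hYy s hs]) (by rw [hYy t ht])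

/-- A function whose time derivative is a trigonometric series has Fourier coefficients with the
corresponding derivatives. -/
lemma hasDerivWithinAt_torusFourierCoeff {T : ℝ} (hT : 0 < T) {u : SpaceTime n}
    {g : ℝ → (Fin n → ℤ) → ℂ} {M : (Fin n → ℤ) → ℝ} (hM : Summable M)
    (hu : ∀ t ∈ Icc 0 T, ∀ x, HasDerivWithinAt (fun s => u s x) (realSeries (g t) x) (Icc 0 T) t)
    (hu0 : Continuous (u 0)) (hg : ∀ k, ContinuousOn (fun t => g t k) (Icc 0 T))
    (hgM : ∀ t ∈ Icc 0 T, ∀ k, ‖g t k‖ ≤ M k)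
    (hgc : ∀ t ∈ Icc 0 T, ∀ k, g t (-k) = (starRingEnd ℂ) (g t k)) (k : Fin n → ℤ) {t : ℝ}
    (ht : t ∈ Icc 0 T) :
    HasDerivWithinAt (fun s => torusFourierCoeff (u s) k) (g t k) (Icc 0 T) t := by
  set Y : ℝ → (Fin n → ℤ) → ℂ := fun t k => timePrimitive T (fun s => g s k) t with hY
  have hYd : ∀ k, ∀ t ∈ Icc 0 T, HasDerivWithinAt (fun s => Y s k) (g t k) (Icc 0 T) t :=
    fun k t ht => hasDerivWithinAt_timePrimitive hT (hg k) ht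
  have hY0 : Y 0 = 0 := by ext k; exact timePrimitive_zero _ _
  have hYs : ∀ s ∈ Icc 0 T, Summable (Y s) := by
    intro s hs
    refine Summable.of_norm_bounded (hM.mul_right |s - 0|) fun k => ?_
    exact intervalIntegral.norm_integral_le_of_norm_le_const fun r _ =>
      hgM _ (clamp_mem hT r) k
  have hYc : ∀ s ∈ Icc 0 T, ∀ k, Y s (-k) = (starRingEnd ℂ) (Y s k) := by
    intro s _ k
    simp only [hY, ← timePrimitive_conj]
    simp only [timePrimitive, hgc _ (clamp_mem hT _)]
  -- Both sides have the same time derivative at each x and agree at time 0. The coefficients of u s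
  -- can then be read off, with no interchange of time derivative and space integral.
  have h1 : ∀ s ∈ Icc 0 T, u s = fun x => u 0 x + realSeries (Y s) x := by
    intro s hs
    ext x
    have := eq_of_hasDerivWithinAt_eq (fun t ht => hu t ht x)
      (fun t ht => hasDerivWithinAt_realSeries hT hM hYd hg hgM (by rw [hY0]; exact summable_zero)
        x ht) hs
    have h0 : realSeries (Y 0) x = 0 := by rw [hY0]; simp [realSeries, series]
    rw [h0] at this
    linarith
  have h2 : ∀ s ∈ Icc 0 T, torusFourierCoeff (u s) k = torusFourierCoeff (u 0) k + Y s k := by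
    intro s hs
    rw [h1 s hs, torusFourierCoeff_add hu0 (continuous_realSeries (hYs s hs)),
      torusFourierCoeff_realSeries (hYs s hs) (hYc s hs)]
  exact ((hYd k t ht).const_add (torusFourierCoeff (u 0) k)).congr h2 (h2 t ht)

/-! ### Spatial derivatives, analyticity and pointwise bounds in 𝓑_α^j -/

section SpaceDerivative

variable {T α : ℝ} {j : ℕ} {f : SpaceTime n}

/-- A partial derivative in space. -/
def spaceDeriv (i : Fin n) (f : SpaceTime n) : SpaceTime n :=
  fun t x => fderiv ℝ (f t) x (EuclideanSpace.single i 1)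

lemma MemST.summable_pow (hT : 0 < T) (hα : 0 < α) (hf : MemST T α j f) {t : ℝ}
    (ht : t ∈ Icc 0 T) : Summable fun k => freqNorm k ^ j * ‖torusFourierCoeff (f t) k‖ := by
  obtain ⟨M, hM, -, hfM⟩ := hf.exists_majorant
  refine Summable.of_nonneg_of_le (fun k => ?_)
    (fun k => freqNorm_pow_mul_norm_le hT hα ht (hfM t ht k)) hM
  have := freqNorm_nonneg k
  positivity

lemma MemST.eq_realSeries (hf : MemST T α j f) {t : ℝ} (ht : t ∈ Icc 0 T) :
    f t = realSeries (torusFourierCoeff (f t)) :=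
  (realSeries_torusFourierCoeff (hf.periodic ht) (hf.continuous_space ht) (hf.summable ht)).symm

lemma MemST.summable_freqNorm (hT : 0 < T) (hα : 0 < α) (hf : MemST T α (j + 1) f) {t : ℝ}
    (ht : t ∈ Icc 0 T) : Summable fun k => freqNorm k * ‖torusFourierCoeff (f t) k‖ := by
  have := (hf.mono hT hα (Nat.le_add_left 1 j)).summable_pow hT hα ht
  simpa using this

lemma MemST.differentiable (hT : 0 < T) (hα : 0 < α) (hf : MemST T α (j + 1) f) {t : ℝ}
    (ht : t ∈ Icc 0 T) : Differentiable ℝ (f t) := by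
  rw [hf.eq_realSeries ht]
  exact differentiable_realSeries (hf.summable ht) (hf.summable_freqNorm hT hα ht)

lemma MemST.spaceDeriv_eq (hT : 0 < T) (hα : 0 < α) (hf : MemST T α (j + 1) f) {t : ℝ}
    (ht : t ∈ Icc 0 T) (i : Fin n) : spaceDeriv i f t =
      realSeries (derivCoeff (torusFourierCoeff (f t)) (EuclideanSpace.single i 1)) := by
  ext x
  rw [spaceDeriv]
  conv_lhs => rw [hf.eq_realSeries ht]
  exact fderiv_realSeries_apply (hf.summable ht) (hf.summable_freqNorm hT hα ht) x _

lemma derivCoeff_conj {a : (Fin n → ℤ) → ℂ} (ha : ∀ k, a (-k) = (starRingEnd ℂ) (a k)) (v : E n)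
    (k : Fin n → ℤ) : derivCoeff a v (-k) = (starRingEnd ℂ) (derivCoeff a v k) := by
  rw [derivCoeff, derivCoeff, ha, iphase_apply, iphase_apply, phase_neg_freq]
  simp

lemma MemST.torusFourierCoeff_spaceDeriv (hT : 0 < T) (hα : 0 < α) (hf : MemST T α (j + 1) f)
    {t : ℝ} (ht : t ∈ Icc 0 T) (i : Fin n) : torusFourierCoeff (spaceDeriv i f t) =
      derivCoeff (torusFourierCoeff (f t)) (EuclideanSpace.single i 1) := by
  rw [hf.spaceDeriv_eq hT hα ht]
  exact torusFourierCoeff_realSeries (summable_derivCoeff (hf.summable_freqNorm hT hα ht) _)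
    (derivCoeff_conj (torusFourierCoeff_neg_freq _) _)

/-- A derivative multiplies the coefficient by at most |k|, and (1 + |k|^j)|k| = |k| + |k|^(j+1) ≤
2(1 + |k|^(j+1)). -/
lemma stENorm_spaceDeriv_le (hT : 0 < T) (hα : 0 < α) (hf : MemST T α (j + 1) f) (i : Fin n) :
    stENorm T α j (spaceDeriv i f) ≤ 2 * stENorm T α (j + 1) f := by
  simp only [stENorm_eq]
  rw [← ENNReal.tsum_mul_left]
  refine ENNReal.tsum_le_tsum fun k => supCoeff_le fun t ht => ?_
  refine le_trans ?_ (mul_le_mul_right (le_supCoeff ht (j + 1) k _) 2)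
  rw [show (2 : ENNReal) = ENNReal.ofReal 2 by simp, ← ENNReal.ofReal_mul (by norm_num)]
  refine ENNReal.ofReal_le_ofReal ?_
  have hk := freqNorm_nonneg k
  rw [hf.torusFourierCoeff_spaceDeriv hT hα ht, derivCoeff, norm_mul, weight, weight]
  have h1 : (1 + freqNorm k ^ j) * freqNorm k ≤ 2 * (1 + freqNorm k ^ (j + 1)) := by
    have h2 : 0 ≤ freqNorm k ^ (j + 1) := by positivity
    rw [add_mul, one_mul, ← pow_succ]
    rcases le_total (freqNorm k) 1 with h | h
    · linarith
    · have := le_self_pow₀ h (Nat.succ_ne_zero j)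
      simp only [Nat.succ_eq_add_one] at this
      linarith
  calc _ ≤ (1 + freqNorm k ^ j) * Real.exp (beta T α t * freqNorm k) *
        (freqNorm k * ‖torusFourierCoeff (f t) k‖) := by
        gcongr
        exact norm_iphase_single_le k i
    _ = (1 + freqNorm k ^ j) * freqNorm k * (Real.exp (beta T α t * freqNorm k) *
        ‖torusFourierCoeff (f t) k‖) := by ring
    _ ≤ 2 * (1 + freqNorm k ^ (j + 1)) * (Real.exp (beta T α t * freqNorm k) *
        ‖torusFourierCoeff (f t) k‖) := by gcongr
    _ = _ := by ring

lemma MemST.spaceDeriv (hT : 0 < T) (hα : 0 < α) (hf : MemST T α (j + 1) f) (i : Fin n) :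
    MemST T α j (spaceDeriv i f) := by
  refine memST_of_coeff hT hα (fun t ht => ?_) (fun t ht => ?_) (fun k => ?_) ?_
  · rw [hf.spaceDeriv_eq hT hα ht]
    exact isPeriodic_realSeries _
  · rw [hf.spaceDeriv_eq hT hα ht]
    exact continuous_realSeries (summable_derivCoeff (hf.summable_freqNorm hT hα ht) _)
  · refine ContinuousOn.congr (f := fun t => derivCoeff (torusFourierCoeff (f t))
      (EuclideanSpace.single i 1) k) ?_ fun t ht => by
        rw [hf.torusFourierCoeff_spaceDeriv hT hα ht]
    exact continuousOn_const.mul (hf.continuousOn_coeff k)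
  · exact (stENorm_spaceDeriv_le hT hα hf i).trans_lt (ENNReal.mul_lt_top (by simp) hf.finite)

lemma stNorm_spaceDeriv_le (hT : 0 < T) (hα : 0 < α) (hf : MemST T α (j + 1) f) (i : Fin n) :
    stNorm T α j (MFG.spaceDeriv i f) ≤ 2 * stNorm T α (j + 1) f := by
  have h := ENNReal.toReal_mono (ENNReal.mul_lt_top (by simp) hf.finite).ne
    (stENorm_spaceDeriv_le hT hα hf i)
  rwa [ENNReal.toReal_mul, ENNReal.toReal_ofNat] at h

lemma MemST.contDiff (hT : 0 < T) (hα : 0 < α) (hf : MemST T α 2 f) {t : ℝ}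
    (ht : t ∈ Icc 0 T) : ContDiff ℝ 2 (f t) := by
  rw [hf.eq_realSeries ht]
  exact contDiff_two_realSeries (hf.summable ht) (hf.summable_pow hT hα ht)

lemma MemST.laplacian_eq (hT : 0 < T) (hα : 0 < α) (hf : MemST T α 2 f) {t : ℝ}
    (ht : t ∈ Icc 0 T) : Δ (f t) =
      realSeries fun k => -(freqNorm k ^ 2 : ℝ) * torusFourierCoeff (f t) k := by
  ext x
  conv_lhs => rw [hf.eq_realSeries ht]
  exact laplacian_realSeries (hf.summable ht) (hf.summable_pow hT hα ht) x

lemma MemST.continuousOn_uncurry (hT : 0 < T) (hα : 0 < α) (hf : MemST T α j f) :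
    ContinuousOn (fun p : ℝ × E n => f p.1 p.2) (Icc 0 T ×ˢ univ) := by
  obtain ⟨M, hM, -, hfM⟩ := hf.exists_majorant
  refine (continuousOn_realSeries hM hf.continuousOn_coeff fun t ht k =>
    norm_le_of_weight_mul_norm_le hT hα ht (hfM t ht k)).congr fun p hp => ?_
  simp only
  conv_lhs => rw [hf.eq_realSeries hp.1]

/-- Strictly between the end times β(t) > 0, so the coefficients decay exponentially at rate β(t).
-/
lemma MemST.analyticOnNhd (hT : 0 < T) (hα : 0 < α) (hf : MemST T α j f) {t : ℝ}
    (ht : t ∈ Ioo 0 T) : AnalyticOnNhd ℝ (f t) univ := by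
  have ht' := Ioo_subset_Icc_self ht
  rw [hf.eq_realSeries ht']
  obtain ⟨M, hM, -, hfM⟩ := hf.exists_majorant
  refine analyticOnNhd_realSeries (beta_pos hT hα ht) ?_
  refine Summable.of_nonneg_of_le (fun k => by positivity) (fun k => ?_) hM
  refine le_trans ?_ (hfM t ht' k)
  rw [mul_comm, weight]
  gcongr
  refine le_mul_of_one_le_left (Real.exp_pos _).le ?_
  have : 0 ≤ freqNorm k ^ j := pow_nonneg (freqNorm_nonneg k) j
  linarith

/-- The supremum is bounded by the ℓ¹ norm of the coefficients, and all weights are at least one.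
This yields the sign of the density and the separation of functions by the norm. -/
lemma MemST.abs_le (hT : 0 < T) (hα : 0 < α) (hf : MemST T α j f) {t : ℝ} (ht : t ∈ Icc 0 T)
    (x : E n) : |f t x| ≤ stNorm T α j f := by
  have h1 : f t x = realSeries (torusFourierCoeff (f t)) x := congrFun (hf.eq_realSeries ht) x
  have h2 : |f t x| ≤ ∑' k, ‖torusFourierCoeff (f t) k‖ := by
    rw [h1, realSeries]
    refine (Complex.abs_re_le_norm _).trans ?_
    refine (norm_tsum_le_tsum_norm (summable_series (hf.summable ht) x).norm).trans (le_of_eq ?_)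
    refine tsum_congr fun k => ?_
    rw [norm_mul, norm_chr, mul_one]
  refine h2.trans ?_
  rw [stNorm, ENNReal.ofReal_le_iff_le_toReal hf.finite.ne |>.symm,
    ENNReal.ofReal_tsum_of_nonneg (fun k => norm_nonneg _) (hf.summable ht).norm, stENorm_eq]
  refine ENNReal.tsum_le_tsum fun k => le_trans ?_ (le_supCoeff ht j k _)
  exact ENNReal.ofReal_le_ofReal
    (le_mul_of_one_le_left (norm_nonneg _) (one_le_weight hT hα ht j k))

end SpaceDerivative

/-! ### Smoothing and solvability for the heat equation -/

lemma one_le_freqNorm {k : Fin n → ℤ} (hk : k ≠ 0) : 1 ≤ freqNorm k := by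
  obtain ⟨i, hi⟩ := Function.ne_iff.mp hk
  have h1 : (1 : ℝ) ≤ (k i : ℝ) ^ 2 := by
    have h2 : (1 : ℤ) ≤ (k i) ^ 2 := by
      have : 0 < (k i) ^ 2 := by
        have := hi
        simp only [Pi.zero_apply] at this
        positivity
      omega
    exact_mod_cast h2
  rw [freqNorm, Real.one_le_sqrt]
  exact h1.trans (Finset.single_le_sum (f := fun i => (k i : ℝ) ^ 2)
    (fun _ _ => sq_nonneg _) (Finset.mem_univ i))

/-- The constant in the smoothing estimate for the heat equation. -/
def gain (T α : ℝ) : ℝ := 1 / (1 - 2 * α / T)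

/-- This is where α < T/2 enters: on modes with |k| ≥ 1 the damping |k|² strictly dominates the
weight's growth (2α/T)|k|. -/
lemma slope_lt_one {T α : ℝ} (hT : 0 < T) (hα : α ∈ Ioo 0 (T / 2)) : 2 * α / T < 1 := by
  rw [div_lt_one hT]
  linarith [hα.2]

lemma gain_pos {T α : ℝ} (hT : 0 < T) (hα : α ∈ Ioo 0 (T / 2)) : 0 < gain T α :=
  one_div_pos.mpr (sub_pos.mpr (slope_lt_one hT hα))

/-- Weighted estimate for a single Fourier mode of the heat equation. -/
lemma exp_beta_mul_norm_le {T α κ M : ℝ} (hT : 0 < T) (hα : α ∈ Ioo 0 (T / 2)) (hκ : 1 ≤ κ)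
    {y g : ℝ → ℂ}
    (hy : ∀ t ∈ Icc 0 T, HasDerivWithinAt y (-(κ ^ 2 : ℝ) * y t + g t) (Icc 0 T) t)
    (hg : ∀ t ∈ Icc 0 T, Real.exp (beta T α t * κ) * ‖g t‖ ≤ M) {t : ℝ} (ht : t ∈ Icc 0 T) :
    Real.exp (beta T α t * κ) * ‖y t‖ ≤ ‖y 0‖ + gain T α * M / κ ^ 2 := by
  set c := 2 * α / T with hc
  have hc0 : 0 < c := by have := hα.1; positivity
  have hc1 : c < 1 := slope_lt_one hT hα
  have hκ0 : 0 < κ := by linarith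
  have hM : 0 ≤ M := le_trans (by positivity) (hg t ht)
  -- The decay rate left after paying for the growth of the weight; κ ≥ 1 makes it at least (1 −
  -- c)κ².
  set μ := κ ^ 2 - c * κ with hμ
  have hμκ : (1 - c) * κ ^ 2 ≤ μ := by
    rw [hμ]; nlinarith [mul_nonneg (mul_nonneg hc0.le hκ0.le) (sub_nonneg.mpr hκ)]
  have hμ0 : 0 < μ := lt_of_lt_of_le (mul_pos (sub_pos.mpr hc1) (by positivity)) hμκ
  -- The final time t is fixed. For s ≤ t one has −β(s)κ ≤ −β(t)κ + cκ(t − s), so e^{κ²s}‖g s‖ ≤ K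
  -- e^{μs}.
  set K := M * Real.exp (-(beta T α t * κ) + c * κ * t) with hK
  have hK0 : 0 ≤ K := by positivity
  have hz : ∀ s ∈ Icc 0 T, HasDerivWithinAt (fun s => Complex.exp ((κ ^ 2 * s : ℝ)) * y s)
      (Complex.exp ((κ ^ 2 * s : ℝ)) * g s) (Icc 0 T) s := by
    intro s hs
    have h1 : HasDerivAt (fun s : ℝ => ((κ ^ 2 * s : ℝ) : ℂ)) ((κ ^ 2 * 1 : ℝ) : ℂ) s :=
      ((hasDerivAt_id s).const_mul (κ ^ 2)).ofReal_comp
    have h2 := h1.cexp.hasDerivWithinAt.mul (hy s hs)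
    refine h2.congr_deriv ?_
    push_cast
    ring
  -- Duhamel's bound as a differential comparison: the solution times the integrating factor e^{κ²s}
  -- stays below the explicit primitive of K e^{μs}.
  have key := image_norm_le_of_norm_deriv_right_le_deriv_boundary' (a := 0) (b := t)
    (f := fun s => Complex.exp ((κ ^ 2 * s : ℝ)) * y s)
    (f' := fun s => Complex.exp ((κ ^ 2 * s : ℝ)) * g s)
    (B := fun s => ‖y 0‖ + K * Real.exp (μ * s) / μ) (B' := fun s => K * Real.exp (μ * s))
    (fun s hs => (hz s ⟨hs.1, hs.2.trans ht.2⟩).continuousWithinAt.mono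
      (Icc_subset_Icc_right ht.2))
    (fun s hs => hasDerivWithinAt_Ici (hz s ⟨hs.1, hs.2.le.trans ht.2⟩)
      ⟨hs.1, hs.2.trans_le ht.2⟩)
    (by
      simp only [mul_zero, Complex.ofReal_zero, Complex.exp_zero, one_mul]
      have : 0 ≤ K * Real.exp 0 / μ := by positivity
      linarith)
    (by fun_prop)
    (fun s _ => by
      have h1 : HasDerivAt (fun s : ℝ => μ * s) (μ * 1) s := (hasDerivAt_id s).const_mul μ
      have h2 := (((h1.exp.const_mul K).div_const μ).const_add ‖y 0‖).hasDerivWithinAt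
        (s := Ici s)
      refine h2.congr_deriv ?_
      field_simp)
    (fun s hs => by
      have hs' : s ∈ Icc 0 T := ⟨hs.1, hs.2.le.trans ht.2⟩
      rw [norm_mul, Complex.norm_exp_ofReal]
      have h1 : ‖g s‖ ≤ M * Real.exp (-(beta T α s * κ)) := by
        rw [Real.exp_neg, ← div_eq_mul_inv, le_div_iff₀' (Real.exp_pos _)]
        exact hg s hs'
      have h2 : -(beta T α s * κ) ≤ -(beta T α t * κ) + c * κ * t - c * κ * s := by
        have h3 := beta_sub_le hT hα.1 s t
        rw [abs_of_nonneg (sub_nonneg.mpr hs.2.le)] at h3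
        have h4 := mul_le_mul_of_nonneg_right h3 hκ0.le
        rw [← hc] at h4
        linarith
      calc Real.exp (κ ^ 2 * s) * ‖g s‖
          ≤ Real.exp (κ ^ 2 * s) *
            (M * Real.exp (-(beta T α t * κ) + c * κ * t - c * κ * s)) := by
            gcongr
            exact h1.trans (by gcongr)
        _ = K * Real.exp (μ * s) := by
            rw [hK, hμ, mul_assoc M, ← Real.exp_add, mul_left_comm (Real.exp _) M, ← Real.exp_add]
            ring_nf)
    (right_mem_Icc.mpr ht.1)
  rw [norm_mul, Complex.norm_exp_ofReal] at key
  -- As β(0) = 0, one has β(t)κ ≤ ctκ ≤ κ²t; the heat decay absorbs the whole weight, and the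
  -- initial value needs none.
  have hE : Real.exp (beta T α t * κ) ≤ Real.exp (κ ^ 2 * t) := by
    refine Real.exp_le_exp.mpr ?_
    have h3 := beta_sub_le hT hα.1 0 t
    rw [beta_zero hT, sub_zero, sub_zero, abs_of_nonneg ht.1, ← hc] at h3
    calc beta T α t * κ ≤ (c * t) * κ := by gcongr
      _ ≤ (1 * t) * κ := by gcongr; exact ht.1
      _ ≤ κ ^ 2 * t := by nlinarith [mul_nonneg (mul_nonneg ht.1 hκ0.le) (sub_nonneg.mpr hκ)]
  have hE2 : Real.exp (beta T α t * κ) * (K * Real.exp (μ * t) / μ) =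
      Real.exp (κ ^ 2 * t) * (M / μ) := by
    rw [hK, hμ]
    have : Real.exp (κ ^ 2 * t) = Real.exp (beta T α t * κ) *
        (Real.exp (-(beta T α t * κ) + c * κ * t) * Real.exp ((κ ^ 2 - c * κ) * t)) := by
      rw [← Real.exp_add, ← Real.exp_add]; ring_nf
    rw [this]; ring
  have hMμ : M / μ ≤ gain T α * M / κ ^ 2 := by
    rw [gain, ← hc]
    have h1c := sub_pos.mpr hc1
    calc M / μ ≤ M / ((1 - c) * κ ^ 2) := by gcongr
      _ = _ := by field_simp
  have hfin : Real.exp (κ ^ 2 * t) * (Real.exp (beta T α t * κ) * ‖y t‖) ≤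
      Real.exp (κ ^ 2 * t) * (‖y 0‖ + gain T α * M / κ ^ 2) := by
    calc _ = Real.exp (beta T α t * κ) * (Real.exp (κ ^ 2 * t) * ‖y t‖) := by ring
      _ ≤ Real.exp (beta T α t * κ) * (‖y 0‖ + K * Real.exp (μ * t) / μ) := by gcongr
      _ = Real.exp (beta T α t * κ) * ‖y 0‖ + Real.exp (κ ^ 2 * t) * (M / μ) := by
          rw [mul_add, hE2]
      _ ≤ Real.exp (κ ^ 2 * t) * ‖y 0‖ + Real.exp (κ ^ 2 * t) * (gain T α * M / κ ^ 2) := by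
          gcongr
      _ = _ := by ring
  exact le_of_mul_le_mul_left hfin (Real.exp_pos _)

/-- The heat equation `f_t = Δ f + F` for the nonzero Fourier modes. -/
def IsHeat (T : ℝ) (f F : SpaceTime n) : Prop :=
  ∀ k : Fin n → ℤ, k ≠ 0 → ∀ t ∈ Icc (0 : ℝ) T,
    HasDerivWithinAt (fun s => torusFourierCoeff (f s) k)
      (-(freqNorm k ^ 2 : ℝ) * torusFourierCoeff (f t) k + torusFourierCoeff (F t) k) (Icc 0 T) t

/-- The backward heat equation `f_t + Δ f + F = 0` for the nonzero Fourier modes. -/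
def IsBackwardHeat (T : ℝ) (f F : SpaceTime n) : Prop :=
  ∀ k : Fin n → ℤ, k ≠ 0 → ∀ t ∈ Icc (0 : ℝ) T,
    HasDerivWithinAt (fun s => torusFourierCoeff (f s) k)
      ((freqNorm k ^ 2 : ℝ) * torusFourierCoeff (f t) k - torusFourierCoeff (F t) k) (Icc 0 T) t

/-- Functions with vanishing spatial mean. -/
def IsMeanZero (T : ℝ) (f : SpaceTime n) : Prop :=
  ∀ t ∈ Icc (0 : ℝ) T, torusFourierCoeff (f t) 0 = 0

section Heat

variable {T α : ℝ} {f F g G : SpaceTime n}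

/-- The factor 1/|k|² of the mode estimate pays for the two extra powers in the weight with j = 2.
-/
lemma weight_two_mul_norm_le (hT : 0 < T) (hα : α ∈ Ioo 0 (T / 2)) {k : Fin n → ℤ} (hk : k ≠ 0)
    {y g : ℝ → ℂ} {M : ℝ}
    (hy : ∀ t ∈ Icc 0 T, HasDerivWithinAt y (-(freqNorm k ^ 2 : ℝ) * y t + g t) (Icc 0 T) t)
    (hg : ∀ t ∈ Icc 0 T, weight T α 0 k t * ‖g t‖ ≤ M) {t : ℝ} (ht : t ∈ Icc 0 T) :
    weight T α 2 k t * ‖y t‖ ≤ (1 + freqNorm k ^ 2) * ‖y 0‖ + gain T α * M := by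
  have hκ := one_le_freqNorm hk
  -- For j = 0 the polynomial factor is 1 + |k|^0 = 2, hence M / 2. It compensates (1 + |k|²)/|k|² ≤
  -- 2 below.
  have h1 := exp_beta_mul_norm_le hT hα hκ (M := M / 2) hy (fun s hs => by
    have := hg s hs
    simp only [weight, pow_zero] at this
    linarith) ht
  have hM : 0 ≤ M := le_trans
    (mul_nonneg (weight_pos T α 0 k t).le (norm_nonneg _)) (hg t ht)
  have hgp := gain_pos hT hα
  rw [weight, mul_assoc]
  calc _ ≤ (1 + freqNorm k ^ 2) * (‖y 0‖ + gain T α * (M / 2) / freqNorm k ^ 2) := by gcongr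
    _ = (1 + freqNorm k ^ 2) * ‖y 0‖ +
        ((1 + freqNorm k ^ 2) / freqNorm k ^ 2) * (gain T α * (M / 2)) := by ring
    _ ≤ (1 + freqNorm k ^ 2) * ‖y 0‖ + 2 * (gain T α * (M / 2)) := by
        gcongr
        rw [div_le_iff₀ (by positivity)]
        nlinarith
    _ = _ := by ring

lemma IsHeat.stENorm_le (hT : 0 < T) (hα : α ∈ Ioo 0 (T / 2)) (h : IsHeat T f F)
    (hf : IsMeanZero T f) (hF : stENorm T α 0 F < ⊤) :
    stENorm T α 2 f ≤ wienerENorm 2 (f 0) + ENNReal.ofReal (gain T α) * stENorm T α 0 F := by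
  simp only [stENorm_eq, wienerENorm]
  rw [← ENNReal.tsum_mul_left, ← ENNReal.tsum_add]
  refine ENNReal.tsum_le_tsum fun k => supCoeff_le fun t ht => ?_
  by_cases hk : k = 0
  · subst hk
    rw [hf t ht]
    simp
  · have hne : supCoeff T α 0 k (fun t => torusFourierCoeff (F t) k) ≠ ⊤ :=
      ENNReal.ne_top_of_tsum_ne_top hF.ne k
    have h1 := weight_two_mul_norm_le hT hα hk (h k hk)
      (M := (supCoeff T α 0 k fun t => torusFourierCoeff (F t) k).toReal)
      (fun s hs => (ENNReal.ofReal_le_iff_le_toReal hne).mp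
        (le_supCoeff hs 0 k fun t => torusFourierCoeff (F t) k)) ht
    refine (ENNReal.ofReal_le_ofReal h1).trans ?_
    have hgp := gain_pos hT hα
    rw [ENNReal.ofReal_add (by positivity) (by positivity), ENNReal.ofReal_mul hgp.le,
      ENNReal.ofReal_toReal hne]

lemma IsHeat.stNorm_le (hT : 0 < T) (hα : α ∈ Ioo 0 (T / 2)) (h : IsHeat T f F)
    (hf : IsMeanZero T f) (hf0 : MemB 2 (f 0)) (hF : MemST T α 0 F) :
    stNorm T α 2 f ≤ wienerNorm 2 (f 0) + gain T α * stNorm T α 0 F := by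
  have hgp := gain_pos hT hα
  have h1 := h.stENorm_le hT hα hf hF.finite
  have h2 : ENNReal.ofReal (gain T α) * stENorm T α 0 F ≠ ⊤ :=
    (ENNReal.mul_lt_top ENNReal.ofReal_lt_top hF.finite).ne
  have h3 := ENNReal.toReal_mono (ENNReal.add_ne_top.mpr ⟨hf0.finite.ne, h2⟩) h1
  rwa [ENNReal.toReal_add hf0.finite.ne h2, ENNReal.toReal_mul,
    ENNReal.toReal_ofReal hgp.le] at h3

lemma IsMeanZero.sub (hf : IsMeanZero T f) (hg : IsMeanZero T g)
    (hfc : ∀ t ∈ Icc 0 T, Continuous (f t)) (hgc : ∀ t ∈ Icc 0 T, Continuous (g t)) :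
    IsMeanZero T (fun t x => f t x - g t x) := fun t ht => by
  rw [torusFourierCoeff_sub (hfc t ht) (hgc t ht), hf t ht, hg t ht, sub_zero]

lemma IsHeat.sub (hf : IsHeat T f F) (hg : IsHeat T g G)
    (hfc : ∀ t ∈ Icc 0 T, Continuous (f t)) (hgc : ∀ t ∈ Icc 0 T, Continuous (g t))
    (hFc : ∀ t ∈ Icc 0 T, Continuous (F t)) (hGc : ∀ t ∈ Icc 0 T, Continuous (G t)) :
    IsHeat T (fun t x => f t x - g t x) (fun t x => F t x - G t x) := by
  intro k hk t ht
  have h1 : ∀ s ∈ Icc 0 T, torusFourierCoeff (fun x => f s x - g s x) k =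
      torusFourierCoeff (f s) k - torusFourierCoeff (g s) k :=
    fun s hs => torusFourierCoeff_sub (hfc s hs) (hgc s hs) k
  have h2 := ((hf k hk t ht).sub (hg k hk t ht)).congr h1 (h1 t ht)
  refine h2.congr_deriv ?_
  rw [h1 t ht, torusFourierCoeff_sub (hFc t ht) (hGc t ht)]
  ring

/-- A single Fourier mode of the solution of the heat equation. -/
def heatMode (T lam : ℝ) (y₀ : ℂ) (g : ℝ → ℂ) (t : ℝ) : ℂ :=
  (Real.exp (-(lam * t)) : ℝ) * (y₀ + timePrimitive T (fun s => (Real.exp (lam * s) : ℝ) * g s) t)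

lemma heatMode_zero (T lam : ℝ) (y₀ : ℂ) (g : ℝ → ℂ) : heatMode T lam y₀ g 0 = y₀ := by
  simp [heatMode, timePrimitive_zero]

lemma heatMode_conj (T lam : ℝ) (y₀ : ℂ) (g : ℝ → ℂ) (t : ℝ) :
    heatMode T lam ((starRingEnd ℂ) y₀) (fun s => (starRingEnd ℂ) (g s)) t =
      (starRingEnd ℂ) (heatMode T lam y₀ g t) := by
  simp only [heatMode, map_mul, map_add, Complex.conj_ofReal, ← timePrimitive_conj]

lemma hasDerivWithinAt_heatMode (hT : 0 < T) (lam : ℝ) (y₀ : ℂ) {g : ℝ → ℂ}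
    (hg : ContinuousOn g (Icc 0 T)) {t : ℝ} (ht : t ∈ Icc 0 T) :
    HasDerivWithinAt (heatMode T lam y₀ g) (-(lam : ℂ) * heatMode T lam y₀ g t + g t)
      (Icc 0 T) t := by
  have hg2 : ContinuousOn (fun s => ((Real.exp (lam * s) : ℝ) : ℂ) * g s) (Icc 0 T) := by
    refine ContinuousOn.mul ?_ hg
    fun_prop
  have h1 : HasDerivAt (fun s : ℝ => ((Real.exp (-(lam * s)) : ℝ) : ℂ))
      ((Real.exp (-(lam * t)) * (-(lam * 1)) : ℝ) : ℂ) t :=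
    (((hasDerivAt_id t).const_mul lam).neg.exp).ofReal_comp
  have h2 := h1.hasDerivWithinAt.mul
    ((hasDerivWithinAt_timePrimitive hT hg2 ht).const_add y₀)
  refine h2.congr_deriv ?_
  have h3 : ((Real.exp (-(lam * t)) : ℝ) : ℂ) * ((Real.exp (lam * t) : ℝ) : ℂ) = 1 := by
    rw [← Complex.ofReal_mul, ← Real.exp_add]; simp
  rw [heatMode]
  push_cast at h3 ⊢
  linear_combination (g t) * h3

/-- Solvability of the heat equation. -/
lemma exists_isHeat (hT : 0 < T) (hα : α ∈ Ioo 0 (T / 2)) {f₀ : E n → ℝ} (hf₀ : MemB 2 f₀)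
    (hz : torusFourierCoeff f₀ 0 = 0) (hF : MemST T α 0 F) :
    ∃ f : SpaceTime n, MemST T α 2 f ∧ IsMeanZero T f ∧ IsHeat T f F ∧ f 0 = f₀ := by
  classical
  -- The zero mode is set to zero whatever the mean of F is; only the nonzero modes have to satisfy
  -- the equation.
  set y : ℝ → (Fin n → ℤ) → ℂ := fun t k => if k = 0 then 0 else
    heatMode T (freqNorm k ^ 2) (torusFourierCoeff f₀ k) (fun s => torusFourierCoeff (F s) k) t
    with hy
  have hyd : ∀ k ≠ 0, ∀ t ∈ Icc 0 T, HasDerivWithinAt (fun s => y s k)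
      (-(freqNorm k ^ 2 : ℝ) * y t k + torusFourierCoeff (F t) k) (Icc 0 T) t := by
    intro k hk t ht
    simp only [hy, if_neg hk]
    exact hasDerivWithinAt_heatMode hT _ _ (hF.continuousOn_coeff k) ht
  have hy0 : y 0 = torusFourierCoeff f₀ := by
    ext k
    simp only [hy]
    split_ifs with hk
    · rw [hk, hz]
    · rw [heatMode_zero]
  have hyk : ∀ k, ContinuousOn (fun t => y t k) (Icc 0 T) := by
    intro k
    by_cases hk : k = 0
    · simp only [hy, if_pos hk]
      exact continuousOn_const
    · exact fun t ht => (hyd k hk t ht).continuousWithinAt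
  -- Hermitian symmetry of the data and the source is inherited by Duhamel's formula, so the
  -- solution is real.
  have hyc : ∀ t k, y t (-k) = (starRingEnd ℂ) (y t k) := by
    intro t k
    simp only [hy, neg_eq_zero]
    split_ifs with hk
    · simp
    · rw [← heatMode_conj]
      have : freqNorm (-k) = freqNorm k := by simp [freqNorm]
      simp only [torusFourierCoeff_neg_freq, this]
  obtain ⟨M, hM, hM0, hFM⟩ := hF.exists_majorant
  have hbound : ∀ t ∈ Icc (0 : ℝ) T, ∀ k, weight T α 2 k t * ‖y t k‖ ≤
      (1 + freqNorm k ^ 2) * ‖torusFourierCoeff f₀ k‖ + gain T α * M k := by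
    intro t ht k
    have hgp := gain_pos hT hα
    by_cases hk : k = 0
    · simp only [hy, if_pos hk]
      have := hM0 k
      simp only [norm_zero, mul_zero]
      positivity
    · have := weight_two_mul_norm_le hT hα hk (hyd k hk) (fun s hs => hFM s hs k) ht
      rwa [hy0] at this
  have hsum : Summable fun k => (1 + freqNorm k ^ 2) * ‖torusFourierCoeff f₀ k‖ +
      gain T α * M k := hf₀.wiener_summable.add (hM.mul_left _)
  have hys : ∀ t ∈ Icc (0 : ℝ) T, Summable (y t) := fun t ht =>
    Summable.of_norm_bounded hsum fun k =>
      norm_le_of_weight_mul_norm_le hT hα.1 ht (hbound t ht k)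
  have hfc : ∀ t ∈ Icc (0 : ℝ) T, torusFourierCoeff (realSeries (y t)) = y t := fun t ht =>
    torusFourierCoeff_realSeries (hys t ht) (hyc t)
  refine ⟨fun t => realSeries (y t), ?_, ?_, ?_, ?_⟩
  · refine memST_of_coeff hT hα.1 (fun t _ => isPeriodic_realSeries _)
      (fun t ht => continuous_realSeries (hys t ht)) (fun k => ?_) ?_
    · exact (hyk k).congr fun t ht => by rw [hfc t ht]
    · rw [stENorm_eq]
      refine lt_of_le_of_lt (le_of_eq (tsum_congr fun k => supCoeff_congr fun t ht => ?_))
        (tsum_supCoeff_lt_top hsum hbound)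
      rw [hfc t ht]
  · intro t ht
    rw [hfc t ht]
    simp [hy]
  · intro k hk t ht
    rw [hfc t ht]
    exact (hyd k hk t ht).congr (fun s hs => by rw [hfc s hs]) (by rw [hfc t ht])
  · simp only
    rw [hy0, realSeries_torusFourierCoeff hf₀.periodic hf₀.continuous hf₀.summable]

lemma stENorm_reflect_le (hT : 0 < T) (hα : 0 < α) (j : ℕ) (f : SpaceTime n) :
    stENorm T α j (fun t => f (T - t)) ≤ stENorm T α j f := by
  simp only [stENorm_eq]
  refine ENNReal.tsum_le_tsum fun k => supCoeff_le fun t ht => ?_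
  refine le_trans (le_of_eq ?_) (le_supCoeff (reflect_mem ht) j k _)
  rw [weight, weight, beta_reflect hT hα]

lemma stENorm_reflect (hT : 0 < T) (hα : 0 < α) (j : ℕ) (f : SpaceTime n) :
    stENorm T α j (fun t => f (T - t)) = stENorm T α j f := by
  refine (stENorm_reflect_le hT hα j f).antisymm ?_
  refine le_trans (le_of_eq ?_) (stENorm_reflect_le hT hα j fun t => f (T - t))
  simp

lemma MemST.reflect (hT : 0 < T) (hα : 0 < α) {j : ℕ} (hf : MemST T α j f) :
    MemST T α j (fun t => f (T - t)) := by
  refine memST_of_coeff hT hα (fun t ht => hf.periodic (reflect_mem ht))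
    (fun t ht => hf.continuous_space (reflect_mem ht)) (fun k => ?_) ?_
  · exact (hf.continuousOn_coeff k).comp (by fun_prop) fun t ht => reflect_mem ht
  · rw [stENorm_reflect hT hα]
    exact hf.finite

lemma IsBackwardHeat.reflect (h : IsBackwardHeat T f F) :
    IsHeat T (fun t => f (T - t)) (fun t => F (T - t)) := by
  intro k hk t ht
  refine (hasDerivWithinAt_reflect (h k hk (T - t) (reflect_mem ht))).congr_deriv ?_
  ring

lemma IsHeat.reflect (h : IsHeat T f F) :
    IsBackwardHeat T (fun t => f (T - t)) (fun t => F (T - t)) := by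
  intro k hk t ht
  refine (hasDerivWithinAt_reflect (h k hk (T - t) (reflect_mem ht))).congr_deriv ?_
  ring

lemma IsBackwardHeat.stNorm_le (hT : 0 < T) (hα : α ∈ Ioo 0 (T / 2)) (h : IsBackwardHeat T f F)
    (hf : IsMeanZero T f) (hf0 : MemB 2 (f T)) (hF : MemST T α 0 F) :
    stNorm T α 2 f ≤ wienerNorm 2 (f T) + gain T α * stNorm T α 0 F := by
  have h1 := h.reflect.stNorm_le hT hα (fun t ht => hf _ (reflect_mem ht))
    (by simpa using hf0) (hF.reflect hT hα.1)
  simpa only [stNorm, stENorm_reflect hT hα.1, sub_zero] using h1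

lemma IsBackwardHeat.sub (hf : IsBackwardHeat T f F) (hg : IsBackwardHeat T g G)
    (hfc : ∀ t ∈ Icc 0 T, Continuous (f t)) (hgc : ∀ t ∈ Icc 0 T, Continuous (g t))
    (hFc : ∀ t ∈ Icc 0 T, Continuous (F t)) (hGc : ∀ t ∈ Icc 0 T, Continuous (G t)) :
    IsBackwardHeat T (fun t x => f t x - g t x) (fun t x => F t x - G t x) := by
  have h := (hf.reflect.sub hg.reflect (fun t ht => hfc _ (reflect_mem ht))
    (fun t ht => hgc _ (reflect_mem ht)) (fun t ht => hFc _ (reflect_mem ht))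
    (fun t ht => hGc _ (reflect_mem ht))).reflect
  simpa only [sub_sub_cancel] using h

lemma exists_isBackwardHeat (hT : 0 < T) (hα : α ∈ Ioo 0 (T / 2)) {f₀ : E n → ℝ}
    (hf₀ : MemB 2 f₀) (hz : torusFourierCoeff f₀ 0 = 0) (hF : MemST T α 0 F) :
    ∃ f : SpaceTime n, MemST T α 2 f ∧ IsMeanZero T f ∧ IsBackwardHeat T f F ∧ f T = f₀ := by
  obtain ⟨f, h1, h2, h3, h4⟩ := exists_isHeat hT hα hf₀ hz (hF.reflect hT hα.1)
  refine ⟨fun t => f (T - t), h1.reflect hT hα.1, fun t ht => h2 _ (reflect_mem ht), ?_, ?_⟩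
  · simpa only [sub_sub_cancel] using h3.reflect
  · simpa using h4

end Heat

/-! ### A complete coefficient space and the contraction principle -/

/-- The Banach space of weighted Fourier coefficients. -/
abbrev CoeffSpace (n : ℕ) (T : ℝ) : Type := lp (fun _ : Fin n → ℤ => C(Icc (0 : ℝ) T, ℂ)) 1

section Encoding

variable {T α : ℝ}

/-- The Fourier coefficients encoded by an element of `CoeffSpace`. -/
def decodeCoeff (hT : 0 < T) (α : ℝ) (x : CoeffSpace n T) (t : ℝ) (k : Fin n → ℤ) : ℂ :=
  x k (projIcc 0 T hT.le t) / (weight T α 2 k (projIcc 0 T hT.le t) : ℝ)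

/-- The function encoded by an element of `CoeffSpace`. -/
def decode (hT : 0 < T) (α : ℝ) (x : CoeffSpace n T) : SpaceTime n :=
  fun t => realSeries (decodeCoeff hT α x t)

/-- The elements that encode real functions with vanishing mean. -/
def realMeanZero (n : ℕ) (T : ℝ) : Set (CoeffSpace n T) :=
  {x | x 0 = 0 ∧ ∀ k t, x (-k) t = (starRingEnd ℂ) (x k t)}

lemma CoeffSpace.hasSum_norm (x : CoeffSpace n T) : HasSum (fun k => ‖x k‖) ‖x‖ := by
  have := lp.hasSum_norm (p := 1) (by simp) x
  simpa using this

lemma isClosed_realMeanZero : IsClosed (realMeanZero n T) := by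
  have h : ∀ k : Fin n → ℤ, Continuous fun x : CoeffSpace n T => x k := fun k =>
    (continuous_apply k).comp lp.uniformContinuous_coe.continuous
  have h2 : ∀ (k : Fin n → ℤ) (t : Icc (0 : ℝ) T), Continuous fun x : CoeffSpace n T => x k t :=
    fun k t => (continuous_eval_const t).comp (h k)
  have h3 : realMeanZero n T = {x | x 0 = 0} ∩
      ⋂ k, ⋂ t, {x | x (-k) t = (starRingEnd ℂ) (x k t)} := by
    ext x; simp only [realMeanZero, mem_ofPred_eq, mem_inter_iff, mem_iInter]
  rw [h3]
  refine (isClosed_eq (h 0) continuous_const).inter ?_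
  exact isClosed_iInter fun k => isClosed_iInter fun t =>
    isClosed_eq (h2 (-k) t) (Complex.continuous_conj.comp (h2 k t))

lemma zero_mem_realMeanZero : (0 : CoeffSpace n T) ∈ realMeanZero n T := by
  simp [realMeanZero]

lemma weight_neg (T α : ℝ) (j : ℕ) (k : Fin n → ℤ) (t : ℝ) :
    weight T α j (-k) t = weight T α j k t := by
  simp [weight, freqNorm]

lemma continuous_weight (hT : 0 < T) (hα : 0 < α) (j : ℕ) (k : Fin n → ℤ) :
    Continuous (weight T α j k) := by
  have := continuous_beta hT hα
  unfold weight
  fun_prop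

lemma weight_mul_norm_decodeCoeff (hT : 0 < T) (α : ℝ) (x : CoeffSpace n T) {t : ℝ}
    (ht : t ∈ Icc 0 T) (k : Fin n → ℤ) :
    weight T α 2 k t * ‖decodeCoeff hT α x t k‖ = ‖x k ⟨t, ht⟩‖ := by
  have hw := weight_pos T α 2 k t
  rw [decodeCoeff, projIcc_of_mem hT.le ht, norm_div, Complex.norm_real, Real.norm_of_nonneg hw.le,
    mul_div_cancel₀ _ hw.ne']

lemma weight_mul_norm_decodeCoeff_le (hT : 0 < T) (α : ℝ) (x : CoeffSpace n T) :
    ∀ t ∈ Icc 0 T, ∀ k, weight T α 2 k t * ‖decodeCoeff hT α x t k‖ ≤ ‖x k‖ := by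
  intro t ht k
  rw [weight_mul_norm_decodeCoeff hT α x ht]
  exact (x k).norm_coe_le_norm _

/-- Decoding divides by the weight, so the weighted supremum of a decoded mode is the uniform norm
of the entry: the encoding is isometric. -/
lemma tsum_supCoeff_decodeCoeff (hT : 0 < T) (α : ℝ) (x : CoeffSpace n T) :
    ∑' k, supCoeff T α 2 k (fun t => decodeCoeff hT α x t k) = ENNReal.ofReal ‖x‖ := by
  rw [← x.hasSum_norm.tsum_eq, ENNReal.ofReal_tsum_of_nonneg (fun k => norm_nonneg _)
    x.hasSum_norm.summable]
  refine tsum_congr fun k => le_antisymm (supCoeff_le fun t ht =>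
    ENNReal.ofReal_le_ofReal (weight_mul_norm_decodeCoeff_le hT α x t ht k)) ?_
  by_cases htop : supCoeff T α 2 k (fun t => decodeCoeff hT α x t k) = ⊤
  · rw [htop]; exact le_top
  rw [ENNReal.ofReal_le_iff_le_toReal htop, ContinuousMap.norm_le _ ENNReal.toReal_nonneg]
  intro t
  rw [← weight_mul_norm_decodeCoeff hT α x t.2 k, ← ENNReal.ofReal_le_iff_le_toReal htop]
  exact le_supCoeff t.2 2 k fun t => decodeCoeff hT α x t k

lemma summable_decodeCoeff (hT : 0 < T) (hα : 0 < α) (x : CoeffSpace n T) (t : ℝ) :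
    Summable (decodeCoeff hT α x t) := by
  have h : ∀ t ∈ Icc 0 T, Summable (decodeCoeff hT α x t) := fun t ht =>
    Summable.of_norm_bounded x.hasSum_norm.summable fun k =>
      norm_le_of_weight_mul_norm_le hT hα ht (weight_mul_norm_decodeCoeff_le hT α x t ht k)
  have h2 : decodeCoeff hT α x t = decodeCoeff hT α x (projIcc 0 T hT.le t) := by
    ext k; simp [decodeCoeff]
  rw [h2]
  exact h _ (projIcc 0 T hT.le t).2

lemma torusFourierCoeff_decode (hT : 0 < T) (hα : 0 < α) {x : CoeffSpace n T}
    (hx : x ∈ realMeanZero n T) (t : ℝ) :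
    torusFourierCoeff (decode hT α x t) = decodeCoeff hT α x t := by
  refine torusFourierCoeff_realSeries (summable_decodeCoeff hT hα x t) fun k => ?_
  rw [decodeCoeff, decodeCoeff, hx.2, weight_neg, map_div₀, Complex.conj_ofReal]

lemma memST_decode (hT : 0 < T) (hα : 0 < α) {x : CoeffSpace n T} (hx : x ∈ realMeanZero n T) :
    MemST T α 2 (decode hT α x) := by
  refine memST_of_coeff hT hα (fun t _ => isPeriodic_realSeries _)
    (fun t _ => continuous_realSeries (summable_decodeCoeff hT hα x t)) (fun k => ?_) ?_
  · simp only [torusFourierCoeff_decode hT hα hx, decodeCoeff]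
    refine Continuous.continuousOn ?_
    have hw := continuous_weight hT hα 2 k
    have hp : Continuous fun t => projIcc 0 T hT.le t := continuous_projIcc
    refine Continuous.div₀ ((x k).continuous.comp hp)
      (Complex.continuous_ofReal.comp (hw.comp (continuous_subtype_val.comp hp))) fun t => ?_
    exact_mod_cast (weight_pos T α 2 k _).ne'
  · simp only [stENorm_eq, torusFourierCoeff_decode hT hα hx, tsum_supCoeff_decodeCoeff]
    exact ENNReal.ofReal_lt_top

lemma isMeanZero_decode (hT : 0 < T) (hα : 0 < α) {x : CoeffSpace n T}
    (hx : x ∈ realMeanZero n T) : IsMeanZero T (decode hT α x) := fun t _ => by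
  rw [torusFourierCoeff_decode hT hα hx, decodeCoeff, hx.1]
  simp

lemma stNorm_decode_sub (hT : 0 < T) (hα : 0 < α) {x y : CoeffSpace n T}
    (hx : x ∈ realMeanZero n T) (hy : y ∈ realMeanZero n T) :
    stNorm T α 2 (decode hT α x - decode hT α y) = ‖x - y‖ := by
  rw [stNorm, stENorm_eq, ← ENNReal.toReal_ofReal (norm_nonneg (x - y)),
    ← tsum_supCoeff_decodeCoeff hT α (x - y)]
  congr 1
  refine tsum_congr fun k => supCoeff_congr fun t _ => ?_
  have hc : ∀ z : CoeffSpace n T, Continuous (decode hT α z t) := fun z =>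
    continuous_realSeries (summable_decodeCoeff hT hα z t)
  rw [Pi.sub_apply, torusFourierCoeff_sub' (hc x) (hc y), torusFourierCoeff_decode hT hα hx,
    torusFourierCoeff_decode hT hα hy, decodeCoeff, decodeCoeff, decodeCoeff, ← sub_div]
  rfl

lemma stNorm_decode (hT : 0 < T) (hα : 0 < α) {x : CoeffSpace n T}
    (hx : x ∈ realMeanZero n T) : stNorm T α 2 (decode hT α x) = ‖x‖ := by
  have h := stNorm_decode_sub hT hα hx zero_mem_realMeanZero
  have h0 : decode hT α (0 : CoeffSpace n T) = 0 := by
    ext t x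
    simp [decode, realSeries, series, decodeCoeff]
  rwa [h0, sub_zero, sub_zero] at h

/-- Multiplication by the weight inverts decoding. Agreement is limited to [0, T], because decoded
functions are frozen outside it while f is arbitrary there. -/
lemma exists_decode_eq (hT : 0 < T) (hα : 0 < α) {f : SpaceTime n} (hf : MemST T α 2 f)
    (hz : IsMeanZero T f) :
    ∃ x ∈ realMeanZero n T, ∀ t ∈ Icc 0 T, decode hT α x t = f t := by
  let c : ∀ _ : Fin n → ℤ, C(Icc (0 : ℝ) T, ℂ) := fun k =>
    ⟨fun t => (weight T α 2 k t : ℝ) * torusFourierCoeff (f t) k,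
      ((Complex.continuous_ofReal.comp ((continuous_weight hT hα 2 k).comp
        continuous_subtype_val)).mul (hf.continuousOn_coeff k).domRestrict)⟩
  obtain ⟨M, hM, hM0, hfM⟩ := hf.exists_majorant
  have hcM : ∀ k, ‖c k‖ ≤ M k := fun k => by
    rw [ContinuousMap.norm_le _ (hM0 k)]
    intro t
    simp only [c, ContinuousMap.coe_mk, norm_mul, Complex.norm_real,
      Real.norm_of_nonneg (weight_pos T α 2 k t).le]
    exact hfM t t.2 k
  have hc : Memℓp c 1 := by
    refine memℓp_gen ?_
    simp only [ENNReal.toReal_one, Real.rpow_one]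
    exact Summable.of_nonneg_of_le (fun k => norm_nonneg _) hcM hM
  refine ⟨⟨c, hc⟩, ⟨?_, fun k t => ?_⟩, fun t ht => ?_⟩
  · ext t
    change (weight T α 2 0 t : ℝ) * torusFourierCoeff (f t) 0 = (0 : ℂ)
    rw [hz t t.2, mul_zero]
  · change (weight T α 2 (-k) t : ℝ) * torusFourierCoeff (f t) (-k) =
      (starRingEnd ℂ) ((weight T α 2 k t : ℝ) * torusFourierCoeff (f t) k)
    rw [weight_neg, torusFourierCoeff_neg_freq, map_mul, Complex.conj_ofReal]
  · rw [hf.eq_realSeries ht, decode]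
    congr 1
    ext k
    rw [decodeCoeff, projIcc_of_mem hT.le ht]
    change (weight T α 2 k t : ℝ) * torusFourierCoeff (f t) k / (weight T α 2 k t : ℝ) = _
    rw [mul_div_cancel_left₀]
    exact_mod_cast (weight_pos T α 2 k t).ne'

/-- The admissible functions in the fixed point argument. -/
structure IsAdmissible (T α ρ : ℝ) (f : SpaceTime n) : Prop where
  mem : MemST T α 2 f
  meanZero : IsMeanZero T f
  norm_le : stNorm T α 2 f ≤ ρ

lemma IsAdmissible.mono {ρ ρ' : ℝ} {f : SpaceTime n} (hf : IsAdmissible T α ρ f) (h : ρ ≤ ρ') :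
    IsAdmissible T α ρ' f := ⟨hf.mem, hf.meanZero, hf.norm_le.trans h⟩

/-- Banach's fixed point theorem for a contracting relation between pairs of functions. -/
theorem exists_fixedPoint_of_contracting (hT : 0 < T) (hα : 0 < α) {ρ : ℝ} (hρ : 0 ≤ ρ)
    {P : SpaceTime n → SpaceTime n → SpaceTime n → SpaceTime n → Prop}
    (hex : ∀ w μ, IsAdmissible T α ρ w → IsAdmissible T α ρ μ →
      ∃ w' μ', IsAdmissible T α ρ w' ∧ IsAdmissible T α ρ μ' ∧ P w μ w' μ')
    (hcongr : ∀ w μ w' μ' w'' μ'', P w μ w' μ' → (∀ t ∈ Icc 0 T, w'' t = w' t) →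
      (∀ t ∈ Icc 0 T, μ'' t = μ' t) → P w μ w'' μ'')
    (hcontr : ∀ w₁ μ₁ w₁' μ₁' w₂ μ₂ w₂' μ₂',
      IsAdmissible T α ρ w₁ → IsAdmissible T α ρ μ₁ → IsAdmissible T α ρ w₁' →
      IsAdmissible T α ρ μ₁' → IsAdmissible T α ρ w₂ → IsAdmissible T α ρ μ₂ →
      IsAdmissible T α ρ w₂' → IsAdmissible T α ρ μ₂' →
      P w₁ μ₁ w₁' μ₁' → P w₂ μ₂ w₂' μ₂' →
      max (stNorm T α 2 (w₁' - w₂')) (stNorm T α 2 (μ₁' - μ₂')) ≤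
        1 / 2 * max (stNorm T α 2 (w₁ - w₂)) (stNorm T α 2 (μ₁ - μ₂))) :
    ∃ w μ, IsAdmissible T α ρ w ∧ IsAdmissible T α ρ μ ∧ P w μ w μ := by
  -- Completeness comes from encoding admissible pairs as a closed subset of a product of ℓ¹ spaces.
  set s : Set (CoeffSpace n T × CoeffSpace n T) :=
    (realMeanZero n T ∩ Metric.closedBall 0 ρ) ×ˢ (realMeanZero n T ∩ Metric.closedBall 0 ρ)
  have hs : IsComplete s :=
    ((isClosed_realMeanZero.inter Metric.isClosed_closedBall).prod
      (isClosed_realMeanZero.inter Metric.isClosed_closedBall)).isComplete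
  have hadm : ∀ x ∈ realMeanZero n T ∩ Metric.closedBall 0 ρ,
      IsAdmissible T α ρ (decode hT α x) := fun x hx =>
    ⟨memST_decode hT hα hx.1, isMeanZero_decode hT hα hx.1, by
      rw [stNorm_decode hT hα hx.1]; simpa using hx.2⟩
  have henc : ∀ f : SpaceTime n, IsAdmissible T α ρ f →
      ∃ x ∈ realMeanZero n T ∩ Metric.closedBall 0 ρ, ∀ t ∈ Icc 0 T, decode hT α x t = f t := by
    intro f hf
    obtain ⟨x, hx, hxf⟩ := exists_decode_eq hT hα hf.mem hf.meanZero
    refine ⟨x, ⟨hx, ?_⟩, hxf⟩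
    rw [mem_closedBall_zero_iff, ← stNorm_decode hT hα hx, stNorm_congr hxf]
    exact hf.norm_le
  have hstep : ∀ z ∈ s, ∃ z' ∈ s, P (decode hT α z.1) (decode hT α z.2)
      (decode hT α z'.1) (decode hT α z'.2) := by
    intro z hz
    obtain ⟨w', μ', hw', hμ', hP⟩ := hex _ _ (hadm z.1 hz.1) (hadm z.2 hz.2)
    obtain ⟨x, hx, hxw⟩ := henc w' hw'
    obtain ⟨y, hy, hyμ⟩ := henc μ' hμ'
    exact ⟨(x, y), ⟨hx, hy⟩, hcongr _ _ _ _ _ _ hP hxw hyμ⟩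
  -- The relation determines functions at most on [0, T], so a genuine self-map is chosen on
  -- encodings.
  choose! F hFs hFP using hstep
  have hcon : ContractingWith (1 / 2) (MapsTo.restrict F s s hFs) := by
    refine ⟨by rw [← NNReal.coe_lt_coe]; norm_num, LipschitzWith.of_dist_le_mul fun z₁ z₂ => ?_⟩
    have h1 := hcontr _ _ _ _ _ _ _ _ (hadm _ z₁.2.1) (hadm _ z₁.2.2)
      (hadm _ (hFs z₁ z₁.2).1) (hadm _ (hFs z₁ z₁.2).2) (hadm _ z₂.2.1) (hadm _ z₂.2.2)
      (hadm _ (hFs z₂ z₂.2).1) (hadm _ (hFs z₂ z₂.2).2) (hFP z₁ z₁.2) (hFP z₂ z₂.2)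
    rw [stNorm_decode_sub hT hα (hFs z₁ z₁.2).1.1 (hFs z₂ z₂.2).1.1,
      stNorm_decode_sub hT hα (hFs z₁ z₁.2).2.1 (hFs z₂ z₂.2).2.1,
      stNorm_decode_sub hT hα z₁.2.1.1 z₂.2.1.1, stNorm_decode_sub hT hα z₁.2.2.1 z₂.2.2.1] at h1
    rw [Subtype.dist_eq, Subtype.dist_eq, Prod.dist_eq, Prod.dist_eq]
    simp only [dist_eq_norm]
    have h2 : ((1 / 2 : NNReal) : ℝ) = 1 / 2 := by norm_num
    rw [h2]
    exact h1
  have h0 : (0 : CoeffSpace n T × CoeffSpace n T) ∈ s :=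
    ⟨⟨zero_mem_realMeanZero, by simpa using hρ⟩, ⟨zero_mem_realMeanZero, by simpa using hρ⟩⟩
  obtain ⟨z, hz, hfix, -⟩ := ContractingWith.exists_fixedPoint' hs hFs hcon h0 (edist_ne_top _ _)
  have h1 := hFP z hz
  rw [hfix] at h1
  exact ⟨_, _, hadm _ hz.1, hadm _ hz.2, h1⟩

end Encoding

/-! ### The linear step and its Lipschitz estimates -/

section Algebra

variable {T α : ℝ} {j : ℕ}

lemma memST_zero (hT : 0 < T) (hα : 0 < α) : MemST T α j (0 : SpaceTime n) :=
  memST_const hT hα (c := fun _ => 0) continuousOn_const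

lemma stNorm_zero (T α : ℝ) (j : ℕ) : stNorm T α j (0 : SpaceTime n) = 0 := by
  have h : stENorm T α j (0 : SpaceTime n) = 0 := by
    rw [stENorm_eq, ENNReal.tsum_eq_zero]
    intro k
    refine le_antisymm (supCoeff_le fun t _ => ?_) bot_le
    have : torusFourierCoeff ((0 : SpaceTime n) t) k = 0 := torusFourierCoeff_zero_fun k
    rw [this, norm_zero, mul_zero, ENNReal.ofReal_zero]
  rw [stNorm, h, ENNReal.toReal_zero]

lemma MemST.neg (hT : 0 < T) (hα : 0 < α) {f : SpaceTime n} (hf : MemST T α j f) :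
    MemST T α j (fun t x => -f t x) :=
  (hf.const_mul hT hα (-1)).congr fun t _ => by ext x; ring

lemma memST_finset_sum (hT : 0 < T) (hα : 0 < α) {ι : Type*} (s : Finset ι)
    {f : ι → SpaceTime n} (hf : ∀ i ∈ s, MemST T α j (f i)) :
    MemST T α j (fun t x => ∑ i ∈ s, f i t x) ∧
      stNorm T α j (fun t x => ∑ i ∈ s, f i t x) ≤ ∑ i ∈ s, stNorm T α j (f i) := by
  classical
  induction s using Finset.induction_on with
  | empty =>
    simp only [Finset.sum_empty]
    exact ⟨memST_zero hT hα, (stNorm_zero T α j).le⟩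
  | insert i s hi ih =>
    obtain ⟨h1, h2⟩ := ih fun l hl => hf l (Finset.mem_insert_of_mem hl)
    have h3 := hf i (Finset.mem_insert_self i s)
    simp only [Finset.sum_insert hi]
    exact ⟨h3.add hT hα h1, (stNorm_add_le h3 h1).trans (by gcongr)⟩

lemma spaceDeriv_sub (hT : 0 < T) (hα : 0 < α) {f g : SpaceTime n} (hf : MemST T α (j + 1) f)
    (hg : MemST T α (j + 1) g) (i : Fin n) {t : ℝ} (ht : t ∈ Icc 0 T) (x : E n) :
    spaceDeriv i (fun t x => f t x - g t x) t x = spaceDeriv i f t x - spaceDeriv i g t x := by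
  simp only [spaceDeriv]
  rw [fderiv_fun_sub (hf.differentiable hT hα ht x) (hg.differentiable hT hα ht x)]
  rfl

lemma spaceGrad_apply (w : SpaceTime n) (t : ℝ) (x : E n) (i : Fin n) :
    spaceGrad w t x i = spaceDeriv i w t x := gradient_apply _ _ _

lemma stNorm_spaceDeriv_sub_le (hT : 0 < T) (hα : 0 < α) {f g : SpaceTime n}
    (hf : MemST T α (j + 1) f) (hg : MemST T α (j + 1) g) (i : Fin n) :
    stNorm T α j (fun t x => spaceDeriv i f t x - spaceDeriv i g t x) ≤
      2 * stNorm T α (j + 1) (fun t x => f t x - g t x) := by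
  refine le_trans (le_of_eq (stNorm_congr fun t ht => ?_))
    (stNorm_spaceDeriv_le hT hα (hf.sub hT hα hg) i)
  ext x
  exact (spaceDeriv_sub hT hα hf hg i ht x).symm

/-- There are n components, and each derivative costs a factor 2. -/
lemma stNormVec_spaceGrad_sub_le (hT : 0 < T) (hα : 0 < α) {w₁ w₂ : SpaceTime n}
    (h₁ : MemST T α 2 w₁) (h₂ : MemST T α 2 w₂) :
    stNormVec T α 1 (spaceGrad w₁ - spaceGrad w₂) ≤ 2 * n * stNorm T α 2 (w₁ - w₂) := by
  have h : ∀ i ∈ (Finset.univ : Finset (Fin n)),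
      stNorm T α 1 (fun t x => (spaceGrad w₁ - spaceGrad w₂) t x i) ≤
        2 * stNorm T α 2 (w₁ - w₂) := by
    intro i _
    refine le_trans (le_of_eq (stNorm_congr fun t ht => ?_))
      (stNorm_spaceDeriv_sub_le hT hα h₁ h₂ i)
    ext x
    simp only [Pi.sub_apply, PiLp.sub_apply, spaceGrad_apply]
  refine (Finset.sum_le_sum h).trans (le_of_eq ?_)
  simp
  ring

lemma stNorm_le_stNormVec (F : ℝ → E n → E n) (i : Fin n) :
    stNorm T α j (fun t x => F t x i) ≤ stNormVec T α j F :=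
  Finset.single_le_sum (f := fun i => stNorm T α j (fun t x => F t x i))
    (fun _ _ => stNorm_nonneg _ _ _ _) (Finset.mem_univ i)

end Algebra

/-- The components of the flux `(μ + m̄) H_p`. -/
def flux (H : Hamiltonian n) (i : Fin n) (w μ : SpaceTime n) : SpaceTime n :=
  fun t x => (μ t x + mbar n) * Theta H w μ t x i

/-- The divergence of the flux. -/
def divFlux (H : Hamiltonian n) (w μ : SpaceTime n) : SpaceTime n :=
  fun t x => ∑ i, spaceDeriv i (flux H i w μ) t x

/-- The source in the equation for the value function. -/
def source (H : Hamiltonian n) (b w μ μ' : SpaceTime n) : SpaceTime n :=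
  fun t x => b t x * μ' t x + projST (Upsilon H b w μ) t x

/-- `(w', μ')` solves the linear equations in which the nonlinear terms are evaluated at
`(w, μ)`. -/
structure IsStep (T : ℝ) (H : Hamiltonian n) (b : SpaceTime n) (wT μ₀ : E n → ℝ)
    (w μ w' μ' : SpaceTime n) : Prop where
  backward : IsBackwardHeat T w' (source H b w μ μ')
  terminal : w' T = wT
  forward : IsHeat T μ' (fun t x => -divFlux H w μ t x)
  initial : μ' 0 = μ₀

/-- The nonlinearities are Lipschitz with constant `ε` on the ball of radius `R`. -/
def IsLipschitzOnBall (T α : ℝ) (H : Hamiltonian n) (b : SpaceTime n) (ε R : ℝ) : Prop :=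
  ∀ w₁ w₂ μ₁ μ₂, IsAdmissible T α R w₁ → IsAdmissible T α R w₂ → IsAdmissible T α R μ₁ →
    IsAdmissible T α R μ₂ →
    stNormVec T α 1 (Theta H w₁ μ₁ - Theta H w₂ μ₂) ≤
      ε * (stNormVec T α 1 (spaceGrad w₁ - spaceGrad w₂) + stNorm T α 2 (μ₁ - μ₂)) ∧
    stNorm T α 0 (projST (Upsilon H b w₁ μ₁) - projST (Upsilon H b w₂ μ₂)) ≤
      ε * (stNormVec T α 1 (spaceGrad w₁ - spaceGrad w₂) + stNorm T α 2 (μ₁ - μ₂))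

section Stability

variable {T α : ℝ} {H : Hamiltonian n} {b : SpaceTime n}

lemma mbar_pos (n : ℕ) : 0 < mbar n := by unfold mbar; positivity

lemma stNormVec_nonneg (T α : ℝ) (j : ℕ) (F : ℝ → E n → E n) : 0 ≤ stNormVec T α j F :=
  Finset.sum_nonneg fun _ _ => stNorm_nonneg _ _ _ _

lemma AssumptionA2.exists_isLipschitzOnBall (hA2 : AssumptionA2 T α H b) {ε : ℝ} (hε : 0 < ε) :
    ∃ R > 0, IsLipschitzOnBall T α H b ε R := by
  obtain ⟨Φ₁, hΦ₁, h₁⟩ := hA2.theta_lipschitz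
  obtain ⟨Φ₂, hΦ₂, h₂⟩ := hA2.upsilon_lipschitz
  obtain ⟨δ₁, hδ₁, hs₁⟩ := hΦ₁.tendsto_zero ε hε
  obtain ⟨δ₂, hδ₂, hs₂⟩ := hΦ₂.tendsto_zero ε hε
  have hm : 0 < min δ₁ δ₂ := lt_min hδ₁ hδ₂
  -- Halving turns the closed ball into the strict inequalities required by the limit at zero.
  refine ⟨min δ₁ δ₂ / 2, by positivity, fun w₁ w₂ μ₁ μ₂ hw₁ hw₂ hμ₁ hμ₂ => ?_⟩
  have hlt : ∀ {f : SpaceTime n}, IsAdmissible T α (min δ₁ δ₂ / 2) f →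
      stNorm T α 2 f < δ₁ ∧ stNorm T α 2 f < δ₂ := fun hf =>
    ⟨by linarith [hf.norm_le, min_le_left δ₁ δ₂], by linarith [hf.norm_le, min_le_right δ₁ δ₂]⟩
  have hnn : 0 ≤ stNormVec T α 1 (spaceGrad w₁ - spaceGrad w₂) + stNorm T α 2 (μ₁ - μ₂) :=
    add_nonneg (stNormVec_nonneg _ _ _ _) (stNorm_nonneg _ _ _ _)
  constructor
  · refine (h₁ w₁ w₂ μ₁ μ₂ hw₁.mem hw₂.mem hμ₁.mem hμ₂.mem).trans ?_
    gcongr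
    exact (le_abs_self _).trans (hs₁ _ _ _ _ hw₁.mem hw₂.mem hμ₁.mem hμ₂.mem (hlt hw₁).1
      (hlt hw₂).1 (hlt hμ₁).1 (hlt hμ₂).1).le
  · refine (h₂ w₁ w₂ μ₁ μ₂ hw₁.mem hw₂.mem hμ₁.mem hμ₂.mem).trans ?_
    gcongr
    exact (le_abs_self _).trans (hs₂ _ _ _ _ hw₁.mem hw₂.mem hμ₁.mem hμ₂.mem (hlt hw₁).2
      (hlt hw₂).2 (hlt hμ₁).2 (hlt hμ₂).2).le

lemma IsLipschitzOnBall.mono {ε R R' : ℝ} (h : IsLipschitzOnBall T α H b ε R) (hR : R' ≤ R) :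
    IsLipschitzOnBall T α H b ε R' := fun _ _ _ _ h₁ h₂ h₃ h₄ =>
  h _ _ _ _ (h₁.mono hR) (h₂.mono hR) (h₃.mono hR) (h₄.mono hR)

lemma isAdmissible_zero (hT : 0 < T) (hα : 0 < α) {ρ : ℝ} (hρ : 0 ≤ ρ) :
    IsAdmissible T α ρ (0 : SpaceTime n) :=
  ⟨memST_zero hT hα, fun _ _ => torusFourierCoeff_zero_fun 0, by rwa [stNorm_zero]⟩

/-- In 2n + 1, the term 2n comes from the gradient and 1 from the density. -/
lemma lipschitz_bound (hT : 0 < T) (hα : 0 < α) {ε : ℝ} (hε : 0 ≤ ε)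
    {w₁ w₂ μ₁ μ₂ : SpaceTime n} (hw₁ : MemST T α 2 w₁) (hw₂ : MemST T α 2 w₂) {d : ℝ}
    (hdw : stNorm T α 2 (w₁ - w₂) ≤ d) (hdμ : stNorm T α 2 (μ₁ - μ₂) ≤ d) :
    ε * (stNormVec T α 1 (spaceGrad w₁ - spaceGrad w₂) + stNorm T α 2 (μ₁ - μ₂)) ≤
      ε * (2 * n + 1) * d := by
  rw [mul_assoc, add_mul, one_mul]
  have := stNormVec_spaceGrad_sub_le hT hα hw₁ hw₂
  gcongr
  exact this.trans (by gcongr)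

lemma AssumptionA2.theta_component_mem (hA2 : AssumptionA2 T α H b) {w μ : SpaceTime n}
    (hw : MemST T α 2 w) (hμ : MemST T α 2 μ) (i : Fin n) :
    MemST T α 1 (fun t x => Theta H w μ t x i) := hA2.theta_mem w μ hw hμ i

lemma memST_add_mbar (hT : 0 < T) (hα : 0 < α) {j : ℕ} {μ : SpaceTime n} (hμ : MemST T α j μ) :
    MemST T α j (fun t x => μ t x + mbar n) :=
  hμ.add hT hα (memST_const hT hα (c := fun _ => mbar n) continuousOn_const)

lemma AssumptionA2.flux_mem (hT : 0 < T) (hα : 0 < α) (hA2 : AssumptionA2 T α H b)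
    {w μ : SpaceTime n} (hw : MemST T α 2 w) (hμ : MemST T α 2 μ) (i : Fin n) :
    MemST T α 1 (flux H i w μ) :=
  ((memST_add_mbar hT hα hμ).mono hT hα one_le_two).mul hT hα le_rfl
    (hA2.theta_component_mem hw hμ i)

lemma AssumptionA2.divFlux_mem (hT : 0 < T) (hα : 0 < α) (hA2 : AssumptionA2 T α H b)
    {w μ : SpaceTime n} (hw : MemST T α 2 w) (hμ : MemST T α 2 μ) :
    MemST T α 0 (divFlux H w μ) :=
  (memST_finset_sum hT hα Finset.univ fun i _ =>
    MemST.spaceDeriv hT hα (hA2.flux_mem hT hα hw hμ i) i).1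

lemma AssumptionA2.source_mem (hT : 0 < T) (hα : 0 < α) (hb : MemST T α 0 b)
    (hA2 : AssumptionA2 T α H b) {w μ μ' : SpaceTime n} (hw : MemST T α 2 w)
    (hμ : MemST T α 2 μ) (hμ' : MemST T α 2 μ') : MemST T α 0 (source H b w μ μ') :=
  (hb.mul hT hα zero_le_one (hμ'.mono hT hα zero_le_two)).add hT hα (hA2.upsilon_mem w μ hw hμ)

/-- The product difference is (μ₁ − μ₂)Θ₁ + μ₂(Θ₁ − Θ₂) + m̄(Θ₁ − Θ₂). With e = ε(2n + 1) these
contribute 2ed, 2ed and m̄ed, where each 2 is the cost of lowering j from 2 to 1. -/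
lemma stNorm_flux_sub_le (hT : 0 < T) (hα : 0 < α) (hA2 : AssumptionA2 T α H b) {ε R : ℝ}
    (hε : 0 ≤ ε) (hR0 : 0 ≤ R) (hR1 : R ≤ 1) (hL : IsLipschitzOnBall T α H b ε R)
    {w₁ w₂ μ₁ μ₂ : SpaceTime n} (hw₁ : IsAdmissible T α R w₁) (hw₂ : IsAdmissible T α R w₂)
    (hμ₁ : IsAdmissible T α R μ₁) (hμ₂ : IsAdmissible T α R μ₂) {d : ℝ}
    (hdw : stNorm T α 2 (w₁ - w₂) ≤ d) (hdμ : stNorm T α 2 (μ₁ - μ₂) ≤ d) (i : Fin n) :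
    stNorm T α 1 (fun t x => flux H i w₁ μ₁ t x - flux H i w₂ μ₂ t x) ≤
      ε * (2 * n + 1) * (4 + mbar n) * d := by
  have hd : 0 ≤ d := (stNorm_nonneg _ _ _ _).trans hdw
  have hm := mbar_pos n
  set e := ε * (2 * n + 1) with he
  have he0 : 0 ≤ e := by positivity
  have hΘ₁ := hA2.theta_component_mem hw₁.mem hμ₁.mem i
  have hΘ₂ := hA2.theta_component_mem hw₂.mem hμ₂.mem i
  have hΘd := hΘ₁.sub hT hα hΘ₂
  have hμd := (hμ₁.mem.sub hT hα hμ₂.mem)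
  have hμd1 := hμd.mono hT hα one_le_two
  have hμ21 := hμ₂.mem.mono hT hα one_le_two
  have hΘdn : stNorm T α 1 (fun t x => Theta H w₁ μ₁ t x i - Theta H w₂ μ₂ t x i) ≤ e * d :=
    (stNorm_le_stNormVec (Theta H w₁ μ₁ - Theta H w₂ μ₂) i).trans
      (((hL _ _ _ _ hw₁ hw₂ hμ₁ hμ₂).1).trans
        (lipschitz_bound hT hα hε hw₁.mem hw₂.mem hdw hdμ))
  -- Θ vanishes at zero, so the Lipschitz bound against zero controls Θ₁ itself by eR ≤ e.
  have hΘn : stNorm T α 1 (fun t x => Theta H w₁ μ₁ t x i) ≤ e := by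
    have h0 := isAdmissible_zero (n := n) hT hα hR0
    have h1 := ((hL _ _ _ _ hw₁ h0 hμ₁ h0).1).trans
      (lipschitz_bound hT hα hε hw₁.mem h0.mem (d := R) (by simpa using hw₁.norm_le)
        (by simpa using hμ₁.norm_le))
    refine le_trans (le_of_eq (stNorm_congr fun t ht => ?_))
      ((stNorm_le_stNormVec (Theta H w₁ μ₁ - Theta H 0 0) i).trans
        (h1.trans (mul_le_of_le_one_right he0 hR1)))
    ext x
    simp [hA2.theta_zero t ht x]
  have hsplit : (fun t x => flux H i w₁ μ₁ t x - flux H i w₂ μ₂ t x) = fun t x =>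
      (μ₁ t x - μ₂ t x) * Theta H w₁ μ₁ t x i +
        (μ₂ t x * (Theta H w₁ μ₁ t x i - Theta H w₂ μ₂ t x i) +
          mbar n * (Theta H w₁ μ₁ t x i - Theta H w₂ μ₂ t x i)) := by
    ext t x
    simp only [flux]
    ring
  rw [hsplit]
  have hA := hμd1.mul hT hα le_rfl hΘ₁
  have hB := hμ21.mul hT hα le_rfl hΘd
  have hC := hΘd.const_mul hT hα (mbar n)
  have hA' : stNorm T α 1 (fun t x => (μ₁ t x - μ₂ t x) * Theta H w₁ μ₁ t x i) ≤ (2 * d) * e := by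
    refine (stNorm_mul_le hT hα le_rfl hμd1 hΘ₁).trans
      (mul_le_mul ((stNorm_mono one_le_two hμd).trans ?_) hΘn (stNorm_nonneg _ _ _ _)
        (by positivity))
    have : stNorm T α 2 (fun t x => μ₁ t x - μ₂ t x) ≤ d := hdμ
    linarith
  have hB' : stNorm T α 1 (fun t x => μ₂ t x * (Theta H w₁ μ₁ t x i - Theta H w₂ μ₂ t x i)) ≤
      2 * (e * d) := by
    refine (stNorm_mul_le hT hα le_rfl hμ21 hΘd).trans
      (mul_le_mul ((stNorm_mono one_le_two hμ₂.mem).trans ?_) hΘdn (stNorm_nonneg _ _ _ _)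
        (by positivity))
    linarith [hμ₂.norm_le]
  have hC' : stNorm T α 1 (fun t x => mbar n * (Theta H w₁ μ₁ t x i - Theta H w₂ μ₂ t x i)) ≤
      mbar n * (e * d) := by
    refine (stNorm_const_mul_le hΘd (mbar n)).trans ?_
    rw [abs_of_pos hm]
    gcongr
  refine (stNorm_add_le hA (hB.add hT hα hC)).trans ?_
  refine (add_le_add hA' ((stNorm_add_le hB hC).trans (add_le_add hB' hC'))).trans (le_of_eq ?_)
  ring

/-- The constant in the estimate for the density. -/
def densityConst (n : ℕ) (T α : ℝ) : ℝ :=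
  gain T α * (n * (2 * ((2 * n + 1) * (4 + mbar n))))

/-- The difference of two steps solves a linear heat equation. `densityConst` collects the smoothing
constant, the n terms of the divergence, a factor 2 per derivative, and the flux constant. -/
lemma IsStep.stNorm_density_sub_le (hT : 0 < T) (hα : α ∈ Ioo 0 (T / 2))
    (hA2 : AssumptionA2 T α H b) {ε R : ℝ} (hε : 0 ≤ ε) (hR0 : 0 ≤ R) (hR1 : R ≤ 1)
    (hL : IsLipschitzOnBall T α H b ε R) {wT₁ μ₀₁ wT₂ μ₀₂ : E n → ℝ}
    {w₁ w₂ μ₁ μ₂ w₁' w₂' μ₁' μ₂' : SpaceTime n}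
    (hw₁ : IsAdmissible T α R w₁) (hw₂ : IsAdmissible T α R w₂)
    (hμ₁ : IsAdmissible T α R μ₁) (hμ₂ : IsAdmissible T α R μ₂) {d : ℝ}
    (hdw : stNorm T α 2 (w₁ - w₂) ≤ d) (hdμ : stNorm T α 2 (μ₁ - μ₂) ≤ d)
    (hμ₁' : MemST T α 2 μ₁') (hμ₂' : MemST T α 2 μ₂') (hz₁ : IsMeanZero T μ₁')
    (hz₂ : IsMeanZero T μ₂') (h₁ : IsStep T H b wT₁ μ₀₁ w₁ μ₁ w₁' μ₁')
    (h₂ : IsStep T H b wT₂ μ₀₂ w₂ μ₂ w₂' μ₂') :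
    stNorm T α 2 (μ₁' - μ₂') ≤ wienerNorm 2 (μ₀₁ - μ₀₂) + densityConst n T α * ε * d := by
  have hT0 : (0 : ℝ) ∈ Icc 0 T := ⟨le_rfl, hT.le⟩
  have hgp := gain_pos hT hα
  have hD₁ := hA2.divFlux_mem hT hα.1 hw₁.mem hμ₁.mem
  have hD₂ := hA2.divFlux_mem hT hα.1 hw₂.mem hμ₂.mem
  have hN₁ := hD₁.neg hT hα.1
  have hN₂ := hD₂.neg hT hα.1
  have hheat := h₁.forward.sub h₂.forward (fun _ ht => hμ₁'.continuous_space ht)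
    (fun _ ht => hμ₂'.continuous_space ht) (fun _ ht => hN₁.continuous_space ht)
    (fun _ ht => hN₂.continuous_space ht)
  have hmz := hz₁.sub hz₂ (fun _ ht => hμ₁'.continuous_space ht)
    (fun _ ht => hμ₂'.continuous_space ht)
  have h0 := (hμ₁'.sub hT hα.1 hμ₂').mem 0 hT0
  have hest := hheat.stNorm_le hT hα hmz h0 (hN₁.sub hT hα.1 hN₂)
  have hinit : (fun x => μ₁' 0 x - μ₂' 0 x) = μ₀₁ - μ₀₂ := by
    rw [h₁.initial, h₂.initial]; rfl
  have hsrc : stNorm T α 0 (fun t x => -divFlux H w₁ μ₁ t x - -divFlux H w₂ μ₂ t x) ≤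
      n * (2 * (ε * (2 * n + 1) * (4 + mbar n) * d)) := by
    have heq : (fun t x => -divFlux H w₁ μ₁ t x - -divFlux H w₂ μ₂ t x) =
        -(fun t x => divFlux H w₁ μ₁ t x - divFlux H w₂ μ₂ t x) := by
      ext t x; simp only [Pi.neg_apply]; ring
    -- The sign is removed by viewing −F as 0 − F and using the symmetry of the norm of a
    -- difference.
    rw [heq, ← zero_sub, stNorm_sub_comm, sub_zero]
    have heq2 : (fun t x => divFlux H w₁ μ₁ t x - divFlux H w₂ μ₂ t x) = fun t x =>
        ∑ i, (spaceDeriv i (flux H i w₁ μ₁) t x - spaceDeriv i (flux H i w₂ μ₂) t x) := by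
      ext t x; simp only [divFlux, Finset.sum_sub_distrib]
    rw [heq2]
    have hf₁ := fun i => hA2.flux_mem hT hα.1 hw₁.mem hμ₁.mem i
    have hf₂ := fun i => hA2.flux_mem hT hα.1 hw₂.mem hμ₂.mem i
    refine (memST_finset_sum hT hα.1 Finset.univ (f := fun i t x =>
      spaceDeriv i (flux H i w₁ μ₁) t x - spaceDeriv i (flux H i w₂ μ₂) t x) fun i _ =>
        (MemST.spaceDeriv hT hα.1 (hf₁ i) i).sub hT hα.1
          (MemST.spaceDeriv hT hα.1 (hf₂ i) i)).2.trans ?_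
    refine (Finset.sum_le_card_nsmul _ _ (2 * (ε * (2 * n + 1) * (4 + mbar n) * d))
      fun i _ => ?_).trans (le_of_eq ?_)
    · refine (stNorm_spaceDeriv_sub_le hT hα.1 (hf₁ i) (hf₂ i) i).trans ?_
      have := stNorm_flux_sub_le hT hα.1 hA2 hε hR0 hR1 hL hw₁ hw₂ hμ₁ hμ₂ hdw hdμ i
      simp only [zero_add]
      linarith
    · simp
  rw [hinit] at hest
  refine hest.trans (add_le_add le_rfl ?_)
  refine (mul_le_mul_of_nonneg_left hsrc hgp.le).trans (le_of_eq ?_)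
  rw [densityConst]
  ring

/-- The coupling bμ' carries no small factor, so its contribution is left in terms of the new
densities, to be closed with the preceding estimate. -/
lemma IsStep.stNorm_value_sub_le (hT : 0 < T) (hα : α ∈ Ioo 0 (T / 2)) (hb : MemST T α 0 b)
    (hA2 : AssumptionA2 T α H b) {ε R : ℝ} (hε : 0 ≤ ε)
    (hL : IsLipschitzOnBall T α H b ε R) {wT₁ μ₀₁ wT₂ μ₀₂ : E n → ℝ}
    {w₁ w₂ μ₁ μ₂ w₁' w₂' μ₁' μ₂' : SpaceTime n}
    (hw₁ : IsAdmissible T α R w₁) (hw₂ : IsAdmissible T α R w₂)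
    (hμ₁ : IsAdmissible T α R μ₁) (hμ₂ : IsAdmissible T α R μ₂) {d : ℝ}
    (hdw : stNorm T α 2 (w₁ - w₂) ≤ d) (hdμ : stNorm T α 2 (μ₁ - μ₂) ≤ d)
    (hw₁' : MemST T α 2 w₁') (hw₂' : MemST T α 2 w₂') (hz₁ : IsMeanZero T w₁')
    (hz₂ : IsMeanZero T w₂')
    (hμ₁' : MemST T α 2 μ₁') (hμ₂' : MemST T α 2 μ₂') (h₁ : IsStep T H b wT₁ μ₀₁ w₁ μ₁ w₁' μ₁')
    (h₂ : IsStep T H b wT₂ μ₀₂ w₂ μ₂ w₂' μ₂') :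
    stNorm T α 2 (w₁' - w₂') ≤ wienerNorm 2 (wT₁ - wT₂) +
      gain T α * (2 * stNorm T α 0 b * stNorm T α 2 (μ₁' - μ₂') + ε * (2 * n + 1) * d) := by
  have hTT : T ∈ Icc 0 T := ⟨hT.le, le_rfl⟩
  have hgp := gain_pos hT hα
  have hS₁ := hA2.source_mem hT hα.1 hb hw₁.mem hμ₁.mem hμ₁'
  have hS₂ := hA2.source_mem hT hα.1 hb hw₂.mem hμ₂.mem hμ₂'
  have hheat := h₁.backward.sub h₂.backward (fun _ ht => hw₁'.continuous_space ht)
    (fun _ ht => hw₂'.continuous_space ht) (fun _ ht => hS₁.continuous_space ht)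
    (fun _ ht => hS₂.continuous_space ht)
  have hmz := hz₁.sub hz₂ (fun _ ht => hw₁'.continuous_space ht)
    (fun _ ht => hw₂'.continuous_space ht)
  have hest := hheat.stNorm_le hT hα hmz ((hw₁'.sub hT hα.1 hw₂').mem T hTT)
    (hS₁.sub hT hα.1 hS₂)
  have hterm : (fun x => w₁' T x - w₂' T x) = wT₁ - wT₂ := by
    rw [h₁.terminal, h₂.terminal]; rfl
  rw [hterm] at hest
  refine hest.trans ?_
  gcongr
  have hsplit : (fun t x => source H b w₁ μ₁ μ₁' t x - source H b w₂ μ₂ μ₂' t x) = fun t x =>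
      b t x * (μ₁' t x - μ₂' t x) +
        (projST (Upsilon H b w₁ μ₁) t x - projST (Upsilon H b w₂ μ₂) t x) := by
    ext t x
    simp only [source]
    ring
  rw [hsplit]
  have hμd := hμ₁'.sub hT hα.1 hμ₂'
  have hμd0 := hμd.mono hT hα.1 zero_le_two
  have hΥ := (hA2.upsilon_mem w₁ μ₁ hw₁.mem hμ₁.mem).sub hT hα.1
    (hA2.upsilon_mem w₂ μ₂ hw₂.mem hμ₂.mem)
  refine (stNorm_add_le (hb.mul hT hα.1 zero_le_one hμd0) hΥ).trans ?_
  refine add_le_add ((stNorm_mul_le hT hα.1 zero_le_one hb hμd0).trans ?_)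
    (((hL _ _ _ _ hw₁ hw₂ hμ₁ hμ₂).2).trans
      (lipschitz_bound hT hα.1 hε hw₁.mem hw₂.mem hdw hdμ))
  have h3 := mul_le_mul_of_nonneg_left (stNorm_mono zero_le_two hμd) (stNorm_nonneg T α 0 b)
  refine h3.trans (le_of_eq ?_)
  change _ = 2 * stNorm T α 0 b * stNorm T α 2 (fun t x => μ₁' t x - μ₂' t x)
  ring

end Stability

/-! ### Classical solutions versus mode equations -/

section HeatEquation

variable {T α : ℝ} {f F : SpaceTime n}

/-- The Fourier coefficients of `Δ f + F`. -/
lemma heat_coeff_bound (hT : 0 < T) (hα : 0 < α) (hf : MemST T α 2 f) (hF : MemST T α 0 F) :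
    ∃ M : (Fin n → ℤ) → ℝ, Summable M ∧ ∀ t ∈ Icc (0 : ℝ) T, ∀ k,
      ‖-(freqNorm k ^ 2 : ℝ) * torusFourierCoeff (f t) k + torusFourierCoeff (F t) k‖ ≤ M k := by
  obtain ⟨M, hM, -, hfM⟩ := hf.exists_majorant
  obtain ⟨N, hN, -, hFN⟩ := hF.exists_majorant
  refine ⟨fun k => M k + N k, hM.add hN, fun t ht k => (norm_add_le _ _).trans (add_le_add ?_ ?_)⟩
  · rw [norm_mul, norm_neg, Complex.norm_real, Real.norm_of_nonneg (sq_nonneg _)]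
    exact freqNorm_pow_mul_norm_le hT hα ht (hfM t ht k)
  · exact norm_le_of_weight_mul_norm_le hT hα ht (hFN t ht k)

lemma laplacian_add_eq_realSeries (hT : 0 < T) (hα : 0 < α) (hf : MemST T α 2 f)
    (hF : MemST T α 0 F) {t : ℝ} (ht : t ∈ Icc 0 T) (x : E n) :
    Δ (f t) x + F t x = realSeries (fun k => -(freqNorm k ^ 2 : ℝ) * torusFourierCoeff (f t) k +
      torusFourierCoeff (F t) k) x := by
  have h1 : Summable fun k => -((freqNorm k ^ 2 : ℝ) : ℂ) * torusFourierCoeff (f t) k := by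
    refine Summable.of_norm ((hf.summable_pow hT hα ht).congr fun k => ?_)
    rw [norm_mul, norm_neg, Complex.norm_real, Real.norm_of_nonneg (sq_nonneg _)]
  rw [hf.laplacian_eq hT hα ht]
  conv_lhs => rw [hF.eq_realSeries ht]
  simp only [realSeries, series, add_mul]
  rw [Summable.tsum_add (summable_series h1 x) (summable_series (hF.summable ht) x), Complex.add_re]

/-- Solutions of the heat equation in Fourier variables are classical solutions. -/
lemma IsHeat.hasDerivWithinAt (hT : 0 < T) (hα : 0 < α) (h : IsHeat T f F) (hf : MemST T α 2 f)
    (hF : MemST T α 0 F) (hfz : IsMeanZero T f) (hFz : IsMeanZero T F) {t : ℝ} (ht : t ∈ Icc 0 T)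
    (x : E n) : HasDerivWithinAt (fun s => f s x) (Δ (f t) x + F t x) (Icc 0 T) t := by
  obtain ⟨M, hM, hbd⟩ := heat_coeff_bound hT hα hf hF
  rw [laplacian_add_eq_realSeries hT hα hf hF ht]
  have h1 := hasDerivWithinAt_realSeries hT hM (y := fun t => torusFourierCoeff (f t))
    (fun k t ht => ?_) (fun k => ?_) hbd (hf.summable ⟨le_rfl, hT.le⟩) x ht
  · exact h1.congr (fun s hs => congrFun (hf.eq_realSeries hs) x)
      (congrFun (hf.eq_realSeries ht) x)
  -- The mode equation says nothing at k = 0; there both f and F have vanishing coefficient.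
  · by_cases hk : k = 0
    · subst hk
      rw [hfz t ht, hFz t ht, mul_zero, add_zero]
      exact (hasDerivWithinAt_const t (Icc 0 T) (0 : ℂ)).congr (fun s hs => hfz s hs) (hfz t ht)
    · exact h k hk t ht
  · exact (continuousOn_const.mul (hf.continuousOn_coeff k)).add (hF.continuousOn_coeff k)

/-- Classical solutions of the heat equation solve the equation for every Fourier mode. -/
lemma hasDerivWithinAt_coeff_of_heat (hT : 0 < T) (hα : 0 < α) (hf : MemST T α 2 f)
    (hF : MemST T α 0 F)
    (h : ∀ t ∈ Icc 0 T, ∀ x, HasDerivWithinAt (fun s => f s x) (Δ (f t) x + F t x) (Icc 0 T) t)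
    (k : Fin n → ℤ) {t : ℝ} (ht : t ∈ Icc 0 T) :
    HasDerivWithinAt (fun s => torusFourierCoeff (f s) k)
      (-(freqNorm k ^ 2 : ℝ) * torusFourierCoeff (f t) k + torusFourierCoeff (F t) k)
      (Icc 0 T) t := by
  obtain ⟨M, hM, hbd⟩ := heat_coeff_bound hT hα hf hF
  refine hasDerivWithinAt_torusFourierCoeff hT hM (g := fun t k =>
    -(freqNorm k ^ 2 : ℝ) * torusFourierCoeff (f t) k + torusFourierCoeff (F t) k)
    (fun t ht x => ?_) (hf.continuous_space ⟨le_rfl, hT.le⟩) (fun k => ?_) hbd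
    (fun _ _ k => ?_) k ht
  · rw [← laplacian_add_eq_realSeries hT hα hf hF ht]
    exact h t ht x
  · exact (continuousOn_const.mul (hf.continuousOn_coeff k)).add (hF.continuousOn_coeff k)
  · have : freqNorm (-k) = freqNorm k := by simp [freqNorm]
    rw [torusFourierCoeff_neg_freq, torusFourierCoeff_neg_freq, this]
    simp

lemma IsMeanZero.reflect (hf : IsMeanZero T f) : IsMeanZero T (fun t => f (T - t)) :=
  fun _ ht => hf _ (reflect_mem ht)

lemma IsBackwardHeat.hasDerivWithinAt (hT : 0 < T) (hα : 0 < α) (h : IsBackwardHeat T f F)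
    (hf : MemST T α 2 f) (hF : MemST T α 0 F) (hfz : IsMeanZero T f) (hFz : IsMeanZero T F)
    {t : ℝ} (ht : t ∈ Icc 0 T) (x : E n) :
    HasDerivWithinAt (fun s => f s x) (-Δ (f t) x - F t x) (Icc 0 T) t := by
  have h1 := h.reflect.hasDerivWithinAt hT hα (hf.reflect hT hα) (hF.reflect hT hα) hfz.reflect
    hFz.reflect (reflect_mem ht) x
  have h2 := hasDerivWithinAt_reflect h1
  simp only [sub_sub_cancel] at h2
  exact h2.congr_deriv (by ring)

lemma hasDerivWithinAt_coeff_of_backwardHeat (hT : 0 < T) (hα : 0 < α) (hf : MemST T α 2 f)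
    (hF : MemST T α 0 F)
    (h : ∀ t ∈ Icc 0 T, ∀ x, HasDerivWithinAt (fun s => f s x) (-Δ (f t) x - F t x) (Icc 0 T) t)
    (k : Fin n → ℤ) {t : ℝ} (ht : t ∈ Icc 0 T) :
    HasDerivWithinAt (fun s => torusFourierCoeff (f s) k)
      ((freqNorm k ^ 2 : ℝ) * torusFourierCoeff (f t) k - torusFourierCoeff (F t) k)
      (Icc 0 T) t := by
  have h1 := hasDerivWithinAt_coeff_of_heat hT hα (hf.reflect hT hα) (hF.reflect hT hα)
    (fun s hs x => (hasDerivWithinAt_reflect (h _ (reflect_mem hs) x)).congr_deriv (by ring))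
    k (reflect_mem ht)
  have h2 := hasDerivWithinAt_reflect h1
  simp only [sub_sub_cancel] at h2
  exact h2.congr_deriv (by ring)

end HeatEquation

/-! ### Regularity and means of the nonlinear terms -/

section Nonlinearity

variable {T α : ℝ} {H : Hamiltonian n} {b : SpaceTime n}

lemma continuousOn_gradient (hT : 0 < T) (hα : 0 < α) {w : SpaceTime n} (hw : MemST T α 2 w) :
    ContinuousOn (fun p : ℝ × E n => ∇ (w p.1) p.2) (Icc 0 T ×ˢ univ) := by
  have h : ∀ i, ContinuousOn (fun p : ℝ × E n => (∇ (w p.1) p.2) i) (Icc 0 T ×ˢ univ) :=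
    fun i => ((MemST.spaceDeriv hT hα (j := 1) hw i).continuousOn_uncurry hT hα).congr
      fun p _ => spaceGrad_apply w p.1 p.2 i
  have h2 := (PiLp.continuous_toLp 2 (fun _ : Fin n => ℝ)).comp_continuousOn
    (continuousOn_pi.mpr h)
  exact h2

/-- The Hamiltonian along a pair of functions. -/
def hamiltonianAlong (H : Hamiltonian n) (w μ : SpaceTime n) : SpaceTime n :=
  fun t x => H t x (∇ (w t) x) (μ t x + mbar n)

lemma IsHamiltonian.continuousOn_along (hT : 0 < T) (hα : 0 < α) (hH : IsHamiltonian T H)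
    {w μ : SpaceTime n} (hw : MemST T α 2 w) (hμ : MemST T α 2 μ) :
    ContinuousOn (fun p : ℝ × E n => hamiltonianAlong H w μ p.1 p.2) (Icc 0 T ×ˢ univ) := by
  have h1 : ContinuousOn (fun p : ℝ × E n => (p.1, p.2, ∇ (w p.1) p.2, μ p.1 p.2 + mbar n))
      (Icc 0 T ×ˢ univ) :=
    continuous_fst.continuousOn.prodMk (continuous_snd.continuousOn.prodMk
      ((continuousOn_gradient hT hα hw).prodMk
        ((hμ.continuousOn_uncurry hT hα).add continuousOn_const)))
  exact hH.continuous.comp h1 fun p hp => ⟨hp.1, mem_univ _⟩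

lemma IsHamiltonian.continuous_along (hT : 0 < T) (hα : 0 < α) (hH : IsHamiltonian T H)
    {w μ : SpaceTime n} (hw : MemST T α 2 w) (hμ : MemST T α 2 μ) {t : ℝ} (ht : t ∈ Icc 0 T) :
    Continuous (hamiltonianAlong H w μ t) :=
  (hH.continuousOn_along hT hα hw hμ).comp_continuous (by fun_prop : Continuous fun x => (t, x))
    fun _ => ⟨ht, mem_univ _⟩

/-- Joint continuity gives a bound on the compact set [0, T] × closed box, and dominated convergence
applies. -/
lemma continuousOn_mean {h : SpaceTime n} (hT : 0 < T)
    (hh : ContinuousOn (fun p : ℝ × E n => h p.1 p.2) (Icc 0 T ×ˢ univ)) :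
    ContinuousOn (fun t => mean (h t)) (Icc 0 T) := by
  have hc : Continuous fun p : ℝ × E n => h (clamp T p.1) p.2 :=
    hh.comp_continuous (f := fun p : ℝ × E n => (clamp T p.1, p.2))
      (((continuous_clamp T).comp continuous_fst).prodMk continuous_snd)
      fun p => ⟨clamp_mem hT _, mem_univ _⟩
  have hK : IsCompact (Icc (0 : ℝ) T ×ˢ (WithLp.toLp 2 ''
      Set.pi univ (fun _ : Fin n => Icc (0 : ℝ) (2 * Real.pi)) : Set (E n))) :=
    isCompact_Icc.prod
      ((isCompact_univ_pi fun _ => isCompact_Icc).image (PiLp.continuous_toLp 2 _))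
  obtain ⟨C, hC⟩ := hK.exists_bound_of_continuousOn hc.continuousOn
  have hint : Continuous fun s => ∫ x in box n, h (clamp T s) x := by
    refine continuous_of_dominated (bound := fun _ => C) (fun s => ?_) (fun s => ?_)
      (integrableOn_box continuous_const) (ae_of_all _ fun x => ?_)
    · exact (hc.comp (by fun_prop : Continuous fun x : E n => (s, x))).aestronglyMeasurable
    · refine (ae_restrict_iff' measurableSet_box).mpr (ae_of_all _ fun x hx => ?_)
      have := hC (clamp T s, x) ⟨clamp_mem hT s,
        ⟨fun i => x i, fun i _ => ⟨(hx i).1, (hx i).2.le⟩, rfl⟩⟩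
      simpa only [clamp_of_mem (clamp_mem hT s)] using this
    · exact hc.comp (by fun_prop : Continuous fun s : ℝ => (s, x))
  refine ((continuous_const (y := mbar n)).mul hint).continuousOn.congr fun t ht => ?_
  simp only [mean, Pi.mul_apply, clamp_of_mem ht]

lemma MemST.projST (hT : 0 < T) (hα : 0 < α) {j : ℕ} {f : SpaceTime n} (hf : MemST T α j f) :
    MemST T α j (projST f) :=
  hf.sub hT hα (memST_const hT hα (continuousOn_mean hT (hf.continuousOn_uncurry hT hα)))

lemma isMeanZero_projST {f : SpaceTime n} (hf : ∀ t ∈ Icc 0 T, Continuous (f t)) :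
    IsMeanZero T (projST f) := fun t ht => torusFourierCoeff_proj_zero (hf t ht)

lemma continuous_upsilon (hT : 0 < T) (hα : 0 < α) (hH : IsHamiltonian T H) (hb : MemST T α 0 b)
    {w μ : SpaceTime n} (hw : MemST T α 2 w) (hμ : MemST T α 2 μ) {t : ℝ} (ht : t ∈ Icc 0 T) :
    Continuous (Upsilon H b w μ t) :=
  (continuous_proj (hH.continuous_along hT hα hw hμ ht)).sub
    ((hb.continuous_space ht).mul (hμ.continuous_space ht))

/-- The source carries ℙΥ where ℙH has Υ; projection changes only the zero mode, which the mode
equations ignore. -/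
lemma torusFourierCoeff_source (hT : 0 < T) (hα : 0 < α) (hH : IsHamiltonian T H)
    (hb : MemST T α 0 b) {w μ : SpaceTime n} (hw : MemST T α 2 w)
    (hμ : MemST T α 2 μ) {t : ℝ} (ht : t ∈ Icc 0 T) {k : Fin n → ℤ} (hk : k ≠ 0) :
    torusFourierCoeff (source H b w μ μ t) k = torusFourierCoeff (Xi H w μ t) k := by
  have h1 := continuous_upsilon hT hα hH hb hw hμ ht
  have h2 : Continuous fun x => b t x * μ t x :=
    (hb.continuous_space ht).mul (hμ.continuous_space ht)
  have h3 : source H b w μ μ t = fun x => b t x * μ t x + proj (Upsilon H b w μ t) x := rfl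
  have h4 : Xi H w μ t = fun x => b t x * μ t x + Upsilon H b w μ t x := by
    ext x; simp only [Upsilon]; ring
  rw [h3, h4, torusFourierCoeff_add h2 (continuous_proj h1), torusFourierCoeff_add h2 h1,
    torusFourierCoeff_proj h1 hk]

/-- (A2) controls only ℙΥ, so the mean of Υ has to be recovered. ℙH has mean zero, hence the mean of
Υ is minus the zero coefficient of the source, which is continuous in time. -/
lemma xi_mem (hT : 0 < T) (hα : 0 < α) (hH : IsHamiltonian T H) (hb : MemST T α 0 b)
    (hA2 : AssumptionA2 T α H b) {w μ : SpaceTime n} (hw : MemST T α 2 w)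
    (hμ : MemST T α 2 μ) : MemST T α 0 (Xi H w μ) := by
  have hs := hA2.source_mem hT hα hb hw hμ hμ
  have hcont : ∀ t ∈ Icc 0 T, Continuous (Xi H w μ t) := fun t ht =>
    continuous_proj (hH.continuous_along hT hα hw hμ ht)
  have hmean : ContinuousOn (fun t => mean (Xi H w μ t - source H b w μ μ t)) (Icc 0 T) := by
    have h1 : ContinuousOn (fun t => torusFourierCoeff (Xi H w μ t - source H b w μ μ t) 0)
        (Icc 0 T) := by
      refine (hs.continuousOn_coeff 0).neg.congr fun t ht => ?_
      rw [torusFourierCoeff_sub' (hcont t ht) (hs.continuous_space ht), Pi.neg_apply,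
        show torusFourierCoeff (Xi H w μ t) 0 = 0 from
          torusFourierCoeff_proj_zero (hH.continuous_along hT hα hw hμ ht), zero_sub]
    refine (Complex.continuous_re.comp_continuousOn h1).congr fun t _ => ?_
    simp [torusFourierCoeff_zero_freq]
  refine (hs.add hT hα (memST_const hT hα hmean)).congr fun t ht => ?_
  ext x
  have h5 : Xi H w μ t = fun x => source H b w μ μ t x + mean (Upsilon H b w μ t) := by
    ext y
    simp only [source, MFG.projST, proj, Upsilon]
    ring
  have h6 : Xi H w μ t - source H b w μ μ t = fun _ => mean (Upsilon H b w μ t) := by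
    ext y
    rw [Pi.sub_apply, h5]
    ring
  rw [h6, mean_const, h5]

lemma along_mem (hT : 0 < T) (hα : 0 < α) (hH : IsHamiltonian T H) (hb : MemST T α 0 b)
    (hA2 : AssumptionA2 T α H b) {w μ : SpaceTime n} (hw : MemST T α 2 w)
    (hμ : MemST T α 2 μ) : MemST T α 0 (hamiltonianAlong H w μ) := by
  refine ((xi_mem hT hα hH hb hA2 hw hμ).add hT hα
    (memST_const hT hα (continuousOn_mean hT (hH.continuousOn_along hT hα hw hμ)))).congr
    fun t ht => ?_
  ext x
  exact (sub_add_cancel _ _).symm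

/-- Conservation of mass: a derivative multiplies the k-th coefficient by a component of ik, which
is zero at k = 0. -/
lemma torusFourierCoeff_divFlux_zero (hT : 0 < T) (hα : 0 < α) (hA2 : AssumptionA2 T α H b)
    {w μ : SpaceTime n} (hw : MemST T α 2 w) (hμ : MemST T α 2 μ) :
    IsMeanZero T (divFlux H w μ) := by
  intro t ht
  have hc : ∀ i, Continuous (spaceDeriv i (flux H i w μ) t) := fun i =>
    (MemST.spaceDeriv hT hα (hA2.flux_mem hT hα hw hμ i) i).continuous_space ht
  have h0 : ∀ i, torusFourierCoeff (spaceDeriv i (flux H i w μ) t) 0 = 0 := by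
    intro i
    rw [(hA2.flux_mem hT hα hw hμ i).torusFourierCoeff_spaceDeriv hT hα ht, derivCoeff,
      iphase_apply, phase_single]
    simp
  have h : ∀ s : Finset (Fin n), Continuous (fun x => ∑ i ∈ s, spaceDeriv i (flux H i w μ) t x) ∧
      torusFourierCoeff (fun x => ∑ i ∈ s, spaceDeriv i (flux H i w μ) t x) 0 = 0 := by
    intro s
    induction s using Finset.induction_on with
    | empty => simpa using ⟨continuous_const, torusFourierCoeff_zero_fun 0⟩
    | insert i s hi ih =>
      simp only [Finset.sum_insert hi]
      refine ⟨(hc i).add ih.1, ?_⟩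
      rw [torusFourierCoeff_add (hc i) ih.1, ih.2, h0, add_zero]
  exact (h Finset.univ).2

lemma divergence_eq_divFlux {w μ : SpaceTime n} {t : ℝ} {V : E n → E n}
    (hV : ∀ x, V x = (μ t x + mbar n) • Theta H w μ t x)
    (hd : Differentiable ℝ V) (x : E n) : divergence V x = divFlux H w μ t x := by
  refine Finset.sum_congr rfl fun i _ => ?_
  have h1 : flux H i w μ t = fun x => V x i := by
    ext y; rw [hV]; simp [flux]
  have h2 : HasFDerivAt (fun y => V y i) ((EuclideanSpace.proj i).comp (fderiv ℝ V x)) x :=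
    (EuclideanSpace.proj (𝕜 := ℝ) i).hasFDerivAt.comp x (hd x).hasFDerivAt
  rw [spaceDeriv, h1, h2.fderiv]
  rfl

lemma differentiable_flux_field (hT : 0 < T) (hα : 0 < α) (hA2 : AssumptionA2 T α H b)
    {w μ : SpaceTime n} (hw : MemST T α 2 w) (hμ : MemST T α 2 μ) {t : ℝ} (ht : t ∈ Icc 0 T) :
    Differentiable ℝ fun x => (μ t x + mbar n) • Theta H w μ t x := by
  rw [differentiable_euclidean]
  intro i
  exact (hA2.flux_mem hT hα hw hμ i).differentiable hT hα (j := 0) ht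

end Nonlinearity

/-! ### Solvability and stability of the linear step -/

section Existence

variable {T α : ℝ} {H : Hamiltonian n} {b : SpaceTime n}

lemma wienerNorm_zero (j : ℕ) : wienerNorm j (0 : E n → ℝ) = 0 := by
  have h : ∀ k, torusFourierCoeff (0 : E n → ℝ) k = 0 := torusFourierCoeff_zero_fun
  simp [wienerNorm_eq_tsum, h]

lemma wienerNorm_nonneg (j : ℕ) (f : E n → ℝ) : 0 ≤ wienerNorm j f := ENNReal.toReal_nonneg

/-- Stability of the linearized step: contraction in the arguments, Lipschitz in the data. -/
lemma exists_stability (hT : 0 < T) (hα : α ∈ Ioo 0 (T / 2)) (hb : MemST T α 0 b)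
    (hA2 : AssumptionA2 T α H b) :
    ∃ R > 0, R ≤ mbar n ∧ ∃ C > 0, ∀ (wT₁ μ₀₁ wT₂ μ₀₂ : E n → ℝ)
      (w₁ μ₁ w₁' μ₁' w₂ μ₂ w₂' μ₂' : SpaceTime n),
      IsAdmissible T α R w₁ → IsAdmissible T α R μ₁ →
      IsAdmissible T α R w₂ → IsAdmissible T α R μ₂ →
      MemST T α 2 w₁' → IsMeanZero T w₁' → MemST T α 2 μ₁' → IsMeanZero T μ₁' →
      MemST T α 2 w₂' → IsMeanZero T w₂' → MemST T α 2 μ₂' → IsMeanZero T μ₂' →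
      IsStep T H b wT₁ μ₀₁ w₁ μ₁ w₁' μ₁' → IsStep T H b wT₂ μ₀₂ w₂ μ₂ w₂' μ₂' →
      max (stNorm T α 2 (w₁' - w₂')) (stNorm T α 2 (μ₁' - μ₂')) ≤
        C * (wienerNorm 2 (wT₁ - wT₂) + wienerNorm 2 (μ₀₁ - μ₀₂)) +
          1 / 2 * max (stNorm T α 2 (w₁ - w₂)) (stNorm T α 2 (μ₁ - μ₂)) := by
  have hgp := gain_pos hT hα
  have hm := mbar_pos n
  set A := densityConst n T α with hA
  have hA0 : 0 ≤ A := by rw [hA, densityConst]; positivity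
  set B := stNorm T α 0 b
  have hB0 : 0 ≤ B := stNorm_nonneg _ _ _ _
  -- K is the coefficient of εd after inserting the density estimate into the value estimate; ε is
  -- then chosen so that Aε and Kε are both at most 1/2.
  set K := gain T α * (2 * B * A + (2 * n + 1)) with hK
  have hK0 : 0 ≤ K := by positivity
  set ε := 1 / (2 * (A + K + 1)) with hε
  have hε0 : 0 < ε := by positivity
  have hAε : A * ε ≤ 1 / 2 := by
    rw [hε, mul_one_div, div_le_div_iff₀ (by positivity) (by norm_num)]
    linarith
  have hKε : K * ε ≤ 1 / 2 := by
    rw [hε, mul_one_div, div_le_div_iff₀ (by positivity) (by norm_num)]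
    linarith
  obtain ⟨R₀, hR₀, hL₀⟩ := hA2.exists_isLipschitzOnBall hε0
  -- R ≤ 1 is used in the flux estimate; R ≤ m̄ will make the density nonnegative.
  set R := min R₀ (min 1 (mbar n)) with hR
  have hR0 : 0 < R := lt_min hR₀ (lt_min one_pos hm)
  have hR1 : R ≤ 1 := (min_le_right _ _).trans (min_le_left _ _)
  have hL := hL₀.mono (min_le_left _ _ : R ≤ R₀)
  refine ⟨R, hR0, (min_le_right _ _).trans (min_le_right _ _), 1 + 2 * gain T α * B,
    by positivity, ?_⟩
  intro wT₁ μ₀₁ wT₂ μ₀₂ w₁ μ₁ w₁' μ₁' w₂ μ₂ w₂' μ₂' hw₁ hμ₁ hw₂ hμ₂ hw₁' hzw₁ hμ₁' hzμ₁ hw₂' hzw₂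
    hμ₂' hzμ₂ h₁ h₂
  set d := max (stNorm T α 2 (w₁ - w₂)) (stNorm T α 2 (μ₁ - μ₂))
  have hd : 0 ≤ d := (stNorm_nonneg _ _ _ _).trans (le_max_left _ _)
  have hDμ := IsStep.stNorm_density_sub_le hT hα hA2 hε0.le hR0.le hR1 hL hw₁ hw₂ hμ₁ hμ₂
    (le_max_left _ _) (le_max_right _ _) hμ₁' hμ₂' hzμ₁ hzμ₂ h₁ h₂
  have hDw := IsStep.stNorm_value_sub_le hT hα hb hA2 hε0.le hL hw₁ hw₂ hμ₁ hμ₂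
    (le_max_left _ _) (le_max_right _ _) hw₁' hw₂' hzw₁ hzw₂ hμ₁' hμ₂' h₁ h₂
  set Dw := wienerNorm 2 (wT₁ - wT₂)
  set Dμ := wienerNorm 2 (μ₀₁ - μ₀₂)
  have hDw0 : 0 ≤ Dw := wienerNorm_nonneg _ _
  have hDμ0 : 0 ≤ Dμ := wienerNorm_nonneg _ _
  have hgB : 0 ≤ 2 * gain T α * B := by positivity
  refine max_le ?_ ?_
  · calc _ ≤ Dw + gain T α * (2 * B * (Dμ + A * ε * d) + ε * (2 * n + 1) * d) := by
          refine hDw.trans ?_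
          gcongr
      _ = Dw + 2 * gain T α * B * Dμ + K * ε * d := by rw [hK]; ring
      _ ≤ (1 + 2 * gain T α * B) * (Dw + Dμ) + 1 / 2 * d := by
          refine add_le_add ?_ (by gcongr)
          nlinarith [mul_nonneg hgB hDw0]
  · calc _ ≤ Dμ + A * ε * d := hDμ
      _ ≤ (1 + 2 * gain T α * B) * (Dw + Dμ) + 1 / 2 * d := by
          refine add_le_add ?_ (by gcongr)
          nlinarith [mul_nonneg hgB hDw0, mul_nonneg hgB hDμ0]

/-- The step is triangular: the density equation does not involve w', so μ' is found first and then
enters the source for w'. -/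
lemma exists_isStep (hT : 0 < T) (hα : α ∈ Ioo 0 (T / 2)) (hb : MemST T α 0 b)
    (hA2 : AssumptionA2 T α H b) {wT μ₀ : E n → ℝ} (hwT : MemB 2 wT)
    (hwT0 : torusFourierCoeff wT 0 = 0) (hμ₀ : MemB 2 μ₀) (hμ₀0 : torusFourierCoeff μ₀ 0 = 0)
    {w μ : SpaceTime n} (hw : MemST T α 2 w) (hμ : MemST T α 2 μ) :
    ∃ w' μ', MemST T α 2 w' ∧ IsMeanZero T w' ∧ MemST T α 2 μ' ∧ IsMeanZero T μ' ∧
      IsStep T H b wT μ₀ w μ w' μ' := by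
  obtain ⟨μ', h1, h2, h3, h4⟩ := exists_isHeat hT hα hμ₀ hμ₀0
    ((hA2.divFlux_mem hT hα.1 hw hμ).neg hT hα.1)
  obtain ⟨w', h5, h6, h7, h8⟩ := exists_isBackwardHeat hT hα hwT hwT0
    (hA2.source_mem hT hα.1 hb hw hμ h1)
  exact ⟨w', μ', h5, h6, h1, h2, h7, h8, h3, h4⟩

/-- The reference solution: stability against it bounds a step by its data, which gives invariance
of the ball. -/
lemma isStep_zero (hA2 : AssumptionA2 T α H b) :
    IsStep T H b (0 : E n → ℝ) 0 0 0 0 0 := by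
  have hsource : ∀ t ∈ Icc 0 T, source H b 0 0 0 t = fun _ => 0 := by
    intro t ht
    have h1 : Upsilon H b 0 0 t = fun _ => 0 := funext (hA2.upsilon_zero t ht)
    ext x
    simp only [source, projST, h1, proj, mean_const]
    simp
  have hdiv : ∀ t ∈ Icc 0 T, divFlux H (0 : SpaceTime n) 0 t = fun _ => 0 := by
    intro t ht
    have h1 : ∀ i, flux H i (0 : SpaceTime n) 0 t = fun _ => 0 := fun i => by
      ext x; simp [flux, hA2.theta_zero t ht x]
    ext x
    simp [divFlux, spaceDeriv, h1]
  have hz : ∀ (t : ℝ) (k : Fin n → ℤ), torusFourierCoeff ((0 : SpaceTime n) t) k = 0 :=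
    fun t k => torusFourierCoeff_zero_fun k
  refine ⟨fun k _ t ht => ?_, rfl, fun k _ t ht => ?_, rfl⟩
  · rw [hsource t ht]
    simp only [hz, torusFourierCoeff_zero_fun, mul_zero, sub_zero]
    exact hasDerivWithinAt_const _ _ _
  · simp only [hdiv t ht, hz, torusFourierCoeff_zero_fun, mul_zero, neg_zero, add_zero]
    exact hasDerivWithinAt_const _ _ _

lemma IsStep.congr {wT μ₀ : E n → ℝ} {w μ w' μ' w'' μ'' : SpaceTime n} (hT : 0 < T)
    (h : IsStep T H b wT μ₀ w μ w' μ') (hw : ∀ t ∈ Icc 0 T, w'' t = w' t)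
    (hμ : ∀ t ∈ Icc 0 T, μ'' t = μ' t) : IsStep T H b wT μ₀ w μ w'' μ'' := by
  refine ⟨fun k hk t ht => ?_, ?_, fun k hk t ht => ?_, ?_⟩
  · have h1 : source H b w μ μ'' t = source H b w μ μ' t := by
      ext x; simp only [source, hμ t ht]
    rw [hw t ht, h1]
    exact (h.backward k hk t ht).congr (fun s hs => by rw [hw s hs]) (by rw [hw t ht])
  · rw [hw T ⟨hT.le, le_rfl⟩, h.terminal]
  · rw [hμ t ht]
    exact (h.forward k hk t ht).congr (fun s hs => by rw [hμ s hs]) (by rw [hμ t ht])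
  · rw [hμ 0 ⟨le_rfl, hT.le⟩, h.initial]

end Existence

/-! ### Fixed points and strong solutions -/

section StrongSolution

variable {T α : ℝ} {H : Hamiltonian n} {b : SpaceTime n}

lemma gradient_add_const (f : E n → ℝ) (c : ℝ) (x : E n) : ∇ (fun y => f y + c) x = ∇ f x := by
  rw [gradient, gradient, fderiv_add_const]

lemma laplacian_add_const {f : E n → ℝ} (hf : ContDiff ℝ 2 f) (c : ℝ) (x : E n) :
    Δ (fun y => f y + c) x = Δ f x := by
  have h := hf.contDiffAt (x := x).laplacian_add (contDiffAt_const (c := c))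
  rw [InnerProductSpace.laplacian_const, Pi.zero_apply, add_zero] at h
  exact h

/-- The mean of the value function. -/
def valueMean (T : ℝ) (H : Hamiltonian n) (uT : E n → ℝ) (w μ : SpaceTime n) (t : ℝ) : ℝ :=
  mean uT + (timePrimitive T (fun s => mean (hamiltonianAlong H w μ s)) T -
    timePrimitive T (fun s => mean (hamiltonianAlong H w μ s)) t)

lemma hasDerivWithinAt_valueMean (hT : 0 < T) (hα : 0 < α) (hH : IsHamiltonian T H)
    (uT : E n → ℝ) {w μ : SpaceTime n} (hw : MemST T α 2 w) (hμ : MemST T α 2 μ) {t : ℝ}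
    (ht : t ∈ Icc 0 T) :
    HasDerivWithinAt (valueMean T H uT w μ) (-mean (hamiltonianAlong H w μ t)) (Icc 0 T) t := by
  have h1 := hasDerivWithinAt_timePrimitive hT
    (continuousOn_mean hT (hH.continuousOn_along hT hα hw hμ)) ht
  exact (h1.const_sub _).const_add _

/-- Fixed points of the linearized step are strong solutions, once the mean of the value function
is added. -/
lemma IsStep.isStrongSolution (hT : 0 < T) (hα : 0 < α) (hH : IsHamiltonian T H)
    (hb : MemST T α 0 b) (hA2 : AssumptionA2 T α H b) {uT m₀ : E n → ℝ} {w μ : SpaceTime n}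
    (hw : MemST T α 2 w) (hwz : IsMeanZero T w) (hμ : MemST T α 2 μ) (hμz : IsMeanZero T μ)
    (h : IsStep T H b (proj uT) (fun x => m₀ x - mbar n) w μ w μ) :
    IsStrongSolution T H uT m₀ (fun t x => w t x + valueMean T H uT w μ t)
      (fun t x => μ t x + mbar n) := by
  have hV : ∀ t, (fun x => (μ t x + mbar n) •
      Hp H t x (∇ (fun y => w t y + valueMean T H uT w μ t) x) (μ t x + mbar n)) =
      fun x => (μ t x + mbar n) • Theta H w μ t x := by
    intro t
    ext1 x
    rw [gradient_add_const]
    rfl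
  have hd := fun t ht => differentiable_flux_field hT hα hA2 hw hμ (t := t) ht
  have hXi := xi_mem hT hα hH hb hA2 hw hμ
  -- Replacing the source by ℙH, which has mean zero, makes the equation valid on the zero mode too
  -- and hence pointwise.
  have hback : IsBackwardHeat T w (Xi H w μ) := by
    intro k hk t ht
    rw [← torusFourierCoeff_source hT hα hH hb hw hμ ht hk]
    exact h.backward k hk t ht
  have hXiz : IsMeanZero T (Xi H w μ) :=
    isMeanZero_projST fun t ht => hH.continuous_along hT hα hw hμ ht
  have hD := hA2.divFlux_mem hT hα hw hμ
  have hDz : IsMeanZero T (fun t x => -divFlux H w μ t x) := by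
    intro t ht
    have h1 := torusFourierCoeff_const_mul (-1) (divFlux H w μ t) 0
    rw [torusFourierCoeff_divFlux_zero hT hα hA2 hw hμ t ht, mul_zero] at h1
    simpa only [neg_one_mul] using h1
  refine ⟨fun t ht => (hw.contDiff hT hα ht).add contDiff_const,
    fun t ht => (hμ.contDiff hT hα ht).add contDiff_const, fun t ht => ?_, fun t ht x => ?_,
    fun t ht x => ?_, ?_, ?_⟩
  · rw [hV]
    exact hd t ht
  · have h1 := hback.hasDerivWithinAt hT hα hw hXi hwz hXiz ht x
    -- The derivative of the mean restores the mean of H that ℙ removed.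
    have h2 := h1.add (hasDerivWithinAt_valueMean hT hα hH uT hw hμ ht)
    refine h2.congr_deriv ?_
    rw [laplacian_add_const (hw.contDiff hT hα ht), gradient_add_const]
    have h3 : Xi H w μ t x = H t x (∇ (w t) x) (μ t x + mbar n) -
      mean (hamiltonianAlong H w μ t) := rfl
    rw [h3]
    ring
  · have h1 := h.forward.hasDerivWithinAt hT hα hμ (hD.neg hT hα) hμz hDz ht x
    refine (h1.add_const (mbar n)).congr_deriv ?_
    rw [laplacian_add_const (hμ.contDiff hT hα ht), hV t,
      divergence_eq_divFlux (fun _ => rfl) (hd t ht), sub_eq_add_neg]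
  · ext x
    simp only [h.initial]
    ring
  · ext x
    simp only [h.terminal, valueMean, proj]
    ring

/-- Strong solutions are fixed points of the linearized step. -/
lemma IsStrongSolution.isStep (hT : 0 < T) (hα : 0 < α) (hH : IsHamiltonian T H)
    (hb : MemST T α 0 b) (hA2 : AssumptionA2 T α H b) {uT m₀ : E n → ℝ} {u m : SpaceTime n}
    (hu : MemST T α 2 u) (hm : MemST T α 2 m) (h : IsStrongSolution T H uT m₀ u m)
    (hm₀ : torusFourierCoeff (fun x => m₀ x - mbar n) 0 = 0) :
    IsMeanZero T (fun t x => m t x - mbar n) ∧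
    IsStep T H b (proj uT) (fun x => m₀ x - mbar n) (projST u) (fun t x => m t x - mbar n)
      (projST u) (fun t x => m t x - mbar n) := by
  set w := projST u with hwdef
  set μ : SpaceTime n := fun t x => m t x - mbar n with hμdef
  have hw : MemST T α 2 w := hu.projST hT hα
  have hμ : MemST T α 2 μ :=
    hm.sub hT hα (memST_const hT hα (c := fun _ => mbar n) continuousOn_const)
  have huw : ∀ t, u t = fun x => w t x + mean (u t) := fun t => by
    ext x; simp [hwdef, projST, proj]
  have hgrad : ∀ t x, ∇ (u t) x = ∇ (w t) x := fun t x => by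
    conv_lhs => rw [huw t]
    exact gradient_add_const _ _ _
  have hmμ : ∀ t, m t = fun x => μ t x + mbar n := fun t => by ext x; simp [hμdef]
  have hV : ∀ t x, m t x • Hp H t x (∇ (u t) x) (m t x) =
      (μ t x + mbar n) • Theta H w μ t x := fun t x => by
    rw [hgrad, hmμ t]
    rfl
  have hD := hA2.divFlux_mem hT hα hw hμ
  have hmu_eq : ∀ t ∈ Icc 0 T, ∀ x, HasDerivWithinAt (fun s => μ s x)
      (Δ (μ t) x + -divFlux H w μ t x) (Icc 0 T) t := by
    intro t ht x
    refine ((h.m_equation t ht x).sub_const (mbar n)).congr_deriv ?_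
    rw [divergence_eq_divFlux (hV t) (h.differentiable_flux t ht), sub_eq_add_neg]
    congr 1
    conv_lhs => rw [hmμ t]
    exact laplacian_add_const (hμ.contDiff hT hα ht) _ x
  have hcoef := fun k t ht => hasDerivWithinAt_coeff_of_heat hT hα hμ (hD.neg hT hα) hmu_eq k
    (t := t) ht
  have hinit : μ 0 = fun x => m₀ x - mbar n := by rw [hμdef]; simp only [h.initial]
  have hterm : w T = proj uT := by rw [hwdef, projST, h.terminal]
  have hDz : IsMeanZero T (fun t x => -divFlux H w μ t x) := by
    intro t ht
    have h1 := torusFourierCoeff_const_mul (-1) (divFlux H w μ t) 0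
    rw [torusFourierCoeff_divFlux_zero hT hα hA2 hw hμ t ht, mul_zero] at h1
    simpa only [neg_one_mul] using h1
  -- On the zero mode the Laplacian and the divergence both vanish, so the coefficient stays at its
  -- initial value zero.
  have hμz : IsMeanZero T μ := by
    intro t ht
    have h0 : ∀ t ∈ Icc 0 T, HasDerivWithinAt (fun s => torusFourierCoeff (μ s) 0)
        (0 : ℂ) (Icc 0 T) t := by
      intro t ht
      refine (hcoef 0 t ht).congr_deriv ?_
      rw [hDz t ht]
      simp [freqNorm]
    have h1 := eq_of_hasDerivWithinAt_eq h0
      (fun t _ => hasDerivWithinAt_const t (Icc 0 T) (0 : ℂ)) ht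
    rw [hinit, hm₀] at h1
    simpa using h1
  have hu_eq : ∀ t ∈ Icc 0 T, ∀ x, HasDerivWithinAt (fun s => u s x)
      (-Δ (u t) x - hamiltonianAlong H w μ t x) (Icc 0 T) t := by
    intro t ht x
    refine (h.u_equation t ht x).congr_deriv ?_
    rw [hgrad, hmμ t]
    rfl
  refine ⟨hμz, fun k hk t ht => ?_, hterm, fun k _ t ht => hcoef k t ht, hinit⟩
  -- The mode equations are taken from u, whose time derivative is given; its nonzero modes are
  -- those of w.
  have h1 := hasDerivWithinAt_coeff_of_backwardHeat hT hα hu (along_mem hT hα hH hb hA2 hw hμ)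
    hu_eq k ht
  have h2 : ∀ s ∈ Icc 0 T, torusFourierCoeff (w s) k = torusFourierCoeff (u s) k :=
    fun s hs => torusFourierCoeff_proj (hu.continuous_space hs) hk
  refine (h1.congr h2 (h2 t ht)).congr_deriv ?_
  rw [h2 t ht, torusFourierCoeff_source hT hα hH hb hw hμ ht hk]
  congr 1
  exact (torusFourierCoeff_proj (hH.continuous_along hT hα hw hμ ht) hk).symm

lemma eq_of_stNorm_sub_le_zero (hT : 0 < T) (hα : 0 < α) {j : ℕ} {f g : SpaceTime n}
    (hf : MemST T α j f) (hg : MemST T α j g) (h : stNorm T α j (f - g) ≤ 0) {t : ℝ}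
    (ht : t ∈ Icc 0 T) : f t = g t := by
  ext x
  have h1 := ((hf.sub hT hα hg).abs_le hT hα ht x).trans h
  have h2 := abs_nonpos_iff.mp h1
  linarith

/-- Strong solutions with the same value gradient and density have the same value function. -/
lemma IsStrongSolution.value_unique (hT : 0 < T) {uT m₀ : E n → ℝ} {u m u' m' : SpaceTime n}
    (h : IsStrongSolution T H uT m₀ u m) (h' : IsStrongSolution T H uT m₀ u' m')
    (hu : ∀ t ∈ Icc 0 T, projST u t = projST u' t) (hm : ∀ t ∈ Icc 0 T, m t = m' t) {t : ℝ}
    (ht : t ∈ Icc 0 T) : u t = u' t := by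
  ext x
  -- The two value functions differ by a function of time alone, so their equations have equal
  -- right-hand sides; the common terminal value then forces equality.
  have huc : ∀ s ∈ Icc 0 T, u s = fun y => u' s y + (mean (u s) - mean (u' s)) := by
    intro s hs
    ext y
    have := congrFun (hu s hs) y
    simp only [projST, proj] at this
    linarith
  have h1 : ∀ s ∈ Icc 0 T, HasDerivWithinAt (fun r => u r x)
      (-(Δ (u' s)) x - H s x (∇ (u' s) x) (m' s x)) (Icc 0 T) s := by
    intro s hs
    refine (h.u_equation s hs x).congr_deriv ?_
    have h2 : Δ (u s) x = Δ (u' s) x := by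
      conv_lhs => rw [huc s hs]
      exact laplacian_add_const (h'.contDiff_u s hs) _ x
    have h3 : ∇ (u s) x = ∇ (u' s) x := by
      conv_lhs => rw [huc s hs]
      exact gradient_add_const _ _ x
    rw [h2, h3, hm s hs]
  have h2 := fun t ht => eq_of_hasDerivWithinAt_eq h1 (fun s hs => h'.u_equation s hs x)
    (t := t) ht
  have h3 := h2 T ⟨hT.le, le_rfl⟩
  rw [h.terminal, h'.terminal, sub_self] at h3
  have h4 := h2 t ht
  linarith

end StrongSolution

/-! ### Mass and sign of the density -/

section Density

variable {T α : ℝ}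

lemma IsProbabilityDensity.torusFourierCoeff_sub_mbar {m₀ : E n → ℝ}
    (h : IsProbabilityDensity m₀) (hc : Continuous m₀) :
    torusFourierCoeff (fun x => m₀ x - mbar n) 0 = 0 := by
  rw [torusFourierCoeff_sub hc continuous_const, torusFourierCoeff_const, Pi.single_eq_same,
    torusFourierCoeff_zero_freq, mean, h.2.2, mul_one, sub_self]

lemma isProbabilityDensity_add_mbar {f : E n → ℝ} (hc : Continuous f)
    (h0 : torusFourierCoeff f 0 = 0) (hle : ∀ x, |f x| ≤ mbar n) :
    IsProbabilityDensity (fun x => f x + mbar n) := by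
  have hc' : Continuous fun x => f x + mbar n := hc.add continuous_const
  refine ⟨fun x => ?_, integrableOn_box hc', ?_⟩
  · have := (abs_le.mp (hle x)).1
    linarith
  · have h1 : torusFourierCoeff (fun x => f x + mbar n) 0 = mbar n := by
      rw [torusFourierCoeff_add hc continuous_const, torusFourierCoeff_const, Pi.single_eq_same,
        h0, zero_add]
    rw [torusFourierCoeff_zero_freq, mean] at h1
    have h2 : mbar n * ∫ x in box n, (f x + mbar n) = mbar n := by exact_mod_cast h1
    exact mul_left_cancel₀ (mbar_pos n).ne' (h2.trans (mul_one _).symm)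

end Density

/-! ### Fixed points for small data -/

section FixedPoint

variable {T α : ℝ} {H : Hamiltonian n} {b : SpaceTime n}

/-- For small data the linearized step has a small fixed point, and fixed points are unique in a
larger ball. -/
lemma exists_fixedPoint_isStep (hT : 0 < T) (hα : α ∈ Ioo 0 (T / 2)) (hb : MemST T α 0 b)
    (hA2 : AssumptionA2 T α H b) :
    ∃ δ > 0, ∃ r > 0, r ≤ mbar n ∧ ∀ wT μ₀ : E n → ℝ, MemB 2 wT → torusFourierCoeff wT 0 = 0 →
      MemB 2 μ₀ → torusFourierCoeff μ₀ 0 = 0 → wienerNorm 2 wT + wienerNorm 2 μ₀ < δ →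
      ∃ w μ, IsAdmissible T α (r / 4) w ∧ IsAdmissible T α (r / 4) μ ∧
        IsStep T H b wT μ₀ w μ w μ ∧
        ∀ w' μ', IsAdmissible T α r w' → IsAdmissible T α r μ' → IsStep T H b wT μ₀ w' μ' w' μ' →
          ∀ t ∈ Icc 0 T, w' t = w t ∧ μ' t = μ t := by
  obtain ⟨R, hR, hRm, C, hC, hst⟩ := exists_stability hT hα hb hA2
  have hR4 : R / 4 ≤ R := by linarith
  -- With this δ the data contribute at most R/8, and contraction of the ball of radius R/4
  -- contributes another R/8, so that ball is invariant. Uniqueness uses the full radius R.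
  refine ⟨R / (8 * C), by positivity, R, hR, hRm, fun wT μ₀ hwT hwT0 hμ₀ hμ₀0 hsmall => ?_⟩
  have hCsmall : C * (wienerNorm 2 wT + wienerNorm 2 μ₀) ≤ R / 8 := by
    calc _ ≤ C * (R / (8 * C)) := by gcongr
      _ = R / 8 := by field_simp
  have hz := isAdmissible_zero (n := n) hT hα.1 hR.le
  have hself : ∀ w₁ μ₁ w₁' μ₁' w₂ μ₂ w₂' μ₂',
      IsAdmissible T α R w₁ → IsAdmissible T α R μ₁ → IsAdmissible T α R w₁' →
      IsAdmissible T α R μ₁' → IsAdmissible T α R w₂ → IsAdmissible T α R μ₂ →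
      IsAdmissible T α R w₂' → IsAdmissible T α R μ₂' →
      IsStep T H b wT μ₀ w₁ μ₁ w₁' μ₁' → IsStep T H b wT μ₀ w₂ μ₂ w₂' μ₂' →
      max (stNorm T α 2 (w₁' - w₂')) (stNorm T α 2 (μ₁' - μ₂')) ≤
        1 / 2 * max (stNorm T α 2 (w₁ - w₂)) (stNorm T α 2 (μ₁ - μ₂)) := by
    intro w₁ μ₁ w₁' μ₁' w₂ μ₂ w₂' μ₂' hw₁ hμ₁ hw₁' hμ₁' hw₂ hμ₂ hw₂' hμ₂' h₁ h₂
    have h := hst _ _ _ _ _ _ _ _ _ _ _ _ hw₁ hμ₁ hw₂ hμ₂ hw₁'.mem hw₁'.meanZero hμ₁'.mem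
      hμ₁'.meanZero hw₂'.mem hw₂'.meanZero hμ₂'.mem hμ₂'.meanZero h₁ h₂
    simpa only [sub_self, wienerNorm_zero, add_zero, mul_zero, zero_add] using h
  have hex : ∀ w μ, IsAdmissible T α (R / 4) w → IsAdmissible T α (R / 4) μ →
      ∃ w' μ', IsAdmissible T α (R / 4) w' ∧ IsAdmissible T α (R / 4) μ' ∧
        IsStep T H b wT μ₀ w μ w' μ' := by
    intro w μ hw hμ
    obtain ⟨w', μ', hw', hwz, hμ', hμz, h⟩ :=
      exists_isStep hT hα hb hA2 hwT hwT0 hμ₀ hμ₀0 hw.mem hμ.mem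
    -- Stability against the zero step with zero data.
    have h1 := hst _ _ _ _ _ _ _ _ _ _ _ _ (hw.mono hR4) (hμ.mono hR4) hz hz hw' hwz hμ' hμz
      hz.mem hz.meanZero hz.mem hz.meanZero h (isStep_zero hA2)
    simp only [sub_zero] at h1
    have h2 := max_le hw.norm_le hμ.norm_le
    have h3 : max (stNorm T α 2 w') (stNorm T α 2 μ') ≤ R / 4 := by linarith
    exact ⟨w', μ', ⟨hw', hwz, (le_max_left _ _).trans h3⟩, ⟨hμ', hμz, (le_max_right _ _).trans h3⟩,
      h⟩
  obtain ⟨w, μ, hw, hμ, hwμ⟩ := exists_fixedPoint_of_contracting hT hα.1 (ρ := R / 4)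
    (by positivity) (P := IsStep T H b wT μ₀) hex
    (fun _ _ _ _ _ _ h hw hμ => h.congr hT hw hμ)
    (fun _ _ _ _ _ _ _ _ h1 h2 h3 h4 h5 h6 h7 h8 => hself _ _ _ _ _ _ _ _ (h1.mono hR4)
      (h2.mono hR4) (h3.mono hR4) (h4.mono hR4) (h5.mono hR4) (h6.mono hR4) (h7.mono hR4)
      (h8.mono hR4))
  refine ⟨w, μ, hw, hμ, hwμ, fun w' μ' hw' hμ' h => ?_⟩
  have h1 := hself _ _ _ _ _ _ _ _ hw' hμ' hw' hμ' (hw.mono hR4) (hμ.mono hR4) (hw.mono hR4)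
    (hμ.mono hR4) h hwμ
  -- The distance between two fixed points is at most half of itself.
  have h2 : max (stNorm T α 2 (w' - w)) (stNorm T α 2 (μ' - μ)) ≤ 0 := by linarith
  exact fun t ht =>
    ⟨eq_of_stNorm_sub_le_zero hT hα.1 hw'.mem hw.mem ((le_max_left _ _).trans h2) ht,
      eq_of_stNorm_sub_le_zero hT hα.1 hμ'.mem hμ.mem ((le_max_right _ _).trans h2) ht⟩

lemma memST_add_valueMean (hT : 0 < T) (hα : 0 < α) (hH : IsHamiltonian T H) (uT : E n → ℝ)
    {w μ : SpaceTime n} (hw : MemST T α 2 w) (hμ : MemST T α 2 μ) :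
    MemST T α 2 (fun t x => w t x + valueMean T H uT w μ t) :=
  hw.add hT hα (memST_const hT hα fun _ ht =>
    (hasDerivWithinAt_valueMean hT hα hH uT hw hμ ht).continuousWithinAt)

lemma projST_add_valueMean {uT : E n → ℝ} {w μ : SpaceTime n} (hw : IsMeanZero T w)
    (hwc : ∀ t ∈ Icc 0 T, Continuous (w t)) {t : ℝ} (ht : t ∈ Icc 0 T) :
    projST (fun t x => w t x + valueMean T H uT w μ t) t = w t := by
  have h : mean (fun x => w t x + valueMean T H uT w μ t) = valueMean T H uT w μ t := by
    have h1 := torusFourierCoeff_add (hwc t ht)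
      (continuous_const (y := valueMean T H uT w μ t)) 0
    rw [hw t ht, zero_add, torusFourierCoeff_const, Pi.single_eq_same,
      torusFourierCoeff_zero_freq] at h1
    exact_mod_cast h1
  ext x
  simp only [projST, proj, h, add_sub_cancel_right]

end FixedPoint

end MFG

end

/-! ### Proof of the theorem -/

theorem theorem2 {n : ℕ} (hn : 1 ≤ n) (T α : ℝ) (hT : 0 < T) (hα : α ∈ Set.Ioo (0 : ℝ) (T / 2))
    (H : MFG.Hamiltonian n) (hH : MFG.IsHamiltonian T H)
    (b : MFG.SpaceTime n) (hb : MFG.MemST T α 0 b) (hA2 : MFG.AssumptionA2 T α H b) :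
    ∃ δ > 0, ∃ r > 0, ∀ uT m₀ : MFG.E n → ℝ,
      MFG.IsProbabilityDensity m₀ →
      MFG.MemB 2 (MFG.proj uT) → MFG.MemB 2 (fun x => m₀ x - MFG.mbar n) →
      MFG.wienerNorm 2 (MFG.proj uT) + MFG.wienerNorm 2 (fun x => m₀ x - MFG.mbar n) < δ →
      ∃ u m : MFG.SpaceTime n,
        MFG.MemST T α 2 u ∧ MFG.MemST T α 2 m ∧
        MFG.IsStrongSolution T H uT m₀ u m ∧
        MFG.stNorm T α 2 (MFG.projST u) +
          MFG.stNorm T α 2 (fun t x => m t x - MFG.mbar n) < r ∧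
        (∀ u' m' : MFG.SpaceTime n,
          MFG.MemST T α 2 u' → MFG.MemST T α 2 m' →
          MFG.IsStrongSolution T H uT m₀ u' m' →
          MFG.stNorm T α 2 (MFG.projST u') +
            MFG.stNorm T α 2 (fun t x => m' t x - MFG.mbar n) < r →
          ∀ t ∈ Set.Icc (0 : ℝ) T, u' t = u t ∧ m' t = m t) ∧
        (∀ t ∈ Set.Ioo (0 : ℝ) T,
          AnalyticOnNhd ℝ (u t) Set.univ ∧ AnalyticOnNhd ℝ (m t) Set.univ) ∧
        (∀ t ∈ Set.Icc (0 : ℝ) T, MFG.IsProbabilityDensity (m t)) := by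
  open MFG in
  obtain ⟨δ, hδ, r, hr, hrm, hfix⟩ := exists_fixedPoint_isStep hT hα hb hA2
  refine ⟨δ, hδ, r, hr, fun uT m₀ hm₀ huT hμ₀ hsmall => ?_⟩
  have hm₀c : Continuous m₀ := by
    simpa only [sub_add_cancel] using hμ₀.continuous.fun_add (continuous_const (y := mbar n))
  have hμ₀0 := hm₀.torusFourierCoeff_sub_mbar hm₀c
  obtain ⟨w, μ, hw, hμ, hstep, huniq⟩ := hfix (proj uT) _ huT
    (torusFourierCoeff_proj_zero (continuous_of_proj huT.continuous)) hμ₀ hμ₀0 hsmall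
  set u : SpaceTime n := fun t x => w t x + valueMean T H uT w μ t with hu
  set m : SpaceTime n := fun t x => μ t x + mbar n with hm
  have hsol : IsStrongSolution T H uT m₀ u m :=
    hstep.isStrongSolution hT hα.1 hH hb hA2 hw.mem hw.meanZero hμ.mem hμ.meanZero
  have huS : MemST T α 2 u := memST_add_valueMean hT hα.1 hH uT hw.mem hμ.mem
  have hmS : MemST T α 2 m := memST_add_mbar hT hα.1 hμ.mem
  have hpu : ∀ t ∈ Set.Icc 0 T, projST u t = w t := fun t ht =>
    projST_add_valueMean hw.meanZero (fun t ht => hw.mem.continuous_space ht) ht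
  have hmμ : (fun t x => m t x - mbar n) = μ := by ext t x; simp [hm]
  refine ⟨u, m, huS, hmS, hsol, ?_, ?_, fun t ht => ⟨huS.analyticOnNhd hT hα.1 ht,
    hmS.analyticOnNhd hT hα.1 ht⟩, fun t ht => ?_⟩
  · rw [stNorm_congr hpu, hmμ]
    -- Each norm is at most r/4, so the sum is strictly below r.
    linarith [hw.norm_le, hμ.norm_le]
  · intro u' m' hu' hm' hsol' hnorm t ht
    have h1 := stNorm_nonneg T α 2 (projST u')
    have h2 := stNorm_nonneg T α 2 (fun t x => m' t x - mbar n)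
    obtain ⟨hz', hstep'⟩ := hsol'.isStep hT hα.1 hH hb hA2 hu' hm' hμ₀0
    -- A bound r on the sum of the two norms bounds each of them, so the competitor lies in the
    -- uniqueness ball.
    have huniq' := huniq _ _
      ⟨hu'.projST hT hα.1, isMeanZero_projST fun t ht => hu'.continuous_space ht, by linarith⟩
      ⟨hm'.sub hT hα.1 (memST_const hT hα.1 (c := fun _ => mbar n) continuousOn_const), hz',
        by linarith⟩ hstep'
    have hmm : ∀ t ∈ Set.Icc 0 T, m' t = m t := fun t ht => by
      ext x
      have := congrFun (huniq' t ht).2 x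
      simp only [hm]
      linarith
    exact ⟨hsol'.value_unique hT hsol (fun t ht => ((huniq' t ht).1).trans (hpu t ht).symm) hmm ht,
      hmm t ht⟩
  -- Pointwise |μ| ≤ r/4 ≤ m̄, and μ has mean zero.
  · exact isProbabilityDensity_add_mbar (hμ.mem.continuous_space ht) (hμ.meanZero t ht) fun x =>
      (hμ.mem.abs_le hT hα.1 ht x).trans (by linarith [hμ.norm_le])
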